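/- **Theorem 53.** Write $\mathbb N=\{0,1,2,\dots\}$ and fix $\rho>0$. There is a function $L$ of finite lists of natural numbers, depending only on $\rho$, such that the following holds. Let $(k_n)_{n\in\mathbb N}$, $(l_n)_{n\in\mathbb N}$, $(s_n)_{n\in\mathbb N}$ be sequences of natural numbers tending to infinity, and put $q_0=1$, $p_0=0$, $q_{n+1}=k_nl_nq_n^2$, $p_{n+1}=p_nk_nl_nq_n+1$. Assume for all $n$ that 1. $l_n\ge L(k_0,\dots,k_n;\,l_0,\dots,l_{n-1};\,s_0,\dots,s_{n+1})$ (that is, $l_n$ grows sufficiently fast); 2. $k_n=2^{n+2}q_nC_n$ for some integer $C_n\ge 1$; 3. $s_n$ divides both $k_n$ and $s_{n+1}$. For each $n$ let $j_i\in\{0,\dots,q_n-1\}$ satisfy $j_i\equiv p_n^{-1}i\pmod{q_n}$ ($j_i=0$ if $n=0$). For $0\le i<2^{n+1}q_n$ put $\psi_n(i)=0$ if $i$ is even and $\psi_n(i)=j_{(i+1)/2 \bmod q_n}$ if $i$ is odd; for $2^{n+1}q_n\le i<2^{n+2}q_n$ put $\psi_n(i)=j_{(i/2+1)\bmod q_n}$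 if $i$ is even and $\psi_n(i)=j_1$ if $i$ is odd. With $t_{m,i}\in\{0,\dots,q_n-1\}$ the residue of $\psi_n(i)+j_m$ modulo $q_n$, the twisting operator (products and powers denote concatenation of words) is $$\mathcal C_n^{\mathrm{twist}}(w_0,\dots,w_{k_n-1})=\prod_{m=0}^{q_n-1}\ \prod_{i=0}^{2^{n+2}q_n-1}\ \prod_{c=0}^{C_n-1} b^{\,q_n-t_{m,i}}\,(w_{iC_n+c})^{l_n-1}\,e^{\,t_{m,i}} .$$ Let $\Sigma$ be a finite non-empty alphabet, $b,e\notin\Sigma$, and let $(\mathcal W_n)_{n\in\mathbb N}$ be a twisted construction sequence in $\Sigma\cup\{b,e\}$. This means that $l_n\geq 1$, $\sum_n 1/l_n<\infty$, $\mathcal W_0=\Sigma$, and for every $n$ there is a set $P_{n+1}\subseteq(\mathcal W_n)^{k_n}$ with $\mathcal W_{n+1}=\{\mathcal C_n^{\mathrm{twist}}(w_0,\dots,w_{k_n-1}) : w_0\cdots w_{k_n-1}\in P_{n+1}\}$ that is uniquely readable in the alphabet whose letters are the elements of $\mathcal W_n$ (if $uv=pws$ with $u,v,w\in P_{n+1}$,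 then $p$ or $s$ is empty). Assume moreover that for all $n$ 4. $|\mathcal W_{n+1}|=s_{n+1}$; 5. for all $w'\in\mathcal W_{n+1}$ and $w\in\mathcal W_n$, if $w'=\mathcal C_n^{\mathrm{twist}}(w_0,\dots,w_{k_n-1})$ with $w_0,\dots,w_{k_n-1}\in\mathcal W_n$, then there are exactly $k_n/s_n$ indices $j$ with $w=w_j$. Let $\mathbb K\subseteq(\Sigma\cup\{b,e\})^{\mathbb Z}$ be the set of bi-infinite sequences each of whose finite contiguous substrings occurs inside some word of some $\mathcal W_n$, and let $sh$ be the shift, $sh(x)(k)=x(k+1)$. Then $(\mathbb K,sh)$ has a unique non-atomic ergodic invariant Borel probability measure $\nu$, and there is $T^{(a)}\in\mathrm{Diff}^{\omega}_\rho(\mathbb T^2,\lambda)$ such that the system $(\mathbb T^2,\mathcal B,\lambda,T^{(a)})$ is measure-theoretically isomorphic to $(\mathbb K,\mathcal B,\nu,sh)$. Here $\lambda$ is Lebesgue measure on $\mathbb T^2=\mathbb R^2/\mathbb Z^2$, and $\mathrm{Diff}^\omega_\rho(\mathbb T^2,\lambda)$ is the set of $\lambda$-preserving real-analytic diffeomorphisms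 of $\mathbb T^2$ homotopic to the identity such that both the map and its inverse have lifts to $\mathbb R^2$ of the form $(x_1+f_1(x),x_2+f_2(x))$, where each $f_i$ is a $\mathbb Z^2$-periodic real-analytic function on $\mathbb R^2$ that extends to a bounded holomorphic function on $\{(z_1,z_2)\in\mathbb C^2: |\operatorname{Im}z_1|<\rho,\ |\operatorname{Im}z_2|<\rho\}$. -/

import Mathlib

open MeasureTheory Filter Topology

namespace TwistedSystem

/-! ### The alphabet, words, and symbolic shifts -/

/-- The alphabet `A ∪ {b, e}`, where `b` and `e` are two additional symbols. -/
inductive Letter (A : Type*) where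
  | sym (a : A) : Letter A
  | b : Letter A
  | e : Letter A

/-- The alphabet is discrete.  The product σ-algebra on `ℤ → Letter A` is then, for a finite `A`,
the Borel σ-algebra of the product topology. -/
instance (A : Type*) : MeasurableSpace (Letter A) := ⊤

/-- A word over `A ∪ {b, e}`. -/
abbrev Word (A : Type*) := List (Letter A)

/-- A collection `W` of finite words is uniquely readable if `uv = pws` with `u, v, w ∈ W` is only
possible when `p` or `s` is empty. -/
def UniquelyReadable {B : Type*} (W : Set (List B)) : Prop :=
  ∀ u ∈ W, ∀ v ∈ W, ∀ w ∈ W, ∀ p s : List B, u ++ v = p ++ w ++ s → p = [] ∨ s = []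

/-- The symbolic shift of a sequence of collections of words: the bi-infinite sequences all of
whose finite contiguous substrings occur inside some word of some `W n`. -/
def symbolicShift {A : Type*} (W : ℕ → Set (Word A)) : Set (ℤ → Letter A) :=
  {x | ∀ (a : ℤ) (m : ℕ), ∃ n, ∃ w ∈ W n, (List.ofFn fun i : Fin m => x (a + i)) <:+: w}

/-- The shift map `sh` of a symbolic shift, `sh x k = x (k + 1)`. -/
def shift {A : Type*} (W : ℕ → Set (Word A)) (x : symbolicShift W) : symbolicShift W :=
  ⟨fun k => x.1 (k + 1), fun a m => by
    have h := x.2 (a + 1) m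
    have hx : (fun i : Fin m => x.1 (a + i + 1)) = fun i : Fin m => x.1 (a + 1 + i) := by
      funext i
      rw [add_right_comm]
    simpa only [hx] using h⟩

/-- `ν` is a non-atomic ergodic (in particular shift-invariant) probability measure on the symbolic
shift of `W`. -/
structure IsNonatomicErgodic {A : Type*} (W : ℕ → Set (Word A))
    (ν : Measure (symbolicShift W)) : Prop where
  prob : IsProbabilityMeasure ν
  ergodic : Ergodic (shift W) ν
  noAtoms : ∀ x, ν {x} = 0

/-! ### Twisting coefficients and the twisting operator -/

/-- The numbers `q n`: `q 0 = 1` and `q (n+1) = k n * l n * (q n)^2` with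
`k n = 2^(n+2) * q n * C n`. -/
def qSeq (C l : ℕ → ℕ) : ℕ → ℕ
  | 0 => 1
  | n + 1 => (2 ^ (n + 2) * qSeq C l n * C n) * l n * qSeq C l n ^ 2

/-- The numbers `k n = 2^(n+2) * q n * C n`. -/
def kSeq (C l : ℕ → ℕ) (n : ℕ) : ℕ := 2 ^ (n + 2) * qSeq C l n * C n

/-- The numbers `p n`: `p 0 = 0` and `p (n+1) = p n * k n * l n * q n + 1`. -/
def pSeq (C l : ℕ → ℕ) : ℕ → ℕ
  | 0 => 0
  | n + 1 => pSeq C l n * kSeq C l n * l n * qSeq C l n + 1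

/-- The number `j_i ∈ {0, …, q n - 1}` with `j_i ≡ (p n)⁻¹ i` modulo `q n` (for `n = 0`, where
`q 0 = 1`, it is `0`). -/
def jNum (C l : ℕ → ℕ) (n i : ℕ) : ℕ :=
  ((pSeq C l n : ZMod (qSeq C l n))⁻¹ * (i : ZMod (qSeq C l n))).val

/-- The numbers `ψ_n(i)`, `0 ≤ i < 2^(n+2) * q n`. -/
def psi (C l : ℕ → ℕ) (n i : ℕ) : ℕ :=
  if i < 2 ^ (n + 1) * qSeq C l n then
    if Even i then 0 else jNum C l n (((i + 1) / 2) % qSeq C l n)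
  else
    if Even i then jNum C l n ((i / 2 + 1) % qSeq C l n) else jNum C l n 1

/-- The exponent of `e`: the residue of `ψ_n(i) + j_m` modulo `q n` in `{0, …, q n - 1}`. -/
def eExp (C l : ℕ → ℕ) (n m i : ℕ) : ℕ := (psi C l n i + jNum C l n m) % qSeq C l n

/-- The twisting operator at level `n`, applied to the tuple `(w_0, …, w_{k n - 1})`:
the concatenation, over `m < q n`, then `i < 2^(n+2) * q n`, then `c < C n`, of
`b^(q n - t) (w_{i * C n + c})^(l n - 1) e^t` with `t = eExp C l n m i`. -/
def twist {A : Type*} (C l : ℕ → ℕ) (n : ℕ) (w : List (Word A)) : Word A :=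
  (List.range (qSeq C l n)).flatMap fun m =>
    (List.range (2 ^ (n + 2) * qSeq C l n)).flatMap fun i =>
      (List.range (C n)).flatMap fun c =>
        List.replicate (qSeq C l n - eExp C l n m i) Letter.b
          ++ (List.replicate (l n - 1) (w.getD (i * C n + c) [])).flatten
          ++ List.replicate (eExp C l n m i) Letter.e

/-- The set `W^k` of `k`-tuples of words from `W`. -/
def tuples {A : Type*} (W : Set (Word A)) (k : ℕ) : Set (List (Word A)) :=
  {u | u.length = k ∧ ∀ w ∈ u, w ∈ W}

/-- `(C n, l n)` is a twisting coefficient sequence. -/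
structure IsTwistingCoefficients (C l : ℕ → ℕ) : Prop where
  C_pos : ∀ n, 0 < C n
  l_pos : ∀ n, 0 < l n
  summable : Summable fun n => (1 : ℝ) / l n

/-- `W` is a twisted construction sequence with twisting coefficients `(C n, l n)`: `W 0` consists
of the letters of `A`, and `W (n+1)` of the words obtained by the twisting operator from a set
`P ⊆ (W n)^(k n)` of pre-words which is uniquely readable in the alphabet whose letters are the
words of `W n`. -/
structure IsTwistedSequence {A : Type*} (C l : ℕ → ℕ) (W : ℕ → Set (Word A)) : Prop where
  coeff : IsTwistingCoefficients C l
  zero : W 0 = Set.range fun a : A => [Letter.sym a]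
  succ : ∀ n, ∃ P : Set (List (Word A)), P ⊆ tuples (W n) (kSeq C l n) ∧ UniquelyReadable P ∧
    W (n + 1) = twist C l n '' P

/-! ### Measure-theoretic isomorphism -/

/-- The systems `(X, μ, T)` and `(Y, ν, S)` are measure-theoretically isomorphic: there are
measurable measure-preserving maps in both directions, inverse to each other off null sets (so that
they restrict to inverse bijections between sets of full measure), conjugating `T` to `S`. -/
def IsIsomorphic {X Y : Type*} [MeasurableSpace X] [MeasurableSpace Y]
    (μ : Measure X) (T : X → X) (ν : Measure Y) (S : Y → Y) : Prop :=
  ∃ (φ : X → Y) (ψ : Y → X), MeasurePreserving φ μ ν ∧ MeasurePreserving ψ ν μ ∧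
    (∀ᵐ x ∂μ, ψ (φ x) = x) ∧ (∀ᵐ y ∂ν, φ (ψ y) = y) ∧ (∀ᵐ x ∂μ, φ (T x) = S (φ x))

/-! ### Real-analytic diffeomorphisms of the torus -/

/-- The torus `𝕋² = ℝ² / ℤ²`; its `volume` is the normalized Lebesgue measure. -/
abbrev Torus := UnitAddCircle × UnitAddCircle

/-- The quotient map `ℝ² → 𝕋²`. -/
def toTorus (x : ℝ × ℝ) : Torus := ((x.1 : UnitAddCircle), (x.2 : UnitAddCircle))

/-- The complex neighbourhood `Ω_ρ` of `ℝ²` in `ℂ²`. -/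
def Omega (ρ : ℝ) : Set (ℂ × ℂ) := {z | |z.1.im| < ρ ∧ |z.2.im| < ρ}

/-- The space `C^ω_ρ(𝕋²)`: the `ℤ²`-periodic real-analytic functions on `ℝ²` that extend to a
bounded holomorphic function on `Ω_ρ`. -/
def COmega (ρ : ℝ) : Set (ℝ × ℝ → ℝ) :=
  {f | (∀ (x : ℝ × ℝ) (a b : ℤ), f (x.1 + a, x.2 + b) = f x) ∧
    AnalyticOnNhd ℝ f Set.univ ∧
    ∃ g : ℂ × ℂ → ℂ, DifferentiableOn ℂ g (Omega ρ) ∧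
      (∀ x : ℝ × ℝ, g ((x.1 : ℂ), (x.2 : ℂ)) = (f x : ℂ)) ∧
      ∃ M : ℝ, ∀ z ∈ Omega ρ, ‖g z‖ ≤ M}

/-- `T : 𝕋² → 𝕋²` has a lift `ℝ² → ℝ²` of the form `(x₁ + f₁ x, x₂ + f₂ x)` with
`f₁, f₂ ∈ C^ω_ρ(𝕋²)`.  (Such a map is homotopic to the identity, through the maps with lift
`x + t f x`.) -/
def HasLift (ρ : ℝ) (T : Torus → Torus) : Prop :=
  ∃ f₁ ∈ COmega ρ, ∃ f₂ ∈ COmega ρ, ∀ x : ℝ × ℝ,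
    T (toTorus x) = toTorus (x.1 + f₁ x, x.2 + f₂ x)

/-- `Diff^ω_ρ(𝕋², λ)`: the Lebesgue measure-preserving real-analytic diffeomorphisms of `𝕋²`
homotopic to the identity such that the lifts of the map and of its inverse differ from the
identity by functions in `C^ω_ρ(𝕋²)`. -/
def DiffOmega (ρ : ℝ) : Set (Torus ≃ₜ Torus) :=
  {T | MeasurePreserving T volume volume ∧ HasLift ρ T ∧ HasLift ρ T.symm}

end TwistedSystem

open TwistedSystem

namespace TwistedSystem

/-! ### Numerical properties of the coefficient sequences -/

section Numerics

variable {C l : ℕ → ℕ}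

/-! The diffeomorphism is a limit of conjugates of rotations. Let `R_α` rotate the first coordinate,
`α_n = p_n / q_n`, `H_0 = 1`, `H_{n+1} = H_n h_n` with `h_n` (`stepMap`) commuting with `R_{1/q_n}`,
and `T_n = H_n R_{α_n} H_n⁻¹` (`approx`). Then `T_n = H_{n+1} R_{α_n} H_{n+1}⁻¹` as well
(`approx_eq`), and `α_{n+1} = α_n + 1/q_{n+1}` with `q_{n+1} ≥ l_n`. So once `l_n` is large in terms
of `H_{n+1}`, the maps `T_{n+1}` and `T_n` and their inverses are `2^{-n}`-close on `Ω_ρ`. The lifts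
converge there, and the limit lies in `DiffOmega ρ` (`exists_limit_mem_DiffOmega`).

The maps `h_n` encode the words. The image under `H_n` of the cell in strip `i` of width `1/q_n` and
row `t` of height `1/s_n` stands for position `p_n⁻¹ i` in the `t`-th word of `W_n`; since `R_{α_n}`
adds `p_n` to `i`, applying `T_n` advances the position by one. `h_n` sends the cell in column `I`
modulo `k_n` and row `t` of level `n + 1` into the row of the `I`-th word used by the `t`-th word of
`W_{n+1}`, moving strips by `p_n ψ_n`. This shift makes the level-`n` position agree with the place
inside the block `b^(q-t) w^(l-1) e^t` (`jNum_rearranged`, `RowData.nested`). Condition 5 says that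
every word of `W_n` receives equally many cells, so a measure-preserving rearrangement exists. By
Borel–Cantelli almost every point is well placed at all large levels; its name is then read off, and
names separate points (`RowData.eq_of_eventually_eq`).

Such an `h_n` with entire lift is needed only up to small measure. Shears along step functions are
limits in measure of shears along trigonometric polynomials, and shears of a grid generate the
required permutations of its cells (`exists_rearrangement`, `exists_isRearranged`).

On the symbolic side, `noShiftedOccurrence` gives unique readability at every level, which makes the
coding injective. Uniqueness of the measure comes from counting: every word of `W_{n+1}` uses each
word of `W_n` equally often, so the frequency of a pattern relative to that of letters of the
alphabet is the same in all words of `W_{n+1}`, up to `O(1/q_n)`. A non-atomic invariant probability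
is thereby determined (`measure_eq_of_measurePreserving`), hence ergodic, and it is the image of
Lebesgue measure under the coding (`isIsomorphic_of_codingScheme`).

The threshold for `l_n` may not depend on the words. They enter `H_{n+1}` only through one of
finitely many bijections at each level, so `growthBound` takes the maximum over all of them. -/

lemma qSeq_pos (hC : ∀ n, 0 < C n) (hl : ∀ n, 0 < l n) (n : ℕ) : 0 < qSeq C l n := by
  induction n with
  | zero => simp [qSeq]
  | succ n ih =>
    have := hC n
    have := hl n
    simp only [qSeq]
    positivity

lemma kSeq_pos (hC : ∀ n, 0 < C n) (hl : ∀ n, 0 < l n) (n : ℕ) : 0 < kSeq C l n := by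
  have := hC n
  have := qSeq_pos hC hl n
  simp only [kSeq]
  positivity

lemma qSeq_succ (C l : ℕ → ℕ) (n : ℕ) :
    qSeq C l (n + 1) = qSeq C l n * kSeq C l n * (l n * qSeq C l n) := by
  simp only [qSeq, kSeq]; ring

lemma pSeq_succ (C l : ℕ → ℕ) (n : ℕ) :
    pSeq C l (n + 1) = pSeq C l n * (kSeq C l n * (l n * qSeq C l n)) + 1 := by
  simp only [pSeq]; ring

/-- `p_{n+1}` is one more than a multiple of `k_n l_n q_n`, and both factors of `q_{n+1} = q_n ·
(k_n l_n q_n)` divide `k_n l_n q_n`. -/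
lemma pSeq_coprime (C l : ℕ → ℕ) (n : ℕ) : (pSeq C l n).Coprime (qSeq C l n) := by
  cases n with
  | zero => simp [qSeq]
  | succ n =>
    have key : ∀ d, d ∣ kSeq C l n * (l n * qSeq C l n) → (pSeq C l (n + 1)).Coprime d := by
      intro d hd
      rw [pSeq_succ, Nat.coprime_comm]
      obtain ⟨e, he⟩ := hd
      rw [he]
      have : pSeq C l n * (d * e) + 1 = 1 + d * (pSeq C l n * e) := by ring
      rw [this, Nat.coprime_add_mul_left_right]
      simp
    rw [qSeq_succ, mul_assoc]
    refine Nat.Coprime.mul_right (key _ ?_) (key _ dvd_rfl)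
    exact Dvd.intro_left (kSeq C l n * l n) (by ring)

lemma four_le_kSeq (hC : ∀ n, 0 < C n) (hl : ∀ n, 0 < l n) (n : ℕ) : 4 ≤ kSeq C l n := by
  have h1 := hC n
  have h2 := qSeq_pos hC hl n
  have h3 : 4 ≤ 2 ^ (n + 2) := by
    rw [pow_add]; have := Nat.one_le_two_pow (n := n); omega
  calc 4 = 4 * 1 * 1 := rfl
    _ ≤ 2 ^ (n + 2) * qSeq C l n * C n := by gcongr <;> omega

lemma eExp_lt (hC : ∀ n, 0 < C n) (hl : ∀ n, 0 < l n) (n m i : ℕ) :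
    eExp C l n m i < qSeq C l n :=
  Nat.mod_lt _ (qSeq_pos hC hl n)

lemma jNum_lt (hC : ∀ n, 0 < C n) (hl : ∀ n, 0 < l n) (n i : ℕ) :
    jNum C l n i < qSeq C l n := by
  have : NeZero (qSeq C l n) := ⟨(qSeq_pos hC hl n).ne'⟩
  exact ZMod.val_lt _

lemma natCast_jNum (hC : ∀ n, 0 < C n) (hl : ∀ n, 0 < l n) (n i : ℕ) :
    (jNum C l n i : ZMod (qSeq C l n)) = (pSeq C l n : ZMod (qSeq C l n))⁻¹ * i := by
  have : NeZero (qSeq C l n) := ⟨(qSeq_pos hC hl n).ne'⟩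
  simp [jNum]

lemma pSeq_mul_inv (C l : ℕ → ℕ) (n : ℕ) :
    (pSeq C l n : ZMod (qSeq C l n)) * (pSeq C l n : ZMod (qSeq C l n))⁻¹ = 1 :=
  ZMod.coe_mul_inv_eq_one _ (pSeq_coprime C l n)

/-- Cancelling `ψ_n(i)` leaves `p_n⁻¹ m` modulo `q_n`, and `p_n` is a unit. In a fixed column the
exponent thus reveals the repetition `m`, which detects shifts of a word by a multiple of `k_n`
blocks. -/
lemma eExp_inj (hC : ∀ n, 0 < C n) (hl : ∀ n, 0 < l n) {n m m' i : ℕ} (hm : m < qSeq C l n)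
    (hm' : m' < qSeq C l n) (h : eExp C l n m i = eExp C l n m' i) : m = m' := by
  have h1 : ((psi C l n i + jNum C l n m : ℕ) : ZMod (qSeq C l n)) =
      ((psi C l n i + jNum C l n m' : ℕ) : ZMod (qSeq C l n)) :=
    (ZMod.natCast_eq_natCast_iff' _ _ _).2 h
  push_cast [natCast_jNum hC hl] at h1
  have h2 := congrArg (fun y => (pSeq C l n : ZMod (qSeq C l n)) * y) (add_left_cancel h1)
  simp only [← mul_assoc, pSeq_mul_inv, one_mul] at h2
  have h3 := (ZMod.natCast_eq_natCast_iff' _ _ _).1 h2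
  rwa [Nat.mod_eq_of_lt hm, Nat.mod_eq_of_lt hm'] at h3

/-- The exponent of `e` in the block with index `α` of a word produced by the twisting operator. -/
def blockExp (C l : ℕ → ℕ) (n α : ℕ) : ℕ :=
  eExp C l n (α / kSeq C l n) (α % kSeq C l n / C n)

lemma blockExp_lt (hC : ∀ n, 0 < C n) (hl : ∀ n, 0 < l n) (n α : ℕ) :
    blockExp C l n α < qSeq C l n := eExp_lt hC hl _ _ _

end Numerics

/-! ### Letters of concatenated words -/

section Indexing

variable {B : Type*}

lemma length_flatMap_range (f : ℕ → List B) (n L : ℕ) (h : ∀ i < n, (f i).length = L) :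
    ((List.range n).flatMap f).length = n * L := by
  induction n with
  | zero => simp
  | succ n ih =>
    rw [List.range_succ, List.flatMap_append, List.length_append,
      ih fun i hi => h i (by omega)]
    simp [h n (by omega), Nat.succ_mul]

lemma getElem?_flatMap_range (f : ℕ → List B) (n L : ℕ) (h : ∀ i < n, (f i).length = L)
    {i t : ℕ} (hi : i < n) (ht : t < L) :
    ((List.range n).flatMap f)[i * L + t]? = (f i)[t]? := by
  induction n with
  | zero => omega
  | succ n ih =>
    have hlen := length_flatMap_range f n L fun i hi => h i (by omega)
    rw [List.range_succ, List.flatMap_append]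
    rcases Nat.lt_succ_iff_lt_or_eq.1 hi with h1 | rfl
    · rw [List.getElem?_append_left, ih (fun i hi => h i (by omega)) h1]
      rw [hlen]
      calc i * L + t < i * L + L := by omega
        _ = (i + 1) * L := by ring
        _ ≤ n * L := Nat.mul_le_mul_right _ h1
    · rw [List.getElem?_append_right (by rw [hlen]; omega), hlen]
      simp

lemma flatten_replicate_eq (k : ℕ) (w : List B) :
    (List.replicate k w).flatten = (List.range k).flatMap fun _ => w := by
  simp [List.flatMap]

lemma getElem?_flatten_replicate {k q : ℕ} {w : List B} (hw : w.length = q) {j : ℕ}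
    (hj : j < k * q) : ((List.replicate k w).flatten)[j]? = w[j % q]? := by
  have hq : 0 < q := Nat.pos_of_ne_zero (by rintro rfl; simp at hj)
  rw [flatten_replicate_eq]
  conv_lhs => rw [← Nat.div_add_mod' j q]
  exact getElem?_flatMap_range _ _ _ (fun _ _ => hw) ((Nat.div_lt_iff_lt_mul hq).2 hj)
    (Nat.mod_lt _ hq)

end Indexing

/-! ### The blocks of a twisted word -/

section Blocks

variable {A : Type*} {C l : ℕ → ℕ} {n : ℕ}

/-- The block `b^(q - t) w^(l - 1) e^t`. -/
def block (q l t : ℕ) (w : Word A) : Word A :=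
  List.replicate (q - t) Letter.b ++ (List.replicate (l - 1) w).flatten ++
    List.replicate t Letter.e

lemma length_block {q l t : ℕ} {w : Word A} (hl : 0 < l) (ht : t < q) (hw : w.length = q) :
    (block q l t w).length = l * q := by
  obtain ⟨l, rfl⟩ : ∃ l', l = l' + 1 := ⟨l - 1, by omega⟩
  simp only [block, List.length_append, List.length_replicate, List.length_flatten, List.map_replicate,
    List.sum_replicate, hw, smul_eq_mul, Nat.add_sub_cancel, Nat.succ_mul]
  omega

lemma block_getElem?_b {q l t : ℕ} (w : Word A) {τ : ℕ} (hτ : τ < q - t) :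
    (block q l t w)[τ]? = some Letter.b := by
  rw [block, List.append_assoc, List.getElem?_append_left (by simpa using hτ),
    List.getElem?_replicate, if_pos hτ]

lemma block_getElem?_w {q l t : ℕ} {w : Word A} (hw : w.length = q) {i : ℕ}
    (hi : i < (l - 1) * q) : (block q l t w)[q - t + i]? = w[i % q]? := by
  rw [block, List.append_assoc, List.getElem?_append_right (by simp),
    List.length_replicate, Nat.add_sub_cancel_left, List.getElem?_append_left,
    getElem?_flatten_replicate hw hi]
  simpa [hw] using hi

lemma block_getElem?_e {q l t : ℕ} {w : Word A} (hw : w.length = q) {i : ℕ}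
    (hi : i < t) : (block q l t w)[q - t + (l - 1) * q + i]? = some Letter.e := by
  rw [block, List.getElem?_append_right (by simp [hw])]
  simp [hw, hi]

lemma twist_eq {q : ℕ} (hq : qSeq C l n = q) (u : List (Word A)) :
    twist C l n u = (List.range q).flatMap fun m => (List.range (2 ^ (n + 2) * q)).flatMap fun i =>
      (List.range (C n)).flatMap fun c => block q (l n) (eExp C l n m i) (u.getD (i * C n + c) []) := by
  subst hq; rfl

variable (hC : ∀ n, 0 < C n) (hl : ∀ n, 0 < l n)
include hC hl

/-- The triple `(m, i, c)` is flattened to `α = m k + i C + c`. The word in block `α` depends only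
on `α` modulo `k`, the exponent also on `α / k`. -/
lemma twist_aux {u : List (Word A)} {q k : ℕ} (hq : qSeq C l n = q) (hk : kSeq C l n = k)
    (hu : u.length = k) (hw : ∀ w ∈ u, w.length = q) :
    (twist C l n u).length = qSeq C l (n + 1) ∧
    ∀ α < q * k, ∀ τ < l n * q,
      (twist C l n u)[α * (l n * q) + τ]? =
        (block q (l n) (blockExp C l n α) (u.getD (α % k) []))[τ]? := by
  have hk' : 2 ^ (n + 2) * q * C n = k := by rw [← hk, ← hq]; rfl
  have hkpos : 0 < k := hk ▸ kSeq_pos hC hl n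
  have h0 : ∀ m, ∀ i < 2 ^ (n + 2) * q, ∀ c < C n,
      (block q (l n) (eExp C l n m i) (u.getD (i * C n + c) [])).length = l n * q := by
    intro m i hi c hc
    refine length_block (hl n) (hq ▸ eExp_lt hC hl n m i) ?_
    have : i * C n + c < u.length := by
      rw [hu, ← hk']
      calc i * C n + c < i * C n + C n := by omega
        _ = (i + 1) * C n := by ring
        _ ≤ _ := Nat.mul_le_mul_right _ hi
    rw [List.getD_eq_getElem _ _ this]
    exact hw _ (List.getElem_mem _)
  have h1 : ∀ m, ∀ i < 2 ^ (n + 2) * q, ((List.range (C n)).flatMap fun c =>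
      block q (l n) (eExp C l n m i) (u.getD (i * C n + c) [])).length = C n * (l n * q) :=
    fun m i hi => length_flatMap_range _ _ _ (h0 m i hi)
  have h2 : ∀ m < q, ((List.range (2 ^ (n + 2) * q)).flatMap fun i => (List.range (C n)).flatMap fun c =>
      block q (l n) (eExp C l n m i) (u.getD (i * C n + c) [])).length = k * (l n * q) := by
    intro m _
    rw [length_flatMap_range _ _ _ (h1 m), ← hk']; ring
  rw [twist_eq hq]
  constructor
  · rw [length_flatMap_range _ _ _ h2, qSeq_succ, hk, hq]; ring
  · intro α hα τ hτ
    set m := α / k with hm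
    set I := α % k with hI
    have hIk : I < k := Nat.mod_lt _ hkpos
    have hα' : α = m * k + I := (Nat.div_add_mod' α k).symm
    have hmq : m < q := (Nat.div_lt_iff_lt_mul hkpos).2 hα
    have hic : I = I / C n * C n + I % C n := (Nat.div_add_mod' I (C n)).symm
    have hi : I / C n < 2 ^ (n + 2) * q := (Nat.div_lt_iff_lt_mul (hC n)).2 (by rw [hk']; exact hIk)
    have e1 : α * (l n * q) + τ = m * (k * (l n * q)) + (I * (l n * q) + τ) := by
      rw [hα']; ring
    have e2 : I * (l n * q) + τ =
        I / C n * (C n * (l n * q)) + (I % C n * (l n * q) + τ) := by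
      conv_lhs => rw [hic]
      ring
    have b1 : I % C n * (l n * q) + τ < C n * (l n * q) := by
      calc I % C n * (l n * q) + τ < I % C n * (l n * q) + l n * q := by omega
        _ = (I % C n + 1) * (l n * q) := by ring
        _ ≤ _ := Nat.mul_le_mul_right _ (Nat.mod_lt _ (hC n))
    have b2 : I * (l n * q) + τ < k * (l n * q) := by
      calc I * (l n * q) + τ < I * (l n * q) + l n * q := by omega
        _ = (I + 1) * (l n * q) := by ring
        _ ≤ _ := Nat.mul_le_mul_right _ hIk
    rw [e1, getElem?_flatMap_range _ _ _ h2 hmq b2, e2, getElem?_flatMap_range _ _ _ (h1 m) hi b1,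
      getElem?_flatMap_range _ _ _ (h0 m _ hi) (Nat.mod_lt _ (hC n)) hτ, ← hic]
    simp only [blockExp, hk, ← hm, ← hI]

end Blocks

/-! ### Unique readability -/

section Readability

variable {A : Type*}

/-- Words of length `q` in `W` occur in a concatenation `uv` of two words in `W` only as the prefix
or the suffix. -/
def NoShiftedOccurrence (q : ℕ) (W : Set (Word A)) : Prop :=
  ∀ u ∈ W, ∀ v ∈ W, ∀ w ∈ W, ∀ d, 0 < d → d < q → ¬ ∀ j < q, (u ++ v)[d + j]? = w[j]?

variable {q B : ℕ} {W : Set (Word A)}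

/-- If `q` does not divide the offset of the two periodic runs, `w` occurs strictly inside `w'w'`,
against `NoShiftedOccurrence`. If the offset is a positive multiple of `q`, the `b` in front of the
later run sits on the last letter of a copy of `w'`, which is not `b`. -/
lemma runs_agree_of_le (hlen : ∀ w ∈ W, w.length = q) (hUR : NoShiftedOccurrence q W)
    (hlast : ∀ w ∈ W, w[q - 1]? ≠ some Letter.b) (hq : 0 < q) (hB : 10 * q ≤ B)
    {z : ℕ → Option (Letter A)} {P Q : ℕ} {w w' : Word A} (hw : w ∈ W) (hw' : w' ∈ W)
    (hP : ∀ i < B - q, z (P + i) = w[i % q]?) (hQ : ∀ i < B - q, z (Q + i) = w'[i % q]?)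
    (hP1 : 0 < P) (hPb : z (P - 1) = some Letter.b) (hQP : Q ≤ P) (hd : P ≤ Q + (B - 4 * q)) :
    P = Q ∧ w = w' := by
  obtain ⟨δ, rfl⟩ := Nat.exists_eq_add_of_le hQP
  by_cases hδ : δ % q = 0
  · rcases Nat.eq_zero_or_pos δ with rfl | hpos
    · refine ⟨rfl, List.ext_getElem? fun j => ?_⟩
      by_cases hj : j < q
      · have h1 := hP j (by omega)
        have h2 := hQ j (by omega)
        rw [Nat.mod_eq_of_lt hj] at h1 h2
        rw [← h1, ← h2]; rfl
      · rw [List.getElem?_eq_none (by rw [hlen w hw]; omega),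
          List.getElem?_eq_none (by rw [hlen w' hw']; omega)]
    · exfalso
      have h1 := hQ (δ - 1) (by omega)
      rw [show Q + (δ - 1) = Q + δ - 1 by omega, hPb] at h1
      obtain ⟨c, rfl⟩ := Nat.dvd_of_mod_eq_zero hδ
      obtain ⟨c, rfl⟩ : ∃ c', c = c' + 1 :=
        ⟨c - 1, by have : c ≠ 0 := by rintro rfl; simp at hpos
                   omega⟩
      have h2 : (q * (c + 1) - 1) % q = q - 1 := by
        rw [show q * (c + 1) - 1 = q - 1 + q * c by rw [Nat.mul_succ]; omega, Nat.add_mul_mod_self_left,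
          Nat.mod_eq_of_lt (by omega)]
      rw [h2] at h1
      exact hlast w' hw' h1.symm
  · exfalso
    have hlt := Nat.mod_lt δ hq
    refine hUR w' hw' w' hw' w hw (δ % q) (by omega) hlt fun j hj => ?_
    have h1 := hP j (by omega)
    have h2 := hQ (δ + j) (by omega)
    rw [Nat.mod_eq_of_lt hj] at h1
    rw [← h1, add_assoc, h2, ← Nat.mod_add_mod]
    by_cases h3 : δ % q + j < q
    · rw [List.getElem?_append_left (by rw [hlen w' hw']; omega), Nat.mod_eq_of_lt h3]
    · have h4 : (δ % q + j) % q = δ % q + j - q := by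
        rw [Nat.mod_eq_sub_mod (by omega), Nat.mod_eq_of_lt (by omega)]
      rw [List.getElem?_append_right (by rw [hlen w' hw']; omega), hlen w' hw', h4]

lemma runs_agree (hlen : ∀ w ∈ W, w.length = q) (hUR : NoShiftedOccurrence q W)
    (hlast : ∀ w ∈ W, w[q - 1]? ≠ some Letter.b) (hq : 0 < q) (hB : 10 * q ≤ B)
    {z : ℕ → Option (Letter A)} {P Q : ℕ} {w w' : Word A} (hw : w ∈ W) (hw' : w' ∈ W)
    (hP : ∀ i < B - q, z (P + i) = w[i % q]?) (hQ : ∀ i < B - q, z (Q + i) = w'[i % q]?)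
    (hP1 : 0 < P) (hQ1 : 0 < Q) (hPb : z (P - 1) = some Letter.b) (hQb : z (Q - 1) = some Letter.b)
    (hd : P ≤ Q + (B - 4 * q)) (hd' : Q ≤ P + (B - 4 * q)) :
    P = Q ∧ w = w' := by
  rcases le_total Q P with h | h
  · exact runs_agree_of_le hlen hUR hlast hq hB hw hw' hP hQ hP1 hPb h hd
  · have := runs_agree_of_le hlen hUR hlast hq hB hw' hw hQ hP hQ1 hQb h hd'
    exact ⟨this.1.symm, this.2.symm⟩

/-- `z` consists of `N` blocks of length `B`, of the form `b^(q - t) w^* e^t`. -/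
structure IsBlockStream (q B N : ℕ) (t : ℕ → ℕ) (w : ℕ → Word A) (z : ℕ → Option (Letter A)) :
    Prop where
  at_b : ∀ β < N, ∀ τ < q - t β, z (β * B + τ) = some Letter.b
  at_w : ∀ β < N, ∀ i < B - q, z (β * B + (q - t β) + i) = (w β)[i % q]?
  at_e : ∀ β < N, ∀ τ < t β, z (β * B + (B - t β) + τ) = some Letter.e

/-- The powers `w^(l-1)` of matching blocks overlap in long stretches, so by `runs_agree` they start
together and carry the same word. The boundary letters `b` and `e` then fix the block boundaries,
hence the exponents. -/
lemma IsBlockStream.align {N : ℕ} {t tX : ℕ → ℕ} {w wX : ℕ → Word A} {z x : ℕ → Option (Letter A)}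
    (hz : IsBlockStream q B (2 * N) t w z) (hx : IsBlockStream q B N tX wX x)
    (hlen : ∀ w ∈ W, w.length = q) (hUR : NoShiftedOccurrence q W)
    (hlast : ∀ w ∈ W, w[q - 1]? ≠ some Letter.b) (hq : 0 < q) (hB : 10 * q ≤ B)
    (hw : ∀ β < 2 * N, w β ∈ W) (hwX : ∀ β < N, wX β ∈ W)
    (ht : ∀ β, t β < q) (htX : ∀ β, tX β < q) (hN : 2 ≤ N) {d : ℕ} (hd : d < N * B)
    (hxz : ∀ j < N * B, z (d + j) = x j) :
    ∃ r ≤ N, d = r * B ∧ ∀ α < N, wX α = w (r + α) ∧ tX α = t (r + α) := by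
  have hBpos : 0 < B := by omega
  -- Round `d` to a block boundary, upwards only when the remainder exceeds `B - 5q`. The starts of
  -- the runs differ from this by less than `q` more, so the closeness required by `runs_agree`
  -- holds because `6q ≤ B - 4q`; this is where `10 q ≤ B` is used.
  obtain ⟨r, hrN, hr, hr'⟩ : ∃ r ≤ N, d ≤ r * B + (B - 5 * q) ∧ r * B ≤ d + 5 * q := by
    have h1 := Nat.div_add_mod' d B
    have h2 := Nat.mod_lt d hBpos
    have h3 : d / B < N := (Nat.div_lt_iff_lt_mul hBpos).2 hd
    by_cases h : d % B ≤ B - 5 * q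
    · exact ⟨d / B, h3.le, by omega, by omega⟩
    · refine ⟨d / B + 1, h3, ?_, ?_⟩ <;> rw [Nat.succ_mul] <;> omega
  have hmulN : ∀ α < N, α * B + B ≤ N * B := fun α hα => by
    rw [← Nat.succ_mul]; exact Nat.mul_le_mul_right _ hα
  have key : ∀ α < N, d + α * B + (q - tX α) = (r + α) * B + (q - t (r + α)) ∧
      wX α = w (r + α) := by
    intro α hα
    have h1 := hmulN α hα
    have h2 := htX α
    have h3 := ht (r + α)
    have hrα : r + α < 2 * N := by omega
    have h4 : (r + α) * B = r * B + α * B := Nat.add_mul _ _ _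
    refine runs_agree (z := z) hlen hUR hlast hq hB (hwX α hα) (hw _ hrα) ?_
      (hz.at_w _ hrα) (by omega) (by omega) ?_ ?_ (by omega) (by omega)
    · intro i hi
      rw [← hx.at_w α hα i hi, ← hxz _ (by omega)]
      congr 1; omega
    · rw [← hx.at_b α hα (q - tX α - 1) (by omega), ← hxz _ (by omega)]
      congr 1; omega
    · rw [← hz.at_b _ hrα (q - t (r + α) - 1) (by omega)]
      congr 1; omega
  have hdr : d = r * B := by
    have h0 := (key 0 (by omega)).1
    simp only [Nat.zero_mul, Nat.add_zero] at h0
    have h1 := hmulN 1 (by omega)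
    have h2 := htX 0
    have h3 := ht r
    -- If `d < r B`, then `tX 0 < t r` and the `b` opening block `1` of `x` falls on an `e` closing
    -- block `r` of `z`. If `d > r B`, an `e` closing block `0` of `x` falls on the `b` opening
    -- block `r + 1` of `z`.
    rcases lt_trichotomy d (r * B) with h | h | h
    · exfalso
      have h4 := hx.at_b 1 (by omega) 0 (by have := htX 1; omega)
      have h5 := hz.at_e r (by omega) (tX 0) (by omega)
      rw [← hxz _ (by omega)] at h4
      rw [show d + (1 * B + 0) = r * B + (B - t r) + tX 0 by omega, h5] at h4
      cases h4
    · exact h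
    · exfalso
      have h4 := hx.at_e 0 (by omega) (t r) (by omega)
      have h5 := hz.at_b (r + 1) (by omega) 0 (by have := ht (r + 1); omega)
      rw [← hxz _ (by omega), show d + (0 * B + (B - tX 0) + t r) = (r + 1) * B + 0 by
        rw [Nat.succ_mul]; omega, h5] at h4
      cases h4
  refine ⟨r, hrN, hdr, fun α hα => ⟨(key α hα).2, ?_⟩⟩
  have h1 := (key α hα).1
  have h2 := htX α
  have h3 := ht (r + α)
  have h4 : (r + α) * B = r * B + α * B := Nat.add_mul _ _ _
  omega

end Readability

/-! ### Words of a twisted construction sequence -/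

section Twisted

variable {A : Type*} {C l : ℕ → ℕ} {W : ℕ → Set (Word A)}

/-- The level-`n+1` word made of the words in `u` is a stream of blocks. -/
lemma isBlockStream_twist (hC : ∀ n, 0 < C n) (hl : ∀ n, 0 < l n) {n : ℕ} {u : List (Word A)}
    {q k : ℕ} (hq : qSeq C l n = q) (hk : kSeq C l n = k) (hu : u.length = k)
    (hw : ∀ w ∈ u, w.length = q) :
    IsBlockStream q (l n * q) (q * k) (blockExp C l n) (fun α => u.getD (α % k) [])
      (fun j => (twist C l n u)[j]?) := by
  have h := (twist_aux hC hl hq hk hu hw).2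
  have hkpos : 0 < k := hk ▸ kSeq_pos hC hl n
  have hword : ∀ α, (u.getD (α % k) []).length = q := fun α => by
    have : α % k < u.length := by rw [hu]; exact Nat.mod_lt _ hkpos
    rw [List.getD_eq_getElem _ _ this]
    exact hw _ (List.getElem_mem _)
  have hlq : l n * q = (l n - 1) * q + q := by
    have := hl n
    rw [← Nat.succ_mul]; congr 1; omega
  have hlt := fun α => hq ▸ blockExp_lt hC hl n α
  refine ⟨fun β hβ τ hτ => ?_, fun β hβ i hi => ?_, fun β hβ τ hτ => ?_⟩
  · rw [h β hβ τ (by omega), block_getElem?_b _ hτ]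
  · have := hlt β
    rw [add_assoc, h β hβ _ (by omega), block_getElem?_w (hword β) (by omega)]
  · have := hlt β
    rw [add_assoc, h β hβ _ (by omega), ← block_getElem?_e (l := l n) (hword β) hτ]
    congr 1; omega

namespace IsTwistedSequence

variable (h : IsTwistedSequence C l W)
include h

lemma length_eq (n : ℕ) : ∀ w ∈ W n, w.length = qSeq C l n := by
  induction n with
  | zero => rw [h.zero]; rintro _ ⟨a, rfl⟩; simp [qSeq]
  | succ n ih =>
    obtain ⟨P, hP, -, hW⟩ := h.succ n
    rw [hW]
    rintro _ ⟨u, hu, rfl⟩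
    exact (twist_aux h.coeff.C_pos h.coeff.l_pos rfl rfl (hP hu).1 fun w hw => ih w ((hP hu).2 w hw)).1

/-- The last block ends with `e` if its exponent is positive, and otherwise with the last letter of
a word one level down, present because `l ≥ 2`. -/
lemma last_ne_b (hl2 : ∀ n, 2 ≤ l n) (n : ℕ) : ∀ w ∈ W n, w[qSeq C l n - 1]? ≠ some Letter.b := by
  have hC := h.coeff.C_pos
  have hl := h.coeff.l_pos
  induction n with
  | zero => rw [h.zero]; rintro _ ⟨a, rfl⟩; simp [qSeq]
  | succ n ih =>
    obtain ⟨P, hP, -, hW⟩ := h.succ n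
    rw [hW]
    rintro _ ⟨u, hu, rfl⟩
    have hq := qSeq_pos hC hl n
    have hk := kSeq_pos hC hl n
    have hs := isBlockStream_twist hC hl rfl rfl (hP hu).1 fun w hw => h.length_eq n w ((hP hu).2 w hw)
    set q := qSeq C l n with hqdef
    set k := kSeq C l n with hkdef
    obtain ⟨M, hM⟩ : ∃ M, q * k = M + 1 := ⟨q * k - 1, by have := Nat.mul_pos hq hk; omega⟩
    have hMlt : M < q * k := by omega
    have hlq : l n * q = (l n - 2) * q + q + q := by
      have := hl2 n
      rw [← Nat.succ_mul, ← Nat.succ_mul]; congr 1; omega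
    have hidx : qSeq C l (n + 1) - 1 = M * (l n * q) + (l n * q - 1) := by
      rw [qSeq_succ, ← hqdef, ← hkdef, hM, Nat.succ_mul]
      have : 0 < l n * q := by omega
      omega
    rw [hidx]
    have hlt : blockExp C l n M < q := blockExp_lt hC hl n M
    by_cases ht : 0 < blockExp C l n M
    · have h1 := hs.at_e M hMlt (blockExp C l n M - 1) (by omega)
      rw [show M * (l n * q) + (l n * q - blockExp C l n M) + (blockExp C l n M - 1) =
        M * (l n * q) + (l n * q - 1) by omega] at h1
      rw [h1]; simp
    · have h1 := hs.at_w M hMlt (q - 1 + (l n - 2) * q) (by omega)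
      rw [show M * (l n * q) + (q - blockExp C l n M) + (q - 1 + (l n - 2) * q) =
        M * (l n * q) + (l n * q - 1) by omega, Nat.add_mul_mod_self_right,
        Nat.mod_eq_of_lt (a := q - 1) (by omega)] at h1
      rw [h1]
      have : M % k < u.length := by rw [(hP hu).1]; exact Nat.mod_lt _ hk
      rw [List.getD_eq_getElem _ _ this]
      exact ih _ ((hP hu).2 _ (List.getElem_mem _))

/-- Every level of a twisted construction sequence is uniquely readable. -/
lemma noShiftedOccurrence (hl10 : ∀ n, 10 ≤ l n) (n : ℕ) :
    NoShiftedOccurrence (qSeq C l n) (W n) := by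
  have hC := h.coeff.C_pos
  have hl := h.coeff.l_pos
  induction n with
  | zero => intro u _ v _ w _ d h1 h2; simp [qSeq] at h2; omega
  | succ n ih =>
    obtain ⟨P, hP, hPR, hW⟩ := h.succ n
    have hlen := h.length_eq n
    have hlen' := h.length_eq (n + 1)
    have hlast := h.last_ne_b (fun n => by have := hl10 n; omega) n
    intro u hu v hv x hx d hd0 hd hocc
    have hul := hlen' u hu
    have hvl := hlen' v hv
    rw [hW] at hu hv hx
    obtain ⟨u, hu, rfl⟩ := hu
    obtain ⟨v, hv, rfl⟩ := hv
    obtain ⟨x, hx, rfl⟩ := hx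
    have hq := qSeq_pos hC hl n
    have hk := kSeq_pos hC hl n
    have hk4 := four_le_kSeq hC hl n
    have hstream : ∀ u ∈ P, _ := fun u hu => isBlockStream_twist hC hl (n := n) (u := u) rfl rfl (hP hu).1
      fun w hw => hlen w ((hP hu).2 w hw)
    have hmem : ∀ u ∈ P, ∀ α, u.getD (α % kSeq C l n) [] ∈ W n := fun u hu α => by
      have : α % kSeq C l n < u.length := by rw [(hP hu).1]; exact Nat.mod_lt _ hk
      rw [List.getD_eq_getElem _ _ this]
      exact (hP hu).2 _ (List.getElem_mem _)
    have hexp := blockExp_lt hC hl n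
    have hqs := qSeq_succ C l n
    have h10 : 10 * qSeq C l n ≤ l n * qSeq C l n := Nat.mul_le_mul_right _ (hl10 n)
    have hu' := hstream u hu
    have hv' := hstream v hv
    have hx' := hstream x hx
    have hexpdef : ∀ α, blockExp C l n α =
        eExp C l n (α / kSeq C l n) (α % kSeq C l n / C n) := fun _ => rfl
    set q := qSeq C l n with hqdef
    set k := kSeq C l n with hkdef
    set B := l n * q with hBdef
    set N := q * k with hNdef
    have hNpos : 0 < N := Nat.mul_pos hq hk
    have hN2 : 2 ≤ N := by
      have : k ≤ N := Nat.le_mul_of_pos_left _ hq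
      omega
    -- The concatenation of two twisted words is a stream of `2N` blocks whose exponents repeat with
    -- period `N`.
    have hz : IsBlockStream q B (2 * N) (fun β => blockExp C l n (β % N))
        (fun β => if β < N then u.getD (β % k) [] else v.getD ((β - N) % k) [])
        (fun j => (twist C l n u ++ twist C l n v)[j]?) := by
      have hleft : ∀ β < N, ∀ τ < B, (twist C l n u ++ twist C l n v)[β * B + τ]? =
          (twist C l n u)[β * B + τ]? := fun β hβ τ hτ => by
        rw [List.getElem?_append_left]
        rw [hul, hqs]
        calc β * B + τ < β * B + B := by omega
          _ = (β + 1) * B := by ring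
          _ ≤ N * B := Nat.mul_le_mul_right _ hβ
      have hright : ∀ β, N ≤ β → ∀ τ, (twist C l n u ++ twist C l n v)[β * B + τ]? =
          (twist C l n v)[(β - N) * B + τ]? := fun β hβ τ => by
        obtain ⟨γ, rfl⟩ := Nat.exists_eq_add_of_le hβ
        rw [List.getElem?_append_right (by rw [hul, hqs, Nat.add_mul]; omega), hul, hqs,
          Nat.add_mul, Nat.add_sub_cancel_left]
        congr 1; omega
      refine ⟨fun β hβ τ hτ => ?_, fun β hβ τ hτ => ?_, fun β hβ τ hτ => ?_⟩
      all_goals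
        have hlt := hexp (β % N)
        try simp only at hτ
        try simp only
        try simp only [add_assoc]
        rcases lt_or_ge β N with h1 | h1
        · rw [hleft β h1 _ (by omega)]
          have hm : β % N = β := Nat.mod_eq_of_lt h1
          rw [hm] at hlt
          try rw [hm] at hτ
          try rw [hm]
          try simp only [h1, if_true]
          try simp only [← add_assoc]
          first
            | exact hu'.at_b β h1 τ hτ
            | exact hu'.at_w β h1 τ hτ
            | exact hu'.at_e β h1 τ hτ
        · have h2 : β - N < N := by omega
          rw [hright β h1]
          have hm : β % N = β - N := by rw [Nat.mod_eq_sub_mod h1, Nat.mod_eq_of_lt h2]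
          rw [hm] at hlt
          try rw [hm] at hτ
          try rw [hm]
          try simp only [h1.not_gt, if_false]
          try simp only [← add_assoc]
          first
            | exact hv'.at_b (β - N) h2 τ hτ
            | exact hv'.at_w (β - N) h2 τ hτ
            | exact hv'.at_e (β - N) h2 τ hτ
    obtain ⟨r, hrN, hdr, hr⟩ := hz.align hx' hlen ih hlast hq h10
      (fun β _ => by
        by_cases h1 : β < N
        · simpa [h1] using hmem u hu β
        · simpa [h1] using hmem v hv (β - N))
      (fun β _ => hmem x hx β) (fun β => hexp _) hexp hN2 (d := d) (by rw [← hqs]; exact hd)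
      (fun j hj => hocc j (by rw [hqs]; exact hj))
    have hr0 : 0 < r := Nat.pos_of_ne_zero (by rintro rfl; simp at hdr; omega)
    have hrlt : r < N := by
      rcases hrN.lt_or_eq with h1 | rfl
      · exact h1
      · rw [hdr, hqs] at hd; omega
    -- A shift by whole repetitions is refuted by the exponents of the first blocks (`eExp_inj`);
    -- any other shift yields a shifted occurrence of one pre-word in a concatenation of two,
    -- against the unique readability of `P`.
    by_cases hrk : r % k = 0
    · have h1 := (hr 0 hNpos).2
      simp only [add_zero] at h1
      rw [Nat.mod_eq_of_lt hrlt, hexpdef, hexpdef, hrk] at h1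
      simp only [Nat.zero_div, Nat.zero_mod] at h1
      have h2 := eExp_inj hC hl (m := 0) (m' := r / k) hq ((Nat.div_lt_iff_lt_mul hk).2 hrlt) h1
      have h3 := Nat.div_add_mod' r k
      rw [← h2, hrk] at h3
      omega
    · have hrklt : r % k < k := Nat.mod_lt _ hk
      have hrdiv := Nat.div_add_mod' r k
      have hrdivlt : r / k < q := (Nat.div_lt_iff_lt_mul hk).2 hrlt
      have hxu : ∀ I, r % k + I < k → x.getD I [] = u.getD (r % k + I) [] := fun I hI => by
        have h1 := (hr I (by
          calc I < 1 * k := by omega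
            _ ≤ q * k := Nat.mul_le_mul_right _ hq)).1
        have h2 : r + I < N := by
          calc r + I = r / k * k + (r % k + I) := by omega
            _ < r / k * k + k := by omega
            _ = (r / k + 1) * k := by ring
            _ ≤ q * k := Nat.mul_le_mul_right _ hrdivlt
        rw [Nat.mod_eq_of_lt (by omega), if_pos h2, show r + I = r % k + I + k * (r / k) by
          rw [mul_comm]; omega, Nat.add_mul_mod_self_left, Nat.mod_eq_of_lt hI] at h1
        exact h1
      -- Past the end of a repetition, the tuple of `x` continues into the next one. This is `u`
      -- again, unless repetition `r / k` is the last one, and then it is `v`.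
      obtain ⟨y, hy, hxy⟩ : ∃ y ∈ P, ∀ I < k, k ≤ r % k + I → x.getD I [] = y.getD (r % k + I - k) [] := by
        by_cases hlast : r / k + 1 < q
        · refine ⟨u, hu, fun I hI hIk => ?_⟩
          have h1 := (hr I (by
            calc I < 1 * k := by omega
              _ ≤ q * k := Nat.mul_le_mul_right _ hq)).1
          have h2 : r + I < N := by
            calc r + I = r / k * k + (r % k + I) := by omega
              _ < r / k * k + k + k := by omega
              _ = (r / k + 1 + 1) * k := by ring
              _ ≤ q * k := Nat.mul_le_mul_right _ hlast
          rw [Nat.mod_eq_of_lt hI, if_pos h2, show r + I = r % k + I - k + k * (r / k + 1) by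
            rw [Nat.mul_succ, mul_comm]; omega, Nat.add_mul_mod_self_left,
            Nat.mod_eq_of_lt (by omega)] at h1
          exact h1
        · refine ⟨v, hv, fun I hI hIk => ?_⟩
          have h1 := (hr I (by
            calc I < 1 * k := by omega
              _ ≤ q * k := Nat.mul_le_mul_right _ hq)).1
          have hN : N = r / k * k + k := by
            rw [hNdef, show q = r / k + 1 by omega]; ring
          rw [Nat.mod_eq_of_lt hI, if_neg (by omega), show r + I - N = r % k + I - k by omega,
            Nat.mod_eq_of_lt (by omega)] at h1
          exact h1
      have hul := (hP hu).1
      have hyl := (hP hy).1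
      have hxl := (hP hx).1
      have hget : ∀ w ∈ P, ∀ i < k, w[i]? = some (w.getD i []) := fun w hw i hi => by
        rw [List.getD_eq_getElem _ _ (by rw [(hP hw).1]; exact hi), List.getElem?_eq_getElem]
      have heq : u ++ y = u.take (r % k) ++ x ++ y.drop (r % k) := by
        refine List.ext_getElem? fun i => ?_
        have htl : (u.take (r % k)).length = r % k := by simp [hul]; omega
        rw [List.append_assoc]
        rcases lt_or_ge i (r % k) with h1 | h1
        · rw [List.getElem?_append_left (by omega), List.getElem?_append_left (by omega),
            List.getElem?_take_of_lt h1]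
        · rw [List.getElem?_append_right (l₁ := u.take (r % k)) (by omega), htl]
          rcases lt_or_ge i k with h2 | h2
          · rw [List.getElem?_append_left (by omega), List.getElem?_append_left (by omega),
              hget x hx _ (by omega), hxu _ (by omega), hget u hu i h2]
            congr 2; omega
          · rw [List.getElem?_append_right (by omega), hul]
            rcases lt_or_ge (i - r % k) k with h3 | h3
            · rw [List.getElem?_append_left (by omega), hget x hx _ h3, hxy _ h3 (by omega),
                hget y hy _ (by omega)]
              congr 2; omega
            · rw [List.getElem?_append_right (by omega), hxl, List.getElem?_drop]
              congr 1; omega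
      rcases hPR u hu y hy x hx _ _ heq with h1 | h1
      · have := congrArg List.length h1
        simp [hul] at this
        omega
      · have := congrArg List.length h1
        simp [hyl] at this
        omega

end IsTwistedSequence

end Twisted

/-! ### Counting occurrences of a pattern -/

section Counting

variable {A : Type*}

/-- The pattern `v` occurs in `w` with its `o`-th letter at position `d`. -/
def AnchoredAt (v : Word A) (o : ℕ) (w : Word A) (d : ℕ) : Prop :=
  o ≤ d ∧ ∀ i < v.length, w[d - o + i]? = v[i]?

/-- Position `d` of `w` carries a letter of `A`. -/
def IsSymAt (w : Word A) (d : ℕ) : Prop := ∃ a, w[d]? = some (Letter.sym a)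

open Classical in
/-- The difference of the indicator of an occurrence of `v` and `c` times the indicator of a letter
of `A`. -/
noncomputable def discrepancyAt (v : Word A) (o : ℕ) (c : ℝ) (w : Word A) (d : ℕ) : ℝ :=
  (if AnchoredAt v o w d then 1 else 0) - c * (if IsSymAt w d then 1 else 0)

/-- The sum of `discrepancyAt` over the positions of the factor `y` of `x ++ y ++ z`. -/
noncomputable def discrepancy (v : Word A) (o : ℕ) (c : ℝ) (x y z : Word A) : ℝ :=
  ∑ d ∈ Finset.range y.length, discrepancyAt v o c (x ++ y ++ z) (x.length + d)

/-- In every context, the discrepancy of the factor `y` is `r`, up to `err`. -/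
def HasDiscrepancy (v : Word A) (o : ℕ) (c : ℝ) (y : Word A) (r err : ℝ) : Prop :=
  ∀ x z, |discrepancy v o c x y z - r| ≤ err

variable {v : Word A} {o : ℕ} {c : ℝ}

lemma AnchoredAt.isSymAt {a : A} (hv : v[o]? = some (Letter.sym a)) {w : Word A} {d : ℕ}
    (h : AnchoredAt v o w d) : IsSymAt w d := by
  have ho : o < v.length := (List.getElem?_eq_some_iff.1 hv).1
  have := h.2 o ho
  rw [Nat.sub_add_cancel h.1, hv] at this
  exact ⟨a, this⟩

lemma discrepancy_append (x y y' z : Word A) :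
    discrepancy v o c x (y ++ y') z =
      discrepancy v o c x y (y' ++ z) + discrepancy v o c (x ++ y) y' z := by
  simp only [discrepancy, List.length_append, Finset.sum_range_add, List.append_assoc, add_assoc]

lemma abs_discrepancyAt_le (hc : 0 ≤ c) (w : Word A) (d : ℕ) :
    |discrepancyAt v o c w d| ≤ 1 + c := by
  unfold discrepancyAt
  rw [abs_le]
  split_ifs <;> constructor <;> simp <;> linarith

lemma abs_discrepancy_le (hc : 0 ≤ c) (x y z : Word A) :
    |discrepancy v o c x y z| ≤ y.length * (1 + c) := by
  refine (Finset.abs_sum_le_sum_abs _ _).trans ?_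
  refine (Finset.sum_le_sum fun d _ => abs_discrepancyAt_le hc _ _).trans ?_
  simp [mul_add]

namespace HasDiscrepancy

lemma nil : HasDiscrepancy v o c [] 0 0 := fun x z => by simp [discrepancy]

lemma append {y y' : Word A} {r r' e e' : ℝ} (h : HasDiscrepancy v o c y r e)
    (h' : HasDiscrepancy v o c y' r' e') : HasDiscrepancy v o c (y ++ y') (r + r') (e + e') := by
  intro x z
  rw [discrepancy_append]
  have h1 := h x (y' ++ z)
  have h2 := h' (x ++ y) z
  rw [abs_le] at *
  constructor <;> linarith

/-- The pattern is anchored at one of its letters of `A`, so at a spacer both indicators vanish.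
This is why occurrences are counted by an anchor position. -/
lemma of_forall_ne {a : A} (hv : v[o]? = some (Letter.sym a)) {y : Word A}
    (hy : ∀ a, Letter.sym a ∉ y) : HasDiscrepancy v o c y 0 0 := by
  intro x z
  have : discrepancy v o c x y z = 0 := by
    refine Finset.sum_eq_zero fun d hd => ?_
    have hs : ¬ IsSymAt (x ++ y ++ z) (x.length + d) := by
      rintro ⟨b, hb⟩
      rw [List.append_assoc, List.getElem?_append_right (by omega), Nat.add_sub_cancel_left,
        List.getElem?_append_left (by simpa using hd)] at hb
      exact hy b (List.mem_of_getElem? hb)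
    have ha : ¬ AnchoredAt v o (x ++ y ++ z) (x.length + d) := fun h => hs (h.isSymAt hv)
    rw [discrepancyAt, if_neg hs, if_neg ha]; simp
  simp [this]

lemma flatMap_range {f : ℕ → Word A} {r e : ℕ → ℝ} {n : ℕ}
    (h : ∀ i < n, HasDiscrepancy v o c (f i) (r i) (e i)) :
    HasDiscrepancy v o c ((List.range n).flatMap f) (∑ i ∈ Finset.range n, r i)
      (∑ i ∈ Finset.range n, e i) := by
  induction n with
  | zero => simpa using nil
  | succ n ih =>
    rw [List.range_succ, List.flatMap_append, Finset.sum_range_succ, Finset.sum_range_succ]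
    refine (ih fun i hi => h i (by omega)).append ?_
    simpa using h n (by omega)

/-- The context matters only at positions where the window of the pattern sticks out of `y`, and
there are at most `v.length` of those; the indicator of a letter of `A` never depends on the
context. -/
lemma self (hv : o < v.length) (y : Word A) :
    HasDiscrepancy v o c y (discrepancy v o c [] y []) v.length := by
  classical
  intro x z
  have key : ∀ d < y.length, |discrepancyAt v o c (x ++ y ++ z) (x.length + d) -
      discrepancyAt v o c y d| ≤ if d < o ∨ y.length + o < d + v.length then 1 else 0 := by
    intro d hd
    have hget : ∀ i < y.length, (x ++ y ++ z)[x.length + i]? = y[i]? := fun i hi => by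
      rw [List.append_assoc, List.getElem?_append_right (by omega), Nat.add_sub_cancel_left,
        List.getElem?_append_left hi]
    have hsym : IsSymAt (x ++ y ++ z) (x.length + d) ↔ IsSymAt y d := by
      simp only [IsSymAt, hget d hd]
    have heq : discrepancyAt v o c (x ++ y ++ z) (x.length + d) - discrepancyAt v o c y d =
        (if AnchoredAt v o (x ++ y ++ z) (x.length + d) then 1 else 0) -
        (if AnchoredAt v o y d then 1 else 0) := by
      simp only [discrepancyAt, hsym]; ring
    rw [heq]
    by_cases hb : d < o ∨ y.length + o < d + v.length
    · rw [if_pos hb]; split_ifs <;> simp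
    · have : AnchoredAt v o (x ++ y ++ z) (x.length + d) ↔ AnchoredAt v o y d := by
        constructor
        · rintro ⟨h1, h2⟩
          refine ⟨by omega, fun i hi => ?_⟩
          rw [← h2 i hi, ← hget _ (by omega)]
          congr 1; omega
        · rintro ⟨h1, h2⟩
          refine ⟨by omega, fun i hi => ?_⟩
          rw [← h2 i hi, ← hget _ (by omega)]
          congr 1; omega
      simp only [this, sub_self, abs_zero, hb, if_false, le_refl]
  have h1 : discrepancy v o c x y z - discrepancy v o c [] y [] =
      ∑ d ∈ Finset.range y.length, (discrepancyAt v o c (x ++ y ++ z) (x.length + d) -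
        discrepancyAt v o c y d) := by
    simp [discrepancy, Finset.sum_sub_distrib]
  rw [h1]
  refine (Finset.abs_sum_le_sum_abs _ _).trans
    ((Finset.sum_le_sum fun d hd => key d (Finset.mem_range.1 hd)).trans ?_)
  rw [Finset.sum_boole]
  have hsub : (Finset.range y.length).filter (fun d => d < o ∨ y.length + o < d + v.length) ⊆
      Finset.range o ∪ Finset.Ico (y.length + 1 + o - v.length) y.length := by
    intro d hd
    simp only [Finset.mem_filter, Finset.mem_range, Finset.mem_union, Finset.mem_Ico] at hd ⊢
    omega
  have hcard := (Finset.card_le_card hsub).trans (Finset.card_union_le _ _)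
  rw [Finset.card_range, Nat.card_Ico] at hcard
  exact_mod_cast hcard.trans (by omega)

lemma block {a : A} (hv : v[o]? = some (Letter.sym a)) {w : Word A} {r e : ℝ}
    (h : HasDiscrepancy v o c w r e) (q l t : ℕ) :
    HasDiscrepancy v o c (block q l t w) ((l - 1 : ℕ) * r) ((l - 1 : ℕ) * e) := by
  have h1 : HasDiscrepancy v o c (List.replicate (q - t) Letter.b) 0 0 :=
    of_forall_ne hv fun a ha => by simp at ha
  have h2 : HasDiscrepancy v o c (List.replicate t Letter.e) 0 0 :=
    of_forall_ne hv fun a ha => by simp at ha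
  have h3 := flatMap_range (n := l - 1) fun _ _ => h
  rw [← flatten_replicate_eq] at h3
  have := (h1.append h3).append h2
  simpa [TwistedSystem.block] using this

end HasDiscrepancy

lemma sum_range_mul {M : Type*} [AddCommMonoid M] (F : ℕ → M) (m n : ℕ) :
    ∑ i ∈ Finset.range m, ∑ j ∈ Finset.range n, F (i * n + j) = ∑ j ∈ Finset.range (m * n), F j := by
  induction m with
  | zero => simp
  | succ m ih => rw [Finset.sum_range_succ, ih, Nat.succ_mul, Finset.sum_range_add]

/-- All entries of `u` are copied equally often, so the main terms sum to a multiple of the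
vanishing sum of `g`. Only the errors of the `q k (l - 1)` copies remain. -/
lemma HasDiscrepancy.twist {C l : ℕ → ℕ} {n : ℕ} {a : A} (hv : v[o]? = some (Letter.sym a))
    (g : Word A → ℝ) {e : ℝ} (he : 0 ≤ e) {u : List (Word A)}
    (hu : u.length = kSeq C l n) (h : ∀ w ∈ u, HasDiscrepancy v o c w (g w) e)
    (hg : ∑ I ∈ Finset.range (kSeq C l n), g (u.getD I []) = 0) :
    HasDiscrepancy v o c (twist C l n u) 0 (qSeq C l n * kSeq C l n * l n * e) := by
  rw [twist_eq rfl]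
  have key := HasDiscrepancy.flatMap_range (v := v) (o := o) (c := c) (n := qSeq C l n)
    (f := fun m => (List.range (2 ^ (n + 2) * qSeq C l n)).flatMap fun i =>
      (List.range (C n)).flatMap fun c =>
        TwistedSystem.block (qSeq C l n) (l n) (eExp C l n m i) (u.getD (i * C n + c) []))
    (r := fun _ => 0) (e := fun _ => kSeq C l n * ((l n - 1 : ℕ) * e)) ?_
  · intro x z
    have h1 := key x z
    simp only [Finset.sum_const, smul_zero, Finset.card_range, nsmul_eq_mul] at h1
    refine h1.trans ?_
    have h2 : ((l n - 1 : ℕ) : ℝ) ≤ l n := by exact_mod_cast Nat.sub_le _ _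
    calc (qSeq C l n : ℝ) * (kSeq C l n * ((l n - 1 : ℕ) * e))
        ≤ (qSeq C l n : ℝ) * (kSeq C l n * (l n * e)) := by gcongr
      _ = _ := by ring
  · intro m _
    have h2 := HasDiscrepancy.flatMap_range (v := v) (o := o) (c := c)
      (n := 2 ^ (n + 2) * qSeq C l n)
      (f := fun i => (List.range (C n)).flatMap fun c =>
        TwistedSystem.block (qSeq C l n) (l n) (eExp C l n m i) (u.getD (i * C n + c) []))
      (r := fun i => ∑ c ∈ Finset.range (C n), (l n - 1 : ℕ) * g (u.getD (i * C n + c) []))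
      (e := fun _ => ∑ c ∈ Finset.range (C n), (l n - 1 : ℕ) * e) ?_
    · rw [sum_range_mul (fun I => ((l n - 1 : ℕ) : ℝ) * g (u.getD I []))] at h2
      rw [← Finset.mul_sum] at h2
      rw [show 2 ^ (n + 2) * qSeq C l n * C n = kSeq C l n from rfl, hg, mul_zero] at h2
      convert h2 using 1
      simp only [Finset.sum_const, Finset.card_range, nsmul_eq_mul, kSeq]
      push_cast; ring
    · intro i hi
      refine HasDiscrepancy.flatMap_range fun j hj => ?_
      refine (h _ ?_).block hv _ _ _
      have : i * C n + j < u.length := by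
        rw [hu, kSeq]
        calc i * C n + j < i * C n + C n := by omega
          _ = (i + 1) * C n := by ring
          _ ≤ _ := Nat.mul_le_mul_right _ hi
      rw [List.getD_eq_getElem _ _ this]
      exact List.getElem_mem _

/-! ### Concatenations of words and spacers -/

/-- Concatenations of words in `V` and of the letters `b` and `e`. -/
inductive Built (V : Set (Word A)) : Word A → Prop
  | nil : Built V []
  | word {p w : Word A} : p ∈ V → Built V w → Built V (p ++ w)
  | b {w : Word A} : Built V w → Built V (Letter.b :: w)
  | e {w : Word A} : Built V w → Built V (Letter.e :: w)

namespace Built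

variable {V : Set (Word A)}

lemma append {w w' : Word A} (h : Built V w) (h' : Built V w') : Built V (w ++ w') := by
  induction h with
  | nil => simpa
  | word hp _ ih => rw [List.append_assoc]; exact .word hp ih
  | b _ ih => exact .b ih
  | e _ ih => exact .e ih

lemma flatMap {ι : Type*} (L : List ι) {f : ι → Word A} (h : ∀ i ∈ L, Built V (f i)) :
    Built V (L.flatMap f) := by
  induction L with
  | nil => exact .nil
  | cons i L ih =>
    rw [List.flatMap_cons]
    exact (h i (by simp)).append (ih fun j hj => h j (by simp [hj]))

lemma block {w : Word A} (h : Built V w) (q l t : ℕ) : Built V (block q l t w) := by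
  refine (Built.append ?_ ?_).append ?_
  · generalize q - t = k
    induction k with
    | zero => exact .nil
    | succ k ih => exact .b ih
  · rw [flatten_replicate_eq]
    exact flatMap _ fun _ _ => h
  · induction t with
    | zero => exact .nil
    | succ k ih => exact .e ih

lemma twist {C l : ℕ → ℕ} {n : ℕ} {u : List (Word A)} (h : ∀ w ∈ u, Built V w) :
    Built V (twist C l n u) := by
  rw [twist_eq rfl]
  refine flatMap _ fun m _ => flatMap _ fun i _ => flatMap _ fun j _ => block ?_ _ _ _
  by_cases hj : i * C n + j < u.length
  · rw [List.getD_eq_getElem _ _ hj]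
    exact h _ (List.getElem_mem _)
  · rw [List.getD_eq_default _ _ (by omega)]
    exact .nil

lemma hasDiscrepancy {a : A} (hv : v[o]? = some (Letter.sym a)) {κ : ℝ} (hκ : 0 ≤ κ)
    (hV : ∀ p ∈ V, HasDiscrepancy v o c p 0 (κ * p.length)) {y : Word A} (h : Built V y) :
    HasDiscrepancy v o c y 0 (κ * y.length) := by
  have aux : ∀ s : Letter A, (∀ a, Letter.sym a ≠ s) → ∀ w, HasDiscrepancy v o c w 0 (κ * w.length) →
      HasDiscrepancy v o c (s :: w) 0 (κ * (s :: w).length) := by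
    intro s hs w hw x z
    have h1 : HasDiscrepancy v o c [s] 0 0 := .of_forall_ne hv fun a ha => hs a (by simpa using ha)
    have h2 := (h1.append hw) x z
    simp only [add_zero, zero_add, List.singleton_append] at h2
    refine h2.trans ?_
    gcongr
    simp
  induction h with
  | nil => simpa using HasDiscrepancy.nil
  | word hp _ ih =>
    have := (hV _ hp).append ih
    rw [← mul_add] at this
    simpa using this
  | b _ ih => exact aux _ (by simp) _ ih
  | e _ ih => exact aux _ (by simp) _ ih

/-- A cut falls inside at most one word of `V`, of which at most `Q` letters are left over. -/
lemma exists_suffix {Q : ℕ} (hV : ∀ p ∈ V, p.length ≤ Q) {y : Word A} (h : Built V y) :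
    ∀ y₁ y₂, y = y₁ ++ y₂ → ∃ a y', y₂ = a ++ y' ∧ a.length ≤ Q ∧ Built V y' := by
  have aux : ∀ s : Letter A, ∀ w, Built V (s :: w) →
      (∀ y₁ y₂, w = y₁ ++ y₂ → ∃ a y', y₂ = a ++ y' ∧ a.length ≤ Q ∧ Built V y') →
      ∀ y₁ y₂, s :: w = y₁ ++ y₂ → ∃ a y', y₂ = a ++ y' ∧ a.length ≤ Q ∧ Built V y' := by
    intro s w hw ih y₁ y₂ he
    cases y₁ with
    | nil => exact ⟨[], s :: w, by simpa using he.symm, by simp, hw⟩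
    | cons t y₁ =>
      rw [List.cons_append, List.cons.injEq] at he
      exact ih _ _ he.2
  induction h with
  | nil =>
    intro y₁ y₂ he
    obtain ⟨rfl, rfl⟩ := List.append_eq_nil_iff.1 he.symm
    exact ⟨[], [], rfl, by simp, .nil⟩
  | @word p w hp hw ih =>
    intro y₁ y₂ he
    rcases List.append_eq_append_iff.1 he with ⟨d, rfl, rfl⟩ | ⟨d, rfl, rfl⟩
    · exact ih _ _ rfl
    · exact ⟨d, w, rfl, by have := hV _ hp; simp at this; omega, hw⟩
  | b hw ih => exact aux _ _ (.b hw) ih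
  | e hw ih => exact aux _ _ (.e hw) ih

lemma exists_prefix {Q : ℕ} (hV : ∀ p ∈ V, p.length ≤ Q) {y : Word A} (h : Built V y) :
    ∀ y₁ y₂, y = y₁ ++ y₂ → ∃ y' a, y₁ = y' ++ a ∧ a.length ≤ Q ∧ Built V y' := by
  have aux : ∀ s : Letter A, ∀ w, (∀ w', Built V w' → Built V (s :: w')) →
      (∀ y₁ y₂, w = y₁ ++ y₂ → ∃ y' a, y₁ = y' ++ a ∧ a.length ≤ Q ∧ Built V y') →
      ∀ y₁ y₂, s :: w = y₁ ++ y₂ → ∃ y' a, y₁ = y' ++ a ∧ a.length ≤ Q ∧ Built V y' := by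
    intro s w hs ih y₁ y₂ he
    cases y₁ with
    | nil => exact ⟨[], [], rfl, by simp, .nil⟩
    | cons t y₁ =>
      rw [List.cons_append, List.cons.injEq] at he
      obtain ⟨y', a, rfl, ha, hy'⟩ := ih _ _ he.2
      exact ⟨t :: y', a, rfl, ha, he.1 ▸ hs _ hy'⟩
  induction h with
  | nil =>
    intro y₁ y₂ he
    obtain ⟨rfl, rfl⟩ := List.append_eq_nil_iff.1 he.symm
    exact ⟨[], [], rfl, by simp, .nil⟩
  | @word p w hp hw ih =>
    intro y₁ y₂ he
    rcases List.append_eq_append_iff.1 he with ⟨d, rfl, rfl⟩ | ⟨d, rfl, rfl⟩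
    · obtain ⟨y', a, rfl, ha, hy'⟩ := ih _ _ rfl
      exact ⟨p ++ y', a, by simp, ha, .word hp hy'⟩
    · exact ⟨[], y₁, rfl, by have := hV _ hp; simp at this; omega, .nil⟩
  | b hw ih => exact aux _ _ (fun _ => .b) ih
  | e hw ih => exact aux _ _ (fun _ => .e) ih

/-- The discrepancy of an arbitrary factor of a concatenation of words in `V` and spacers. -/
lemma abs_discrepancy_le {a : A} (hv : v[o]? = some (Letter.sym a)) (hc : 0 ≤ c) {κ : ℝ} (hκ : 0 ≤ κ)
    (hV : ∀ p ∈ V, HasDiscrepancy v o c p 0 (κ * p.length)) {Q : ℕ} (hQ : ∀ p ∈ V, p.length ≤ Q)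
    {x y z : Word A} (h : Built V (x ++ y ++ z)) :
    |discrepancy v o c x y z| ≤ κ * y.length + 2 * Q * (1 + c) := by
  have hQ' : ∀ a : Word A, a.length ≤ Q → ∀ x z, |discrepancy v o c x a z| ≤ Q * (1 + c) := by
    intro a ha x z
    refine (TwistedSystem.abs_discrepancy_le hc x a z).trans ?_
    gcongr
  obtain ⟨a, y', h1, ha, hy'⟩ := h.exists_suffix hQ x (y ++ z) (List.append_assoc _ _ _)
  have hpos : 0 ≤ Q * (1 + c) := by positivity
  rcases List.append_eq_append_iff.1 h1 with ⟨d, rfl, rfl⟩ | ⟨d, rfl, rfl⟩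
  · have h2 := hQ' y (by simp at ha; omega) x (d ++ y')
    have : 0 ≤ κ * y.length := by positivity
    linarith
  · obtain ⟨t, a', rfl, ha', ht⟩ := hy'.exists_prefix hQ _ _ rfl
    have h2 := hQ' a ha x (t ++ a' ++ z)
    have h3 := (ht.hasDiscrepancy hv hκ hV) (x ++ a) (a' ++ z)
    have h4 := hQ' a' ha' (x ++ a ++ t) z
    rw [discrepancy_append, discrepancy_append]
    have h5 : κ * t.length ≤ κ * (a ++ (t ++ a')).length := by
      gcongr; simp; omega
    rw [sub_zero] at h3
    have h6 := abs_add_le (discrepancy v o c x a (t ++ a' ++ z))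
      (discrepancy v o c (x ++ a) t (a' ++ z) + discrepancy v o c (x ++ a ++ t) a' z)
    have h7 := abs_add_le (discrepancy v o c (x ++ a) t (a' ++ z))
      (discrepancy v o c (x ++ a ++ t) a' z)
    linarith

end Built

/-- A non-empty word that does not start with `e`, does not end with `b`, and in which no `b` is
followed by `e`. -/
structure IsOrdered (w : Word A) : Prop where
  ne_nil : w ≠ []
  head : w.head? ≠ some Letter.e
  last : w.getLast? ≠ some Letter.b
  chain : w.IsChain fun s t => ¬(s = Letter.b ∧ t = Letter.e)

namespace IsOrdered

lemma append {w w' : Word A} (h : IsOrdered w) (h' : IsOrdered w') : IsOrdered (w ++ w') := by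
  refine ⟨by simp [h.ne_nil], ?_, ?_, ?_⟩
  · rw [List.head?_append_of_ne_nil _ h.ne_nil]; exact h.head
  · rw [List.getLast?_append_of_ne_nil _ h'.ne_nil]; exact h'.last
  · refine List.isChain_append.2 ⟨h.chain, h'.chain, fun s hs t ht hst => ?_⟩
    rw [hst.1] at hs
    exact h.last hs

lemma b_append {w : Word A} (h : IsOrdered w) (k : ℕ) :
    IsOrdered (List.replicate k Letter.b ++ w) := by
  induction k with
  | zero => simpa
  | succ k ih =>
    rw [List.replicate_succ, List.cons_append]
    refine ⟨by simp, by simp, ?_, ?_⟩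
    · rw [List.getLast?_cons_of_ne_nil ih.ne_nil]; exact ih.last
    · refine List.isChain_cons.2 ⟨fun t ht hst => ?_, ih.chain⟩
      rw [hst.2] at ht
      exact ih.head ht

lemma append_e {w : Word A} (h : IsOrdered w) (k : ℕ) :
    IsOrdered (w ++ List.replicate k Letter.e) := by
  induction k with
  | zero => simpa
  | succ k ih =>
    rw [List.replicate_succ', ← List.append_assoc]
    refine ⟨by simp, ?_, by simp, ?_⟩
    · rw [List.head?_append_of_ne_nil _ ih.ne_nil]; exact ih.head
    · refine List.isChain_append.2 ⟨ih.chain, by simp, fun s hs t ht hst => ?_⟩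
      rw [hst.1] at hs
      exact ih.last hs

lemma flatMap_range {f : ℕ → Word A} {n : ℕ} (hn : 0 < n) (h : ∀ i < n, IsOrdered (f i)) :
    IsOrdered ((List.range n).flatMap f) := by
  induction n with
  | zero => omega
  | succ n ih =>
    rw [List.range_succ, List.flatMap_append]
    rcases Nat.eq_zero_or_pos n with rfl | hn
    · simpa using h 0 (by omega)
    · refine (ih hn fun i hi => h i (by omega)).append ?_
      simpa using h n (by omega)

lemma block {w : Word A} (h : IsOrdered w) (q t : ℕ) {l : ℕ} (hl : 2 ≤ l) :
    IsOrdered (block q l t w) := by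
  rw [TwistedSystem.block]
  refine append_e (b_append ?_ _) _
  rw [flatten_replicate_eq]
  exact flatMap_range (by omega) fun _ _ => h

lemma twist {C l : ℕ → ℕ} {n : ℕ} {u : List (Word A)} (hC : ∀ n, 0 < C n) (hl : ∀ n, 2 ≤ l n)
    (hu : u.length = kSeq C l n) (h : ∀ w ∈ u, IsOrdered w) : IsOrdered (twist C l n u) := by
  have hq := qSeq_pos hC (fun n => lt_of_lt_of_le (by norm_num) (hl n)) n
  rw [twist_eq rfl]
  refine flatMap_range hq fun m _ => flatMap_range (by positivity) fun i hi =>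
    flatMap_range (hC n) fun j hj => block (h _ ?_) _ _ (hl n)
  have : i * C n + j < u.length := by
    rw [hu, kSeq]
    calc i * C n + j < i * C n + C n := by omega
      _ = (i + 1) * C n := by ring
      _ ≤ _ := Nat.mul_le_mul_right _ hi
  rw [List.getD_eq_getElem _ _ this]
  exact List.getElem_mem _

end IsOrdered

end Counting

/-! ### Order of spacers, letters and growth in the words of a construction sequence. -/

namespace IsTwistedSequence

variable {A : Type*} {C l : ℕ → ℕ} {W : ℕ → Set (Word A)} (h : IsTwistedSequence C l W)
include h

lemma isOrdered (hl2 : ∀ n, 2 ≤ l n) (n : ℕ) : ∀ w ∈ W n, IsOrdered w := by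
  induction n with
  | zero => rw [h.zero]; rintro _ ⟨a, rfl⟩; constructor <;> simp
  | succ n ih =>
    obtain ⟨P, hP, -, hW⟩ := h.succ n
    rw [hW]
    rintro _ ⟨u, hu, rfl⟩
    exact .twist h.coeff.C_pos hl2 (hP hu).1 fun w hw => ih w ((hP hu).2 w hw)

lemma exists_sym_mem (hl2 : ∀ n, 2 ≤ l n) (n : ℕ) : ∀ w ∈ W n, ∃ a, Letter.sym a ∈ w := by
  have hC := h.coeff.C_pos
  have hl := h.coeff.l_pos
  induction n with
  | zero => rw [h.zero]; rintro _ ⟨a, rfl⟩; simp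
  | succ n ih =>
    obtain ⟨P, hP, -, hW⟩ := h.succ n
    rw [hW]
    rintro _ ⟨u, hu, rfl⟩
    have hq := qSeq_pos hC hl n
    have hk := kSeq_pos hC hl n
    have hu0 : 0 < u.length := by rw [(hP hu).1]; exact hk
    obtain ⟨a, ha⟩ := ih _ ((hP hu).2 _ (List.getElem_mem hu0))
    refine ⟨a, ?_⟩
    rw [twist_eq rfl]
    simp only [List.mem_flatMap, List.mem_range]
    refine ⟨0, hq, 0, by positivity, 0, hC n, ?_⟩
    have hl1 : l n - 1 ≠ 0 := by have := hl2 n; omega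
    simp [block, List.mem_flatten, List.mem_replicate, hl1, ha, hu0]

lemma built {n j : ℕ} (hj : n ≤ j) : ∀ w ∈ W j, Built (W n) w := by
  induction j, hj using Nat.le_induction with
  | base => intro w hw; simpa using Built.word hw .nil
  | succ j hj ih =>
    obtain ⟨P, hP, -, hW⟩ := h.succ j
    rw [hW]
    rintro _ ⟨u, hu, rfl⟩
    exact .twist fun w hw => ih w ((hP hu).2 w hw)

lemma qSeq_mono : Monotone (qSeq C l) := by
  refine monotone_nat_of_le_succ fun n => ?_
  have hq := qSeq_pos h.coeff.C_pos h.coeff.l_pos n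
  have hk := kSeq_pos h.coeff.C_pos h.coeff.l_pos n
  have hl := h.coeff.l_pos n
  rw [qSeq_succ, mul_assoc]
  exact Nat.le_mul_of_pos_right _ (by positivity)

lemma two_pow_le_qSeq (n : ℕ) : 2 ^ n ≤ qSeq C l n := by
  induction n with
  | zero => simp [qSeq]
  | succ n ih =>
    have hq := qSeq_pos h.coeff.C_pos h.coeff.l_pos n
    have hk := four_le_kSeq h.coeff.C_pos h.coeff.l_pos n
    have hl := h.coeff.l_pos n
    rw [qSeq_succ, pow_succ, mul_assoc]
    refine Nat.mul_le_mul ih ?_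
    calc 2 ≤ kSeq C l n * 1 := by omega
      _ ≤ _ := Nat.mul_le_mul_left _ (Nat.mul_pos hl hq)

end IsTwistedSequence

/-! ### Uniqueness of the non-atomic invariant measure -/

section Uniqueness

variable {A : Type*} {C l : ℕ → ℕ} {W : ℕ → Set (Word A)}

instance [Finite A] : Finite (Letter A) := by
  let f : Letter A → Option (Option A) := fun s => match s with
    | .sym a => some (some a)
    | .b => some none
    | .e => none
  refine Finite.of_injective f fun s t h => ?_
  cases s <;> cases t <;> simp_all [f]

instance : MeasurableSingletonClass (Letter A) := ⟨fun _ => trivial⟩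

instance : DiscreteMeasurableSpace (Letter A) := ⟨fun _ => trivial⟩

/-- In every word of `W (n+1)` each word of `W n` is used the same number `r n` of times. -/
def IsBalanced (C l : ℕ → ℕ) (W : ℕ → Set (Word A)) (r : ℕ → ℕ) : Prop :=
  ∀ n, ∀ w' ∈ W (n + 1), ∀ w ∈ W n, ∀ u ∈ tuples (W n) (kSeq C l n), w' = twist C l n u →
    {j : ℕ | j < kSeq C l n ∧ u[j]? = some w}.ncard = r n

lemma sum_eq_of_balanced {k r : ℕ} {S : Finset (Word A)} {u : List (Word A)}
    (hu : u.length = k) (hS : ∀ w ∈ u, w ∈ S)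
    (hr : ∀ w ∈ S, {j : ℕ | j < k ∧ u[j]? = some w}.ncard = r) (g : Word A → ℝ) :
    ∑ I ∈ Finset.range k, g (u.getD I []) = r * ∑ w ∈ S, g w := by
  classical
  have hmaps : ∀ I ∈ Finset.range k, u.getD I [] ∈ S := fun I hI => by
    have : I < u.length := by rw [hu]; exact Finset.mem_range.1 hI
    rw [List.getD_eq_getElem _ _ this]
    exact hS _ (List.getElem_mem _)
  rw [← Finset.sum_fiberwise_of_maps_to hmaps, Finset.mul_sum]
  refine Finset.sum_congr rfl fun w hw => ?_
  rw [Finset.sum_congr rfl (g := fun _ => g w) fun I hI => by rw [(Finset.mem_filter.1 hI).2],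
    Finset.sum_const, nsmul_eq_mul]
  congr 2
  rw [← hr w hw, ← Set.ncard_coe_finset]
  congr 1
  ext I
  simp only [Finset.coe_filter, Finset.mem_range, Set.mem_ofPred_eq]
  refine and_congr_right fun hI => ?_
  have : I < u.length := by omega
  rw [List.getD_eq_getElem _ _ this, List.getElem?_eq_getElem this, Option.some_inj]

/-- Take for `c` the ratio of occurrences of `v` to letters of `A` over all of `W n` together, so
that the discrepancies of the words of `W n` sum to zero. By balance so do those of the entries of
any word of `W (n+1)`. The `q k l` errors of size `v.length` are a proportion `v.length / q` of the
length. -/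
lemma exists_rate (h : IsTwistedSequence C l W) (hl2 : ∀ n, 2 ≤ l n) (hfin : ∀ n, (W n).Finite)
    (hne : ∀ n, (W n).Nonempty) {r : ℕ → ℕ} (hr : IsBalanced C l W r) {v : Word A} {o : ℕ} {a : A}
    (hv : v[o]? = some (Letter.sym a)) (n : ℕ) :
    ∃ c : ℝ, 0 ≤ c ∧ ∀ w ∈ W (n + 1),
      HasDiscrepancy v o c w 0 (v.length / qSeq C l n * w.length) := by
  classical
  have ho : o < v.length := (List.getElem?_eq_some_iff.1 hv).1
  set S := (hfin n).toFinset with hSdef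
  have hS : ∀ w, w ∈ S ↔ w ∈ W n := fun w => (hfin n).mem_toFinset
  set occ : Word A → ℝ := fun w => ∑ d ∈ Finset.range w.length, if AnchoredAt v o w d then 1 else 0
  set sy : Word A → ℝ := fun w => ∑ d ∈ Finset.range w.length, if IsSymAt w d then 1 else 0
  have hocc : ∀ w, 0 ≤ occ w := fun w => Finset.sum_nonneg fun d _ => by split_ifs <;> norm_num
  have hsy : ∀ w ∈ S, 0 < sy w := fun w hw => by
    obtain ⟨b, hb⟩ := h.exists_sym_mem hl2 n w ((hS w).1 hw)
    obtain ⟨i, hi⟩ := List.mem_iff_getElem?.1 hb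
    have hi' : i < w.length := (List.getElem?_eq_some_iff.1 hi).1
    refine Finset.sum_pos' (fun d _ => by split_ifs <;> norm_num)
      ⟨i, Finset.mem_range.2 hi', ?_⟩
    rw [if_pos ⟨b, hi⟩]; norm_num
  have hsyS : 0 < ∑ w ∈ S, sy w := by
    obtain ⟨w, hw⟩ := hne n
    exact Finset.sum_pos hsy ⟨w, (hS w).2 hw⟩
  set c : ℝ := (∑ w ∈ S, occ w) / ∑ w ∈ S, sy w with hcdef
  have hc : 0 ≤ c := div_nonneg (Finset.sum_nonneg fun w _ => hocc w) hsyS.le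
  refine ⟨c, hc, fun w' hw' => ?_⟩
  have hlen := h.length_eq (n + 1) w' hw'
  have hw'0 := hw'
  obtain ⟨P, hP, -, hW⟩ := h.succ n
  rw [hW] at hw'
  obtain ⟨u, hu, rfl⟩ := hw'
  have hg : ∀ w, discrepancy v o c [] w [] = occ w - c * sy w := fun w => by
    simp only [discrepancy, discrepancyAt, occ, sy, Finset.mul_sum, Finset.sum_sub_distrib,
      List.nil_append, List.append_nil, List.length_nil, zero_add]
  have h1 := HasDiscrepancy.twist (c := c) (e := v.length) hv (fun w => discrepancy v o c [] w [])
    (by positivity) (hP hu).1 (fun w _ => HasDiscrepancy.self ho w) ?_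
  · rw [hlen]
    convert h1 using 1
    have hq : (qSeq C l n : ℝ) ≠ 0 := by
      exact_mod_cast (qSeq_pos h.coeff.C_pos h.coeff.l_pos n).ne'
    rw [qSeq_succ]
    push_cast
    field_simp
  · rw [sum_eq_of_balanced (S := S) (hP hu).1 (fun w hw => (hS w).2 ((hP hu).2 w hw))
      (fun w hw => hr n _ hw'0 w ((hS w).1 hw) u (hP hu) rfl)
      (fun w => discrepancy v o c [] w [])]
    simp only [hg, Finset.sum_sub_distrib, ← Finset.mul_sum]
    rw [hcdef, div_mul_cancel₀ _ hsyS.ne', sub_self, mul_zero]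

/-- The sequences in the symbolic shift that carry the word `v` at position `a`. -/
def cylinder (W : ℕ → Set (Word A)) (a : ℤ) (v : Word A) : Set (symbolicShift W) :=
  {x | ∀ i < v.length, v[i]? = some (x.1 (a + i))}

/-- The sequences in the symbolic shift that carry a letter of `A` at position `a`. -/
def symSet (W : ℕ → Set (Word A)) (a : ℤ) : Set (symbolicShift W) :=
  {x | ∃ s, x.1 a = Letter.sym s}

lemma measurable_coord (a : ℤ) : Measurable fun x : symbolicShift W => x.1 a :=
  (measurable_pi_apply a).comp measurable_subtype_coe

lemma measurableSet_cylinder (a : ℤ) (v : Word A) : MeasurableSet (cylinder W a v) := by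
  have : cylinder W a v = ⋂ i : ℕ, ⋂ _ : i < v.length,
      (fun x : symbolicShift W => x.1 (a + i)) ⁻¹' {s | v[i]? = some s} := by
    ext x; simp [cylinder]
  rw [this]
  exact .iInter fun i => .iInter fun _ => measurable_coord _ trivial

lemma measurableSet_symSet (a : ℤ) : MeasurableSet (symSet W a) :=
  measurable_coord a (t := {s | ∃ t, s = Letter.sym t}) trivial

lemma measurable_shift : Measurable (shift W) := by
  refine Measurable.subtype_mk (measurable_pi_lambda _ fun k => ?_)
  exact measurable_coord (k + 1)

section Invariant

variable {ν : Measure (symbolicShift W)}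

lemma measure_cylinder_add (hν : MeasurePreserving (shift W) ν ν) (a : ℤ) (v : Word A) (d : ℕ) :
    ν (cylinder W (a + d) v) = ν (cylinder W a v) := by
  induction d with
  | zero => simp
  | succ d ih =>
    rw [← ih, ← hν.measure_preimage (measurableSet_cylinder (a + d) v).nullMeasurableSet]
    congr 1
    ext x
    simp only [cylinder, Set.mem_preimage, Set.mem_ofPred_eq, shift]
    refine forall₂_congr fun i _ => ?_
    rw [show a + ((d + 1 : ℕ) : ℤ) + i = a + d + i + 1 by push_cast; ring]

lemma measure_symSet_add (hν : MeasurePreserving (shift W) ν ν) (a : ℤ) (d : ℕ) :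
    ν (symSet W (a + d)) = ν (symSet W a) := by
  induction d with
  | zero => simp
  | succ d ih =>
    rw [← ih, ← hν.measure_preimage (measurableSet_symSet (a + d)).nullMeasurableSet]
    congr 1
    ext x
    simp only [symSet, Set.mem_preimage, Set.mem_ofPred_eq, shift]
    rw [show a + ((d + 1 : ℕ) : ℤ) = a + d + 1 by push_cast; ring]

lemma measure_symSet (hν : MeasurePreserving (shift W) ν ν) (a : ℤ) :
    ν (symSet W a) = ν (symSet W 0) := by
  rcases le_total 0 a with h | h
  · obtain ⟨d, rfl⟩ := Int.eq_ofNat_of_zero_le h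
    simpa using measure_symSet_add hν 0 d
  · obtain ⟨d, hd⟩ := Int.eq_ofNat_of_zero_le (neg_nonneg.2 h)
    have := measure_symSet_add hν a d
    rw [← this, show a + (d : ℤ) = 0 by omega]

end Invariant

open Classical in
-- A window of the sequence occurs in a word that is a concatenation of words of `W (n+1)` and
-- spacers; all of these have small discrepancy, and the two ends cost at most one word each.
lemma abs_sum_indicator_le (h : IsTwistedSequence C l W) {v : Word A} {o : ℕ} {a : A}
    (hv : v[o]? = some (Letter.sym a)) {n : ℕ} {c : ℝ} (hc : 0 ≤ c)
    (hd : ∀ w ∈ W (n + 1), HasDiscrepancy v o c w 0 (v.length / qSeq C l n * w.length))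
    (x : symbolicShift W) (p : ℤ) {N : ℕ} (hN : qSeq C l n < N) :
    |∑ d ∈ Finset.range N, ((if x ∈ cylinder W (p + d) v then (1 : ℝ) else 0) -
      c * if x ∈ symSet W (p + o + d) then 1 else 0)| ≤
      v.length / qSeq C l n * N + 2 * qSeq C l (n + 1) * (1 + c) := by
  have ho : o < v.length := (List.getElem?_eq_some_iff.1 hv).1
  obtain ⟨j, w, hw, w₁, w₂, hY⟩ := x.2 p (N + v.length)
  set Y := List.ofFn fun i : Fin (N + v.length) => x.1 (p + i) with hYdef
  have hYlen : Y.length = N + v.length := by simp [Y]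
  have hYget : ∀ i < N + v.length, Y[i]? = some (x.1 (p + i)) := fun i hi => by
    rw [List.getElem?_eq_getElem (by omega)]; simp [Y]
  -- A word containing a window longer than `q_n` cannot come from a level up to `n`.
  have hj : n + 1 ≤ j := by
    by_contra hj
    have h1 := h.length_eq j w hw
    have h2 := h.qSeq_mono (show j ≤ n by omega)
    have h3 := congrArg List.length hY
    simp only [List.length_append, hYlen] at h3
    omega
  have hsplit : w = (w₁ ++ Y.take o) ++ ((Y.drop o).take N) ++ ((Y.drop o).drop N ++ w₂) := by
    rw [← hY]
    simp only [List.append_assoc]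
    rw [← List.append_assoc (List.take N _), List.take_append_drop, ← List.append_assoc (List.take o Y),
      List.take_append_drop]
  have hbuilt := h.built hj w hw
  rw [hsplit] at hbuilt
  have key := hbuilt.abs_discrepancy_le hv hc (κ := v.length / qSeq C l n) (by positivity)
    hd (Q := qSeq C l (n + 1)) (fun p hp => (h.length_eq _ p hp).le)
  have hylen : ((Y.drop o).take N).length = N := by simp [hYlen]; omega
  have hxlen : (w₁ ++ Y.take o).length = w₁.length + o := by simp [hYlen]; omega
  rw [hylen] at key
  refine le_trans (le_of_eq ?_) key
  rw [discrepancy, hylen, hxlen, ← hsplit]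
  congr 1
  refine Finset.sum_congr rfl fun d hd => ?_
  rw [Finset.mem_range] at hd
  have hwget : ∀ i < N + v.length, w[w₁.length + i]? = some (x.1 (p + i)) := fun i hi => by
    rw [← hY, List.append_assoc, List.getElem?_append_right (by omega), Nat.add_sub_cancel_left,
      List.getElem?_append_left (by omega), hYget i hi]
  have h1 : AnchoredAt v o w (w₁.length + o + d) ↔ x ∈ cylinder W (p + d) v := by
    simp only [AnchoredAt, cylinder, Set.mem_ofPred_eq]
    rw [and_iff_right (by omega)]
    refine forall₂_congr fun i hi => ?_
    rw [show w₁.length + o + d - o + i = w₁.length + (d + i) by omega, hwget _ (by omega), eq_comm]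
    push_cast
    rw [add_assoc]
  have h2 : IsSymAt w (w₁.length + o + d) ↔ x ∈ symSet W (p + o + d) := by
    simp only [IsSymAt, symSet, Set.mem_ofPred_eq]
    rw [add_assoc, hwget _ (by omega)]
    push_cast
    simp only [add_assoc, Option.some_inj]
  simp only [discrepancyAt, h1, h2]

/-- Integrate the bound for windows of length `N`. By invariance the integral is `N` times the
quantity to be estimated, and the end effects disappear after division by `N → ∞`. -/
lemma abs_measureReal_cylinder_sub_le (h : IsTwistedSequence C l W) {v : Word A} {o : ℕ} {a : A}
    (hv : v[o]? = some (Letter.sym a)) {n : ℕ} {c : ℝ} (hc : 0 ≤ c)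
    (hd : ∀ w ∈ W (n + 1), HasDiscrepancy v o c w 0 (v.length / qSeq C l n * w.length))
    {ν : Measure (symbolicShift W)} [IsProbabilityMeasure ν] (hν : MeasurePreserving (shift W) ν ν)
    (p : ℤ) :
    |ν.real (cylinder W p v) - c * ν.real (symSet W 0)| ≤ v.length / qSeq C l n := by
  classical
  set κ : ℝ := v.length / qSeq C l n with hκ
  set D : ℝ := 2 * qSeq C l (n + 1) * (1 + c)
  set X := ν.real (cylinder W p v) - c * ν.real (symSet W 0) with hX
  have hN : ∀ N : ℕ, qSeq C l n < N → |X| ≤ κ + D / N := by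
    intro N hN
    have hNpos : (0 : ℝ) < N := by exact_mod_cast (Nat.zero_le _).trans_lt hN
    have hint : ∀ s : Set (symbolicShift W), MeasurableSet s →
        Integrable (fun x => if x ∈ s then (1 : ℝ) else 0) ν ∧
        ∫ x, (if x ∈ s then (1 : ℝ) else 0) ∂ν = ν.real s := by
      intro s hs
      have he : (fun x => if x ∈ s then (1 : ℝ) else 0) = s.indicator 1 := by
        ext x; simp [Set.indicator_apply]
      rw [he]
      exact ⟨(integrable_indicator_iff hs).2 (integrable_const 1).integrableOn, integral_indicator_one hs⟩
    have h1 : ∫ x, ∑ d ∈ Finset.range N, ((if x ∈ cylinder W (p + d) v then (1 : ℝ) else 0) -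
        c * if x ∈ symSet W (p + o + d) then 1 else 0) ∂ν = N * X := by
      rw [integral_finsetSum]
      · rw [Finset.sum_congr rfl (g := fun _ => X), Finset.sum_const, Finset.card_range, nsmul_eq_mul]
        intro d _
        rw [integral_sub (hint _ (measurableSet_cylinder _ _)).1
          ((hint _ (measurableSet_symSet _)).1.const_mul c), integral_const_mul,
          (hint _ (measurableSet_cylinder _ _)).2, (hint _ (measurableSet_symSet _)).2, hX]
        simp only [Measure.real]
        rw [measure_cylinder_add hν, measure_symSet hν]
      · intro d _
        exact (hint _ (measurableSet_cylinder _ _)).1.sub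
          ((hint _ (measurableSet_symSet _)).1.const_mul c)
    have h2 : ‖N * X‖ ≤ (κ * N + D) * ν.real Set.univ := by
      rw [← h1]
      refine norm_integral_le_of_norm_le_const (.of_forall fun x => ?_)
      rw [Real.norm_eq_abs]
      exact abs_sum_indicator_le h hv hc hd x p hN
    rw [Real.norm_eq_abs, abs_mul, abs_of_pos hNpos, probReal_univ, mul_one] at h2
    rw [← sub_le_iff_le_add', le_div_iff₀ hNpos]
    linarith
  have hlim : Tendsto (fun N : ℕ => κ + D / N) atTop (𝓝 (κ + 0)) :=
    tendsto_const_nhds.add (tendsto_const_div_atTop_nhds_zero_nat D)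
  rw [add_zero] at hlim
  exact ge_of_tendsto hlim ((eventually_gt_atTop (qSeq C l n)).mono hN)

/-- The rate `c` depends on `n` but not on the measure, so it cancels in the cross product; the
remaining error is `O(1/q_n)`. -/
lemma measureReal_cylinder_mul_eq (h : IsTwistedSequence C l W) (hl2 : ∀ n, 2 ≤ l n)
    (hfin : ∀ n, (W n).Finite) (hne : ∀ n, (W n).Nonempty) {r : ℕ → ℕ} (hr : IsBalanced C l W r)
    {v : Word A} {o : ℕ} {a : A} (hv : v[o]? = some (Letter.sym a))
    {ν₁ ν₂ : Measure (symbolicShift W)} [IsProbabilityMeasure ν₁] [IsProbabilityMeasure ν₂]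
    (h₁ : MeasurePreserving (shift W) ν₁ ν₁) (h₂ : MeasurePreserving (shift W) ν₂ ν₂) (p : ℤ) :
    ν₂.real (symSet W 0) * ν₁.real (cylinder W p v) =
      ν₁.real (symSet W 0) * ν₂.real (cylinder W p v) := by
  set X := ν₂.real (symSet W 0) * ν₁.real (cylinder W p v) -
      ν₁.real (symSet W 0) * ν₂.real (cylinder W p v) with hX
  have hn : ∀ n, |X| ≤ 2 * v.length / qSeq C l n := by
    intro n
    obtain ⟨c, hc, hd⟩ := exists_rate h hl2 hfin hne hr hv n
    have e1 := abs_measureReal_cylinder_sub_le h hv hc hd h₁ p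
    have e2 := abs_measureReal_cylinder_sub_le h hv hc hd h₂ p
    have b1 : ν₁.real (symSet W 0) ≤ 1 := measureReal_le_one
    have b2 : ν₂.real (symSet W 0) ≤ 1 := measureReal_le_one
    have n1 : 0 ≤ ν₁.real (symSet W 0) := measureReal_nonneg
    have n2 : 0 ≤ ν₂.real (symSet W 0) := measureReal_nonneg
    have : X = ν₂.real (symSet W 0) * (ν₁.real (cylinder W p v) - c * ν₁.real (symSet W 0)) -
        ν₁.real (symSet W 0) * (ν₂.real (cylinder W p v) - c * ν₂.real (symSet W 0)) := by
      rw [hX]; ring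
    rw [this]
    refine (abs_sub _ _).trans ?_
    rw [abs_mul, abs_mul, abs_of_nonneg n1, abs_of_nonneg n2]
    calc _ ≤ 1 * ((v.length : ℝ) / qSeq C l n) + 1 * ((v.length : ℝ) / qSeq C l n) := by gcongr
      _ = _ := by ring
  have hlim : Tendsto (fun n => 2 * (v.length : ℝ) / qSeq C l n) atTop (𝓝 0) := by
    refine tendsto_const_nhds.div_atTop ?_
    refine tendsto_natCast_atTop_atTop.comp ?_
    exact tendsto_atTop_mono (fun n => (Nat.lt_two_pow_self.le.trans (h.two_pow_le_qSeq n))) tendsto_id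
  have : |X| ≤ 0 := ge_of_tendsto' hlim hn
  exact sub_eq_zero.1 (abs_nonpos_iff.1 this)

/-- Since `b` is never followed by `e` in a word (`isOrdered`), a sequence without letters of `A` is
constant or a ray of `e` followed by a ray of `b`. There are only countably many of these, hence a
null set for a measure without atoms. -/
lemma ae_exists_mem_symSet (h : IsTwistedSequence C l W) (hl2 : ∀ n, 2 ≤ l n)
    {ν : Measure (symbolicShift W)} (hν : ∀ x, ν {x} = 0) : ∀ᵐ x ∂ν, ∃ k, x ∈ symSet W k := by
  have : NullSingletonClass ν := ⟨hν⟩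
  rw [ae_iff]
  refine Set.Countable.measure_zero ?_ ν
  let S : Set (ℤ → Letter A) := {fun _ => Letter.b, fun _ => Letter.e} ∪
    Set.range fun j : ℤ => fun k => if k < j then Letter.e else Letter.b
  have hS : S.Countable := (Set.Countable.insert _ (Set.countable_singleton _)).union
    (Set.countable_range _)
  refine (hS.preimage Subtype.val_injective).mono fun x hx => ?_
  have hx' : ∀ k, x.1 k = Letter.b ∨ x.1 k = Letter.e := fun k => by
    match hk : x.1 k with
    | .sym s => exact absurd ⟨k, s, hk⟩ hx
    | .b => simp
    | .e => simp
  have hstep : ∀ k, x.1 k = Letter.b → x.1 (k + 1) = Letter.b := by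
    intro k hk
    obtain ⟨n, w, hw, hinf⟩ := x.2 k 2
    have hchain := ((h.isOrdered hl2 n w hw).chain).infix hinf
    have hof : (List.ofFn fun i : Fin 2 => x.1 (k + i)) = [x.1 k, x.1 (k + 1)] := by simp
    rw [hof, List.isChain_pair] at hchain
    exact (hx' (k + 1)).resolve_right fun h1 => hchain ⟨hk, h1⟩
  have hup : ∀ k k', k ≤ k' → x.1 k = Letter.b → x.1 k' = Letter.b := by
    intro k k' hkk' hk
    induction k', hkk' using Int.leInduction with
    | base => exact hk
    | succ m _ ih => exact hstep m ih
  show x.1 ∈ S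
  by_cases hb : ∃ k, x.1 k = Letter.b
  · by_cases he : ∃ k, x.1 k = Letter.e
    · obtain ⟨k₁, hk₁⟩ := he
      obtain ⟨j, hj, hmin⟩ := Int.exists_least_of_bdd (P := fun k => x.1 k = Letter.b)
        ⟨k₁, fun z hz => le_of_not_ge fun hzk => by
          have := hup z k₁ hzk hz
          rw [hk₁] at this; cases this⟩ hb
      refine Or.inr ⟨j, funext fun k => ?_⟩
      by_cases hk : k < j
      · simp only [hk, if_true]
        exact ((hx' k).resolve_left fun h1 => absurd (hmin k h1) (not_le.2 hk)).symm
      · simp only [hk, if_false]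
        exact (hup j k (not_lt.1 hk) hj).symm
    · refine Or.inl (Or.inl (funext fun k => ?_))
      exact (hx' k).resolve_right fun h1 => he ⟨k, h1⟩
  · refine Or.inl (Or.inr (funext fun k => ?_))
    exact (hx' k).resolve_left fun h1 => hb ⟨k, h1⟩

/-- Windows around `0` of radius at least `K`. -/
def centralCylinders (W : ℕ → Set (Word A)) (K : ℕ) : Set (Set (symbolicShift W)) :=
  {s | ∃ (M : ℕ) (v : Word A), K ≤ M ∧ v.length = 2 * M + 1 ∧ s = cylinder W (-M) v}

lemma mem_cylinder_iff {M : ℕ} {v : Word A} (hv : v.length = 2 * M + 1) (x : symbolicShift W) :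
    x ∈ cylinder W (-M) v ↔ ∀ k : ℤ, -M ≤ k → k ≤ M → v[(k + M).toNat]? = some (x.1 k) := by
  constructor
  · intro hx k h1 h2
    have := hx (k + M).toNat (by omega)
    rwa [show (-(M : ℤ) + ((k + M).toNat : ℤ)) = k by omega] at this
  · intro hx i hi
    have := hx (-M + i) (by omega) (by omega)
    rwa [show (-(M : ℤ) + i + M).toNat = i by omega] at this

/-- If two central windows are compatible, the longer one determines the shorter one, so the
intersection is again one of the two cylinders. -/
lemma isPiSystem_centralCylinders (K : ℕ) : IsPiSystem (centralCylinders W K) := by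
  have key : ∀ M M' : ℕ, ∀ v v' : Word A, M ≤ M' → v.length = 2 * M + 1 → v'.length = 2 * M' + 1 →
      (cylinder W (-M) v ∩ cylinder W (-M') v').Nonempty →
      cylinder W (-M' : ℤ) v' ⊆ cylinder W (-M) v := by
    rintro M M' v v' hM hv hv' ⟨x, hx, hx'⟩ y hy
    rw [mem_cylinder_iff hv] at hx ⊢
    rw [mem_cylinder_iff hv'] at hx' hy
    intro k h1 h2
    rw [hx k h1 h2, ← hx' k (by omega) (by omega), hy k (by omega) (by omega)]
  rintro _ ⟨M, v, hM, hv, rfl⟩ _ ⟨M', v', hM', hv', rfl⟩ hne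
  rcases le_total M M' with h1 | h1
  · rw [Set.inter_eq_right.2 (key M M' v v' h1 hv hv' hne)]
    exact ⟨M', v', hM', hv', rfl⟩
  · rw [Set.inter_comm] at hne ⊢
    rw [Set.inter_eq_right.2 (key M' M v' v h1 hv' hv hne)]
    exact ⟨M, v, hM, hv, rfl⟩

/-- Every coordinate is visible in large enough windows, so small radii can be dropped. A bound `K ≥
|k|` then ensures that each generator decides whether position `k` carries a letter of `A`. -/
lemma generateFrom_centralCylinders [Finite A] (K : ℕ) :
    (inferInstance : MeasurableSpace (symbolicShift W)) =
      MeasurableSpace.generateFrom (centralCylinders W K) := by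
  apply le_antisymm
  · have hcoord : ∀ k : ℤ, Measurable[MeasurableSpace.generateFrom (centralCylinders W K)]
        fun x : symbolicShift W => x.1 k := by
      intro k
      refine @measurable_to_countable' _ _ _ _ (_) _ fun s => ?_
      set M := max K k.natAbs
      have : (fun x : symbolicShift W => x.1 k) ⁻¹' {s} = ⋃ v : Word A,
          ⋃ _ : v.length = 2 * M + 1 ∧ v[(k + M).toNat]? = some s, cylinder W (-M) v := by
        ext x
        simp only [Set.mem_preimage, Set.mem_singleton_iff, Set.mem_iUnion, exists_prop]
        constructor
        · rintro rfl
          refine ⟨List.ofFn fun i : Fin (2 * M + 1) => x.1 (-M + i), ⟨by simp, ?_⟩, ?_⟩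
          · rw [List.getElem?_eq_getElem (by simp; omega)]
            have e : (-(M : ℤ) + ((k + M).toNat : ℤ)) = k := by omega
            simp only [List.getElem_ofFn, e]
          · intro i hi
            rw [List.getElem?_eq_getElem hi]
            simp only [List.getElem_ofFn]
        · rintro ⟨v, ⟨h1, h2⟩, hx⟩
          rw [mem_cylinder_iff h1] at hx
          have := hx k (by omega) (by omega)
          rw [h2, Option.some_inj] at this
          exact this.symm
      rw [this]
      refine @MeasurableSet.iUnion _ _ (_) _ _ fun v => @MeasurableSet.iUnion _ _ (_) _ _ fun hv => ?_
      exact MeasurableSpace.measurableSet_generateFrom ⟨M, v, le_max_left _ _, hv.1, rfl⟩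
    have : Measurable[MeasurableSpace.generateFrom (centralCylinders W K)]
        fun x : symbolicShift W => x.1 := @measurable_pi_lambda _ _ _ (_) _ _ hcoord
    exact this.comap_le
  · refine MeasurableSpace.generateFrom_le ?_
    rintro _ ⟨M, v, -, -, rfl⟩
    exact measurableSet_cylinder _ _

/-- A twisted symbolic system has at most one non-atomic invariant probability measure. -/
theorem measure_eq_of_measurePreserving [Finite A] (h : IsTwistedSequence C l W) (hl2 : ∀ n, 2 ≤ l n)
    (hfin : ∀ n, (W n).Finite) (hne : ∀ n, (W n).Nonempty) {r : ℕ → ℕ} (hr : IsBalanced C l W r)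
    {ν₁ ν₂ : Measure (symbolicShift W)} [IsProbabilityMeasure ν₁] [IsProbabilityMeasure ν₂]
    (h₁ : MeasurePreserving (shift W) ν₁ ν₁) (h₂ : MeasurePreserving (shift W) ν₂ ν₂)
    (ha₁ : ∀ x, ν₁ {x} = 0) (ha₂ : ∀ x, ν₂ {x} = 0) : ν₁ = ν₂ := by
  have hpos : ∀ ν : Measure (symbolicShift W), IsProbabilityMeasure ν →
      MeasurePreserving (shift W) ν ν → (∀ x, ν {x} = 0) → ν (symSet W 0) ≠ 0 := by
    intro ν _ hν ha h0
    have h1 := ae_exists_mem_symSet h hl2 ha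
    have h2 : ν (⋃ k, symSet W k) = 0 := measure_iUnion_null fun k => by rw [measure_symSet hν, h0]
    have h3 : ν (⋃ k, symSet W k) = 1 := by
      rw [prob_compl_eq_zero_iff (.iUnion fun k => measurableSet_symSet k) |>.1]
      rw [ae_iff] at h1
      convert h1 using 2
      ext x; simp
    rw [h2] at h3
    exact zero_ne_one h3
  have hcyl : ∀ {v : Word A} {o : ℕ} {a : A}, v[o]? = some (Letter.sym a) → ∀ p,
      ν₂ (symSet W 0) * ν₁ (cylinder W p v) = ν₁ (symSet W 0) * ν₂ (cylinder W p v) := by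
    intro v o a hv p
    have := measureReal_cylinder_mul_eq h hl2 hfin hne hr hv h₁ h₂ p
    simp only [Measure.real, ← ENNReal.toReal_mul] at this
    exact (ENNReal.toReal_eq_toReal_iff' (ENNReal.mul_ne_top (measure_ne_top _ _) (measure_ne_top _ _))
      (ENNReal.mul_ne_top (measure_ne_top _ _) (measure_ne_top _ _))).1 this
  set c₁ := ν₁ (symSet W 0) with hc₁
  set c₂ := ν₂ (symSet W 0) with hc₂
  have hc₁t : c₁ ≠ ⊤ := measure_ne_top _ _
  have hc₂t : c₂ ≠ ⊤ := measure_ne_top _ _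
  -- The sets `symSet W k` cover almost everything. On each of them the two measures are compared on
  -- central windows that see position `k`: such a window either lies in `symSet W k`, and the cross
  -- product identity applies, or misses it.
  have hμ : c₂ • ν₁ = c₁ • ν₂ := by
    set s : Option ℤ → Set (symbolicShift W) := fun k => match k with
      | none => {x | ¬ ∃ k, x ∈ symSet W k}
      | some k => symSet W k with hs
    have hsU : ⋃ k, s k = Set.univ := by
      ext x
      simp only [Set.mem_iUnion, Set.mem_univ, iff_true]
      by_cases hx : ∃ k, x ∈ symSet W k
      · exact ⟨some hx.choose, hx.choose_spec⟩
      · exact ⟨none, hx⟩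
    rw [Measure.ext_iff_of_iUnion_eq_univ hsU]
    intro k
    cases k with
    | none =>
      have e1 : ν₁ (s none) = 0 := ae_iff.1 (ae_exists_mem_symSet h hl2 ha₁)
      have e2 : ν₂ (s none) = 0 := ae_iff.1 (ae_exists_mem_symSet h hl2 ha₂)
      rw [Measure.restrict_eq_zero.2, Measure.restrict_eq_zero.2] <;> simp [e1, e2]
    | some k =>
      have hf₁ : IsFiniteMeasure (c₂ • ν₁) := ⟨by simp; exact hc₂t.lt_top⟩
      refine ext_of_generate_finite _ (generateFrom_centralCylinders k.natAbs)
        (isPiSystem_centralCylinders _) ?_ ?_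
      · rintro _ ⟨M, v, hM, hv, rfl⟩
        rw [Measure.restrict_apply (measurableSet_cylinder _ _),
          Measure.restrict_apply (measurableSet_cylinder _ _)]
        by_cases hsym : ∃ a, v[(k + M).toNat]? = some (Letter.sym a)
        · obtain ⟨a, ha⟩ := hsym
          have : cylinder W (-M) v ∩ s (some k) = cylinder W (-M) v := by
            refine Set.inter_eq_left.2 fun x hx => ⟨a, ?_⟩
            have := (mem_cylinder_iff hv x).1 hx k (by omega) (by omega)
            rw [ha, Option.some_inj] at this
            exact this.symm
          rw [this]
          simpa using hcyl ha (-M)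
        · have : cylinder W (-M) v ∩ s (some k) = ∅ := by
            refine Set.eq_empty_of_forall_notMem ?_
            rintro x ⟨hx, a, ha⟩
            have := (mem_cylinder_iff hv x).1 hx k (by omega) (by omega)
            exact hsym ⟨a, by rw [this, ha]⟩
          simp [this]
      · simp only [hs, Measure.restrict_apply MeasurableSet.univ, Set.univ_inter, Measure.smul_apply,
          smul_eq_mul, measure_symSet h₁, measure_symSet h₂]
        rw [← hc₁, ← hc₂, mul_comm]
  -- On the whole space the identity reads `c₂ = c₁`, as both measures are probabilities; the common
  -- factor is non-zero and cancels.
  have huniv := congrArg (fun μ => μ Set.univ) hμ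
  simp only [Measure.smul_apply, measure_univ, smul_eq_mul, mul_one] at huniv
  rw [huniv] at hμ
  ext t ht
  have := congrArg (fun μ => μ t) hμ
  simp only [Measure.smul_apply, smul_eq_mul] at this
  exact (ENNReal.mul_right_inj (hpos ν₁ inferInstance h₁ ha₁) hc₁t).1 this

/-- A non-atomic invariant probability measure on a twisted symbolic system is ergodic. -/
theorem isNonatomicErgodic_of_measurePreserving [Finite A] (h : IsTwistedSequence C l W)
    (hl2 : ∀ n, 2 ≤ l n) (hfin : ∀ n, (W n).Finite) (hne : ∀ n, (W n).Nonempty) {r : ℕ → ℕ}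
    (hr : IsBalanced C l W r) {ν : Measure (symbolicShift W)} [IsProbabilityMeasure ν]
    (hν : MeasurePreserving (shift W) ν ν) (ha : ∀ x, ν {x} = 0) : IsNonatomicErgodic W ν := by
  refine ⟨inferInstance, ⟨hν, ⟨fun s hs hinv => ?_⟩⟩, ha⟩
  rw [eventuallyConst_set']
  by_cases h0 : ν s = 0
  · exact Or.inl (by rw [ae_eq_empty]; exact h0)
  right
  -- Conditioning on an invariant set of positive measure gives another non-atomic invariant
  -- probability. By uniqueness it equals `ν`, so the complement of the set is null.
  have hprob : IsProbabilityMeasure (ProbabilityTheory.cond ν s) :=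
    ProbabilityTheory.cond_isProbabilityMeasure h0
  have hcond : MeasurePreserving (shift W) (ProbabilityTheory.cond ν s) (ProbabilityTheory.cond ν s) := by
    have h1 := hν.restrict_preimage hs
    rw [hinv] at h1
    exact h1.smul_measure _
  have heq := measure_eq_of_measurePreserving h hl2 hfin hne hr hν hcond ha fun x => by
    have : ProbabilityTheory.cond ν s ≪ ν := ProbabilityTheory.cond_absolutelyContinuous
    exact this (ha x)
  have h2 : ν sᶜ = 0 := by
    rw [heq, ProbabilityTheory.cond_apply hs]; simp
  rw [ae_eq_univ]
  exact h2

end Uniqueness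

/-! ### Coding a transformation by a twisted symbolic system -/

section Coding

variable {A X : Type*} {C l : ℕ → ℕ} {W : ℕ → Set (Word A)}

/-- Approximate names of level `n`: the word of `W n` that `x` is in, and the position in it. -/
structure CodingScheme (A X : Type*) where
  pos : ℕ → X → ℕ
  word : ℕ → X → Word A

namespace CodingScheme

variable (S : CodingScheme A X)

/-- The letter of level `n` at `x`. -/
def letter (n : ℕ) (x : X) : Option (Letter A) := (S.word n x)[S.pos n x]?

open Classical in
/-- The eventual value of the letters at `x`. -/
noncomputable def limitLetter (x : X) : Letter A :=
  if h : ∃ a, ∀ᶠ n in atTop, S.letter n x = some a then h.choose else Letter.b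

lemma limitLetter_eq {x : X} {a : Letter A} (h : ∀ᶠ n in atTop, S.letter n x = some a) :
    S.limitLetter x = a := by
  have hex : ∃ a, ∀ᶠ n in atTop, S.letter n x = some a := ⟨a, h⟩
  rw [limitLetter, dif_pos hex]
  obtain ⟨n, h1, h2⟩ := (hex.choose_spec.and h).exists
  rw [h1] at h2
  exact Option.some_inj.1 h2

lemma measurable_limitLetter [Finite A] [MeasurableSpace X] (hpos : ∀ n, Measurable (S.pos n))
    (hword : ∀ n w, MeasurableSet {x | S.word n x = w}) : Measurable S.limitLetter := by
  have hcount : Countable (Word A) := inferInstance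
  have h1 : ∀ n a, MeasurableSet {x | S.letter n x = some a} := by
    intro n a
    have : {x | S.letter n x = some a} =
        ⋃ w : Word A, ⋃ i : ℕ, ⋃ _ : w[i]? = some a, {x | S.word n x = w} ∩ S.pos n ⁻¹' {i} := by
      ext x
      simp [letter]
    rw [this]
    exact .iUnion fun w => .iUnion fun i => .iUnion fun _ =>
      (hword n w).inter (hpos n (measurableSet_singleton i))
  have h2 : ∀ a, MeasurableSet {x | ∀ᶠ n in atTop, S.letter n x = some a} := fun a => by
    simp only [eventually_atTop]
    have : {x | ∃ N, ∀ n ≥ N, S.letter n x = some a} =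
        ⋃ N, ⋂ n, ⋂ _ : n ≥ N, {x | S.letter n x = some a} := by ext x; simp
    rw [this]
    exact .iUnion fun N => .iInter fun n => .iInter fun _ => h1 n a
  refine measurable_to_countable' fun a => ?_
  have : S.limitLetter ⁻¹' {a} = {x | ∀ᶠ n in atTop, S.letter n x = some a} ∪
      {x | a = Letter.b ∧ ∀ a', ¬ ∀ᶠ n in atTop, S.letter n x = some a'} := by
    ext x
    simp only [Set.mem_preimage, Set.mem_singleton_iff, Set.mem_union, Set.mem_ofPred_eq]
    constructor
    · rintro rfl
      by_cases hx : ∃ a, ∀ᶠ n in atTop, S.letter n x = some a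
      · left
        obtain ⟨a, ha⟩ := hx
        rwa [S.limitLetter_eq ha]
      · right
        refine ⟨?_, fun a ha => hx ⟨a, ha⟩⟩
        rw [limitLetter, dif_neg hx]
    · rintro (hx | ⟨rfl, hx⟩)
      · exact S.limitLetter_eq hx
      · rw [limitLetter, dif_neg fun ⟨a, ha⟩ => hx a ha]
  rw [this]
  refine (h2 a).union ?_
  by_cases hab : a = Letter.b
  · simp only [hab, true_and]
    have : {x | ∀ a', ¬ ∀ᶠ n in atTop, S.letter n x = some a'} =
        ⋂ a', {x | ∀ᶠ n in atTop, S.letter n x = some a'}ᶜ := by ext x; simp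
    rw [this]
    exact .iInter fun a' => (h2 a').compl
  · simp [hab]

/-- The conditions on an orbit under which the name is read off from the approximate names. -/
structure IsRegular [TopologicalSpace X] (C l : ℕ → ℕ) (T : X ≃ₜ X) (x : X) : Prop where
  step : ∀ᶠ n in atTop, S.word n (T x) = S.word n x ∧ S.pos n (T x) = (S.pos n x + 1) % qSeq C l n
  inner : ∀ M, ∀ᶠ n in atTop, S.pos n x + M < qSeq C l n
  nested : ∀ᶠ n in atTop, S.pos n x ≤ S.pos (n + 1) x ∧ ∀ i < 2 * qSeq C l n,
    (S.word (n + 1) x)[S.pos (n + 1) x - S.pos n x + i]? = (S.word n x)[i % qSeq C l n]?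

variable {S} [TopologicalSpace X] {T : X ≃ₜ X} (h : IsTwistedSequence C l W)
  (hmem : ∀ n x, S.word n x ∈ W n) (hlt : ∀ n x, S.pos n x < qSeq C l n)

/-- For a fixed number of steps the position eventually stays away from the end of the word, so the
addition modulo `q_n` does not wrap around. -/
lemma eventually_iterate {x : X} (hx : ∀ k : ℤ, S.IsRegular C l T ((T ^ k) x)) (i : ℕ) :
    ∀ᶠ n in atTop, S.word n ((T ^ i) x) = S.word n x ∧ S.pos n ((T ^ i) x) = S.pos n x + i := by
  induction i with
  | zero => simp
  | succ i ih =>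
    filter_upwards [ih, (hx i).step, (hx 0).inner (i + 1)] with n h1 h2 h3
    rw [zpow_natCast] at h2
    rw [zpow_zero] at h3
    have h4 : (T ^ (i + 1)) x = T ((T ^ i) x) := by rw [pow_succ']; rfl
    rw [h4, h2.1, h2.2, h1.1, h1.2]
    exact ⟨rfl, Nat.mod_eq_of_lt h3⟩

lemma eventually_zpow {x : X} (hx : ∀ k : ℤ, S.IsRegular C l T ((T ^ k) x)) (k : ℤ) :
    ∀ᶠ n in atTop, S.word n ((T ^ k) x) = S.word n x ∧
      (S.pos n ((T ^ k) x) : ℤ) = S.pos n x + k := by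
  rcases le_total 0 k with hk | hk
  · obtain ⟨i, rfl⟩ := Int.eq_ofNat_of_zero_le hk
    filter_upwards [eventually_iterate hx i] with n hn
    rw [zpow_natCast, hn.1, hn.2]
    simp
  · obtain ⟨i, hi⟩ := Int.eq_ofNat_of_zero_le (neg_nonneg.2 hk)
    have hx' : ∀ j : ℤ, S.IsRegular C l T ((T ^ j) ((T ^ k) x)) := fun j => by
      have : (T ^ j) ((T ^ k) x) = (T ^ (j + k)) x := by rw [zpow_add]; rfl
      rw [this]; exact hx _
    filter_upwards [eventually_iterate hx' i] with n hn
    have : (T ^ i) ((T ^ k) x) = x := by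
      rw [← zpow_natCast, ← hi]
      show (T ^ (-k) * T ^ k) x = x
      rw [zpow_neg, inv_mul_cancel]; rfl
    rw [this] at hn
    refine ⟨hn.1.symm, ?_⟩
    have := hn.2
    omega

include h hmem hlt

/-- Taking `i` equal to the position in `nested` shows that the letter no longer changes with the
level. -/
lemma eventually_letter {x : X} (hx : S.IsRegular C l T x) :
    ∀ᶠ n in atTop, S.letter n x = some (S.limitLetter x) := by
  obtain ⟨N, hN⟩ := eventually_atTop.1 hx.nested
  have hlen := fun n => h.length_eq n _ (hmem n x)
  have hget : ∀ n, (S.word n x)[S.pos n x]? = some ((S.word n x)[S.pos n x]'(by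
    rw [hlen]; exact hlt n x)) := fun n => List.getElem?_eq_getElem _
  have hstep : ∀ n ≥ N, S.letter n x = S.letter N x := by
    intro n hn
    induction n, hn using Nat.le_induction with
    | base => rfl
    | succ n hn ih =>
      rw [← ih]
      have h1 := (hN n hn).1
      have h2 := (hN n hn).2 (S.pos n x) (by have := hlt n x; omega)
      rw [Nat.sub_add_cancel h1, Nat.mod_eq_of_lt (hlt n x)] at h2
      exact h2
  have hev : ∀ᶠ n in atTop, S.letter n x = some ((S.word N x)[S.pos N x]'(by
      rw [hlen]; exact hlt N x)) :=
    eventually_atTop.2 ⟨N, fun n hn => by rw [hstep n hn, letter, hget]⟩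
  rwa [S.limitLetter_eq hev]

lemma eventually_getElem?_word {x : X} (hx : ∀ k : ℤ, S.IsRegular C l T ((T ^ k) x)) (k : ℤ) :
    ∀ᶠ n in atTop, 0 ≤ S.pos n x + k ∧
      (S.word n x)[(S.pos n x + k).toNat]? = some (S.limitLetter ((T ^ k) x)) := by
  filter_upwards [eventually_zpow hx k, eventually_letter h hmem hlt (hx k)] with n h1 h2
  rw [letter, h1.1] at h2
  refine ⟨by omega, ?_⟩
  rw [← h2]
  congr 1; omega

lemma code_mem {x : X} (hx : ∀ k : ℤ, S.IsRegular C l T ((T ^ k) x)) :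
    (fun k : ℤ => S.limitLetter ((T ^ k) x)) ∈ symbolicShift W := by
  intro a m
  have h1 : ∀ᶠ n in atTop, ∀ i ∈ Finset.range m, 0 ≤ S.pos n x + (a + i) ∧
      (S.word n x)[(S.pos n x + (a + i)).toNat]? = some (S.limitLetter ((T ^ (a + i)) x)) :=
    (eventually_all_finset _).2 fun i _ => eventually_getElem?_word h hmem hlt hx _
  obtain ⟨n, hn⟩ := h1.exists
  rcases Nat.eq_zero_or_pos m with rfl | hm
  · exact ⟨n, S.word n x, hmem n x, by simp⟩
  refine ⟨n, S.word n x, hmem n x, ?_⟩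
  set p := (S.pos n x + a).toNat with hp
  have h0 := (hn 0 (by simpa using hm)).1
  have hlast := hn (m - 1) (by simp; omega)
  have hlen : p + m ≤ (S.word n x).length := by
    have := (List.getElem?_eq_some_iff.1 hlast.2).1
    omega
  have : (List.ofFn fun i : Fin m => S.limitLetter ((T ^ (a + (i : ℤ))) x)) =
      ((S.word n x).drop p).take m := by
    refine List.ext_getElem? fun i => ?_
    by_cases hi : i < m
    · rw [List.getElem?_take_of_lt hi, List.getElem?_drop, List.getElem?_eq_getElem (by simpa)]
      simp only [List.getElem_ofFn]
      rw [← (hn i (by simpa)).2]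
      congr 1; omega
    · rw [List.getElem?_eq_none (by simp; omega), List.getElem?_eq_none (by simp; omega)]
  rw [this]
  exact (List.take_prefix _ _).isInfix.trans (List.drop_suffix _ _).isInfix

/-- Composing the nestings of all higher levels, the name of `x` from the start of its level-`n`
word on reads this word twice in succession. The second copy leaves room for a shifted occurrence in
`eventually_eq_of_code_eq`. -/
lemma eventually_code_eq {x : X} (hx : ∀ k : ℤ, S.IsRegular C l T ((T ^ k) x)) :
    ∀ᶠ n in atTop, ∀ i < 2 * qSeq C l n,
      (S.word n x)[i % qSeq C l n]? = some (S.limitLetter ((T ^ (-(S.pos n x : ℤ) + i)) x)) := by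
  have h0 : S.IsRegular C l T x := hx 0
  obtain ⟨N, hN⟩ := eventually_atTop.1 h0.nested
  have hlen := fun n => h.length_eq n _ (hmem n x)
  refine eventually_atTop.2 ⟨N, fun n hn i hi => ?_⟩
  have hq := qSeq_pos h.coeff.C_pos h.coeff.l_pos n
  have key : ∀ m ≥ n + 1, S.pos n x ≤ S.pos m x ∧
      (S.word m x)[S.pos m x - S.pos n x + i]? = (S.word n x)[i % qSeq C l n]? := by
    intro m hm
    induction m, hm using Nat.le_induction with
    | base => exact ⟨(hN n hn).1, (hN n hn).2 i hi⟩
    | succ m hm ih =>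
      have h1 := hN m (by omega)
      have h2 : S.pos m x - S.pos n x + i < qSeq C l m := by
        have h3 := ih.2
        rw [List.getElem?_eq_getElem (l := S.word n x) (by rw [hlen]; exact Nat.mod_lt _ hq)] at h3
        have := (List.getElem?_eq_some_iff.1 h3).1
        rwa [hlen] at this
      refine ⟨ih.1.trans h1.1, ?_⟩
      have h3 := h1.2 (S.pos m x - S.pos n x + i) (by omega)
      rw [Nat.mod_eq_of_lt h2] at h3
      rw [← ih.2, ← h3]
      congr 1
      have := h1.1; have := ih.1
      omega
  obtain ⟨m, h1, h2⟩ := ((eventually_getElem?_word h hmem hlt hx (-(S.pos n x : ℤ) + i)).and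
    (eventually_ge_atTop (n + 1))).exists
  rw [← (key m h2).2, ← h1.2]
  congr 1
  have := (key m h2).1
  omega

/-- If the positions differed, the level-`n` word of one point would occur with a shift less than
`q_n` in the square of the word of the other, against `noShiftedOccurrence`. With equal positions
the words agree letter by letter. -/
lemma eventually_eq_of_code_eq (hl10 : ∀ n, 10 ≤ l n) {x y : X}
    (hx : ∀ k : ℤ, S.IsRegular C l T ((T ^ k) x)) (hy : ∀ k : ℤ, S.IsRegular C l T ((T ^ k) y))
    (hxy : ∀ k : ℤ, S.limitLetter ((T ^ k) x) = S.limitLetter ((T ^ k) y)) :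
    ∀ᶠ n in atTop, S.pos n x = S.pos n y ∧ S.word n x = S.word n y := by
  have aux : ∀ {x y : X}, (∀ k : ℤ, S.limitLetter ((T ^ k) x) = S.limitLetter ((T ^ k) y)) → ∀ n,
      (∀ i < 2 * qSeq C l n,
      (S.word n x)[i % qSeq C l n]? = some (S.limitLetter ((T ^ (-(S.pos n x : ℤ) + i)) x))) →
      (∀ i < 2 * qSeq C l n,
      (S.word n y)[i % qSeq C l n]? = some (S.limitLetter ((T ^ (-(S.pos n y : ℤ) + i)) y))) →
      ¬ S.pos n y < S.pos n x := by
    intro x y hxy n h1 h2 hlt'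
    have hx' := hlt n x
    have hlen := h.length_eq n _ (hmem n x)
    refine h.noShiftedOccurrence hl10 n _ (hmem n x) _ (hmem n x) _ (hmem n y)
      (S.pos n x - S.pos n y) (by omega) (by omega) fun j hj => ?_
    have e1 := h1 (S.pos n x - S.pos n y + j) (by omega)
    have e2 := h2 j (by omega)
    rw [Nat.mod_eq_of_lt hj, ← hxy] at e2
    rw [e2, show -(S.pos n y : ℤ) + j = -(S.pos n x : ℤ) + (S.pos n x - S.pos n y + j : ℕ) by omega,
      ← e1]
    have hd2 : S.pos n x - S.pos n y + j < 2 * qSeq C l n := by omega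
    clear e1 e2
    generalize S.pos n x - S.pos n y + j = d at *
    by_cases hd : d < qSeq C l n
    · rw [List.getElem?_append_left (by omega), Nat.mod_eq_of_lt hd]
    · rw [List.getElem?_append_right (by omega), hlen, Nat.mod_eq_sub_mod (by omega),
        Nat.mod_eq_of_lt (by omega)]
  filter_upwards [eventually_code_eq h hmem hlt hx, eventually_code_eq h hmem hlt hy] with n h1 h2
  have hp : S.pos n x = S.pos n y :=
    le_antisymm (not_lt.1 (aux hxy n h1 h2)) (not_lt.1 (aux (fun k => (hxy k).symm) n h2 h1))
  refine ⟨hp, List.ext_getElem? fun i => ?_⟩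
  have e1 := h.length_eq n _ (hmem n x)
  have e2 := h.length_eq n _ (hmem n y)
  by_cases hi : i < qSeq C l n
  · have h3 := h1 i (by omega)
    have h4 := h2 i (by omega)
    rw [Nat.mod_eq_of_lt hi] at h3 h4
    rw [h3, h4, hp, hxy]
  · rw [List.getElem?_eq_none (by omega), List.getElem?_eq_none (by omega)]

end CodingScheme

open CodingScheme

lemma measurePreserving_zpow [TopologicalSpace X] [MeasurableSpace X] [BorelSpace X] {μ : Measure X}
    {T : X ≃ₜ X} (hT : MeasurePreserving T μ μ) (k : ℤ) : MeasurePreserving (T ^ k : X ≃ₜ X) μ μ := by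
  have hinv : MeasurePreserving (T⁻¹ : X ≃ₜ X) μ μ := MeasurePreserving.symm T.toMeasurableEquiv hT
  induction k using Int.induction_on with
  | zero => exact MeasurePreserving.id μ
  | succ i ih => rw [zpow_add_one]; exact ih.comp hT
  | pred i ih => rw [zpow_sub_one]; exact ih.comp hinv

/-- A transformation with a separating coding scheme is isomorphic to the symbolic system with its
unique non-atomic ergodic measure. -/
theorem isIsomorphic_of_codingScheme [Finite A] [TopologicalSpace X] [MeasurableSpace X] [BorelSpace X]
    [StandardBorelSpace X] {μ : Measure X} [IsProbabilityMeasure μ] (hμ : ∀ x, μ {x} = 0)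
    {T : X ≃ₜ X} (hT : MeasurePreserving T μ μ) (h : IsTwistedSequence C l W)
    (hl10 : ∀ n, 10 ≤ l n) (hfin : ∀ n, (W n).Finite) (hne : ∀ n, (W n).Nonempty) {r : ℕ → ℕ}
    (hr : IsBalanced C l W r) (S : CodingScheme A X) (hmem : ∀ n x, S.word n x ∈ W n)
    (hlt : ∀ n x, S.pos n x < qSeq C l n) (hpos : ∀ n, Measurable (S.pos n))
    (hword : ∀ n w, MeasurableSet {x | S.word n x = w}) (hreg : ∀ᵐ x ∂μ, S.IsRegular C l T x)
    {G : Set X} (hG : ∀ᵐ x ∂μ, x ∈ G) (hsep : ∀ x ∈ G, ∀ y ∈ G,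
      (∀ᶠ n in atTop, S.pos n x = S.pos n y ∧ S.word n x = S.word n y) → x = y) :
    (∃! ν : Measure (symbolicShift W), IsNonatomicErgodic W ν) ∧
      ∀ ν : Measure (symbolicShift W), IsNonatomicErgodic W ν → IsIsomorphic μ T ν (shift W) := by
  have hl2 : ∀ n, 2 ≤ l n := fun n => by have := hl10 n; omega
  have hall : ∀ᵐ x ∂μ, x ∈ G ∧ ∀ k : ℤ, S.IsRegular C l T ((T ^ k) x) :=
    hG.and (ae_all_iff.2 fun k => (measurePreserving_zpow hT k).quasiMeasurePreserving.ae hreg)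
  -- The set of good points need not be measurable; remove a measurable hull of its complement.
  obtain ⟨Y, hYsub, hYmeas, hYnull⟩ : ∃ Y : Set X, (∀ x ∈ Y, x ∈ G ∧
      ∀ k : ℤ, S.IsRegular C l T ((T ^ k) x)) ∧ MeasurableSet Y ∧ ∀ᵐ x ∂μ, x ∈ Y := by
    refine ⟨(toMeasurable μ {x | ¬ (x ∈ G ∧ ∀ k : ℤ, S.IsRegular C l T ((T ^ k) x))})ᶜ, fun x hx => ?_,
      (measurableSet_toMeasurable _ _).compl, ?_⟩
    · by_contra hc
      exact hx (subset_toMeasurable _ _ hc)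
    · rw [ae_iff]
      simp only [Set.mem_compl_iff, not_not, Set.ofPred_mem_eq, measure_toMeasurable]
      exact ae_iff.1 hall
  obtain ⟨x₀, hx₀⟩ : Y.Nonempty := by
    obtain ⟨x, hx⟩ := hYnull.exists
    exact ⟨x, hx⟩
  classical
  let code : X → ℤ → Letter A := fun x k => S.limitLetter ((T ^ k) x)
  have hcode : ∀ x ∈ Y, code x ∈ symbolicShift W := fun x hx => code_mem h hmem hlt (hYsub x hx).2
  -- Outside `Y` the name may leave the symbolic shift, so a fixed name is used there.
  let φ : X → symbolicShift W := fun x =>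
    if hx : x ∈ Y then ⟨code x, hcode x hx⟩ else ⟨code x₀, hcode x₀ hx₀⟩
  have hφY : ∀ x ∈ Y, (φ x).1 = code x := fun x hx => by simp [φ, hx]
  have hcodemeas : Measurable code := measurable_pi_lambda _ fun k =>
    (S.measurable_limitLetter hpos hword).comp (T ^ k : X ≃ₜ X).continuous.measurable
  have hφmeas : Measurable φ := by
    have : (fun x => (φ x).1) = fun x => if x ∈ Y then code x else code x₀ := by
      ext x
      by_cases hx : x ∈ Y <;> simp [φ, hx]
    refine Measurable.subtype_mk (f := fun x => (φ x).1) ?_ (h := fun x => (φ x).2)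
    rw [this]
    exact Measurable.ite hYmeas hcodemeas measurable_const
  have hφinj : Set.InjOn φ Y := by
    intro x hx y hy hxy
    refine hsep x (hYsub x hx).1 y (hYsub y hy).1
      (eventually_eq_of_code_eq h hmem hlt hl10 (hYsub x hx).2 (hYsub y hy).2 fun k => ?_)
    have := congrArg Subtype.val hxy
    rw [hφY x hx, hφY y hy] at this
    exact congrFun this k
  have hφT : ∀ᵐ x ∂μ, φ (T x) = shift W (φ x) := by
    filter_upwards [hYnull, hT.quasiMeasurePreserving.ae hYnull] with x h1 h2
    refine Subtype.ext (funext fun k => ?_)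
    rw [hφY _ h2]
    show code (T x) k = (φ x).1 (k + 1)
    rw [hφY _ h1]
    show S.limitLetter ((T ^ k) (T x)) = S.limitLetter ((T ^ (k + 1)) x)
    rw [zpow_add_one]; rfl
  set ν₀ := μ.map φ with hν₀
  have hφmp : MeasurePreserving φ μ ν₀ := hφmeas.measurePreserving μ
  have hprob : IsProbabilityMeasure ν₀ := Measure.isProbabilityMeasure_map hφmeas.aemeasurable
  have hinv : MeasurePreserving (shift W) ν₀ ν₀ := by
    refine ⟨measurable_shift, ?_⟩
    rw [hν₀, Measure.map_map measurable_shift hφmeas,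
      Measure.map_congr (g := φ ∘ T) (by filter_upwards [hφT] with x hx; exact hx.symm),
      ← Measure.map_map hφmeas T.continuous.measurable, hT.map_eq]
  have hsing : ∀ z : symbolicShift W, MeasurableSet {z} := fun z => by
    have : ({z} : Set (symbolicShift W)) = ⋂ k : ℤ, (fun x : symbolicShift W => x.1 k) ⁻¹' {z.1 k} := by
      ext x
      simp only [Set.mem_singleton_iff, Set.mem_iInter, Set.mem_preimage, Subtype.ext_iff, funext_iff]
    rw [this]
    exact .iInter fun k => measurable_coord k (measurableSet_singleton _)
  have hatoms : ∀ z, ν₀ {z} = 0 := fun z => by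
    rw [hν₀, Measure.map_apply hφmeas (hsing z)]
    have hsub : (φ ⁻¹' {z} ∩ Y).Subsingleton := fun x hx y hy =>
      hφinj hx.2 hy.2 (hx.1.trans hy.1.symm)
    have h1 : μ (φ ⁻¹' {z} ∩ Y) = 0 := by
      rcases hsub.eq_empty_or_singleton with h0 | ⟨x, hx⟩
      · simp [h0]
      · rw [hx, hμ]
    have h2 : μ Yᶜ = 0 := ae_iff.1 hYnull
    refine le_antisymm ((measure_mono fun x hx => ?_).trans
      ((measure_union_le (φ ⁻¹' {z} ∩ Y) Yᶜ).trans (by rw [h1, h2, add_zero]))) (zero_le)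
    by_cases hxY : x ∈ Y
    · exact Or.inl ⟨hx, hxY⟩
    · exact Or.inr hxY
  have herg := isNonatomicErgodic_of_measurePreserving h hl2 hfin hne hr hinv hatoms
  have huniq : ∀ ν : Measure (symbolicShift W), IsNonatomicErgodic W ν → ν = ν₀ := fun ν hν => by
    have := hν.prob
    exact measure_eq_of_measurePreserving h hl2 hfin hne hr hν.ergodic.toMeasurePreserving hinv
      hν.noAtoms hatoms
  refine ⟨⟨ν₀, herg, huniq⟩, fun ν hν => ?_⟩
  rw [huniq ν hν]
  have hYborel : StandardBorelSpace Y := hYmeas.standardBorel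
  -- By the Lusin–Souslin theorem the injective coding of the standard Borel set `Y` is an
  -- embedding, so its inverse extends to a measurable map.
  have hemb : MeasurableEmbedding fun x : Y => φ x :=
    Measurable.measurableEmbedding (hφmeas.comp measurable_subtype_coe)
      fun x y hxy => Subtype.ext (hφinj x.2 y.2 hxy)
  have : Nonempty X := ⟨x₀⟩
  obtain ⟨ψ, hψmeas, hψ⟩ := hemb.exists_measurable_extend measurable_subtype_coe fun _ => this
  have hψY : ∀ x ∈ Y, ψ (φ x) = x := fun x hx => congrFun hψ ⟨x, hx⟩
  have hrange : ∀ᵐ z ∂ν₀, z ∈ Set.range fun x : Y => φ x := by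
    refine (ae_map_iff hφmeas.aemeasurable hemb.measurableSet_range).2 ?_
    filter_upwards [hYnull] with x hx
    exact ⟨⟨x, hx⟩, rfl⟩
  have hleft : ∀ᵐ x ∂μ, ψ (φ x) = x := by
    filter_upwards [hYnull] with x hx using hψY x hx
  refine ⟨φ, ψ, hφmp, ⟨hψmeas, ?_⟩, hleft, ?_, hφT⟩
  · rw [hν₀, Measure.map_map hψmeas hφmeas, Measure.map_congr (show ψ ∘ φ =ᵐ[μ] id from hleft), Measure.map_id]
  · filter_upwards [hrange] with z hz
    obtain ⟨x, rfl⟩ := hz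
    simp only [hψY x.1 x.2]

end Coding

/-! ### Separately holomorphic functions of two variables -/

open Real in
/-- The circle integral over `∂B(b, r)` as a functional on the continuous functions of the angle. -/
noncomputable def circleFunctional (b : ℂ) (r : ℝ) : C(Set.Icc 0 (2 * π), ℂ) →L[ℂ] ℂ :=
  LinearMap.mkContinuousOfExistsBound
    { toFun := fun f => ∫ θ in 0..2 * π, deriv (circleMap b r) θ * Set.IccExtend two_pi_pos.le f θ
      map_add' := fun f g => by
        rw [← intervalIntegral.integral_add]
        · refine intervalIntegral.integral_congr fun θ _ => ?_
          simp [Set.IccExtend, mul_add]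
        all_goals
          refine Continuous.intervalIntegrable ?_ _ _
          simp only [deriv_circleMap]
          have := f.continuous.Icc_extend' (h := two_pi_pos.le)
          have := g.continuous.Icc_extend' (h := two_pi_pos.le)
          fun_prop
      map_smul' := fun c f => by
        rw [RingHom.id_apply, smul_eq_mul, ← intervalIntegral.integral_const_mul]
        refine intervalIntegral.integral_congr fun θ _ => ?_
        simp [Set.IccExtend]
        ring }
    ⟨|r| * (2 * π), fun f => by
      refine (intervalIntegral.norm_integral_le_of_norm_le_const (C := |r| * ‖f‖) fun θ _ => ?_).trans ?_
      · rw [norm_mul]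
        gcongr
        · simp [deriv_circleMap]
        · exact f.norm_coe_le_norm _
      · rw [sub_zero, abs_of_pos two_pi_pos]
        exact le_of_eq (by ring)⟩

open Real in
lemma circleFunctional_apply (b : ℂ) (r : ℝ) (f : C(Set.Icc 0 (2 * π), ℂ)) (g : ℂ → ℂ)
    (hfg : ∀ θ, f θ = g (circleMap b r θ)) : circleFunctional b r f = ∮ w in C(b, r), g w := by
  show ∫ θ in 0..2 * π, deriv (circleMap b r) θ * Set.IccExtend two_pi_pos.le f θ = _
  refine intervalIntegral.integral_congr fun θ hθ => ?_
  rw [Set.uIcc_of_le two_pi_pos.le] at hθ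
  simp only [smul_eq_mul]
  rw [Set.IccExtend_of_mem _ _ hθ, hfg]

open Real in
/-- Osgood's lemma. -/
theorem analyticOnNhd_of_separately {g : ℂ × ℂ → ℂ} {U : Set (ℂ × ℂ)} (hU : IsOpen U)
    (hg : ContinuousOn g U) (h1 : ∀ z ∈ U, DifferentiableAt ℂ (fun w => g (w, z.2)) z.1)
    (h2 : ∀ z ∈ U, DifferentiableAt ℂ (fun w => g (z.1, w)) z.2) : AnalyticOnNhd ℂ g U := by
  rintro ⟨a, b⟩ hz
  obtain ⟨r, hr, hsub⟩ := Metric.nhds_basis_closedBall.mem_iff.1 (hU.mem_nhds hz)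
  have hr0 := hr.le
  rw [← closedBall_prod_same] at hsub
  have hmem : ∀ z ∈ Metric.closedBall a r, ∀ w ∈ Metric.closedBall b r, (z, w) ∈ U :=
    fun z hz w hw => hsub ⟨hz, hw⟩
  have hcirc : ∀ θ : ℝ, circleMap b r θ ∈ Metric.closedBall b r :=
    fun θ => circleMap_mem_closedBall b hr0 θ
  have hcont : Continuous fun p : Metric.closedBall a r × Set.Icc 0 (2 * π) =>
      g (p.1, circleMap b r p.2) := by
    refine hg.comp_continuous (by fun_prop) fun p => hmem _ p.1.2 _ (hcirc _)
  -- View `g` on discs in the first variable and a circle in the second as a function of `z` with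
  -- values in the Banach space of continuous functions of the angle. Cauchy's formula in `z` makes
  -- this vector-valued function `F` analytic.
  let A : C(Metric.closedBall a r, C(Set.Icc 0 (2 * π), ℂ)) := ContinuousMap.curry ⟨_, hcont⟩
  classical
  let f : ℂ → C(Set.Icc 0 (2 * π), ℂ) := fun z => if hz : z ∈ Metric.closedBall a r then A ⟨z, hz⟩ else 0
  have hf : ∀ z ∈ Metric.closedBall a r, ∀ θ : Set.Icc 0 (2 * π), f z θ = g (z, circleMap b r θ) :=
    fun z hz θ => by simp only [f, dif_pos hz]; rfl
  have hfc : ContinuousOn f (Metric.closedBall a r) := by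
    rw [continuousOn_iff_continuous_domRestrict]
    convert A.continuous using 1
    ext1 z
    simp only [Set.domRestrict_apply, f, dif_pos z.2]
  have hint : CircleIntegrable f a r :=
    (hfc.mono Metric.sphere_subset_closedBall).circleIntegrable hr0
  let F : ℂ → C(Set.Icc 0 (2 * π), ℂ) := fun z => (2 * π * Complex.I : ℂ)⁻¹ • ∮ w in C(a, r), (w - z)⁻¹ • f w
  have hFan : AnalyticAt ℂ F a := by
    lift r to NNReal using hr0
    exact (hasFPowerSeriesOn_cauchy_integral hint hr).analyticAt
  have hFeval : ∀ z ∈ Metric.ball a r, ∀ θ : Set.Icc 0 (2 * π), F z θ = g (z, circleMap b r θ) := by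
    intro z hz θ
    have hd : DifferentiableOn ℂ (fun w => g (w, circleMap b r θ)) (Metric.closedBall a r) :=
      fun w hw => (h1 (w, circleMap b r θ) (hmem w hw _ (hcirc _))).differentiableWithinAt
    have := hd.diffContOnCl_ball subset_rfl |>.two_pi_i_inv_smul_circleIntegral_sub_inv_smul hz
    rw [← this]
    show (ContinuousMap.evalCLM ℂ θ) (F z) = _
    have hne : ∀ w ∈ Metric.sphere a r, w - z ≠ 0 := fun w hw h0 => by
      rw [sub_eq_zero] at h0
      rw [Metric.mem_sphere] at hw; rw [Metric.mem_ball, ← h0] at hz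
      exact hz.ne hw
    have hint' : CircleIntegrable (fun w => (w - z)⁻¹ • f w) a r :=
      ContinuousOn.circleIntegrable hr0 <| ContinuousOn.smul
        (ContinuousOn.inv₀ (by fun_prop) hne) (hfc.mono Metric.sphere_subset_closedBall)
    simp only [F, map_smul]
    congr 1
    rw [circleIntegral, circleIntegral, ← ContinuousLinearMap.intervalIntegral_comp_comm _ hint'.out]
    refine intervalIntegral.integral_congr fun φ _ => ?_
    simp only [map_smul]
    congr 2
    exact hf _ (circleMap_mem_closedBall a hr0 φ) θ
  -- The Cauchy kernel of the second variable, as a function of `w`, is an inverse in the Banach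
  -- algebra of continuous functions, hence analytic in `w`.
  let cb : C(Set.Icc 0 (2 * π), ℂ) := ⟨fun θ => circleMap b r θ, by fun_prop⟩
  let κ : ℂ → C(Set.Icc 0 (2 * π), ℂ) := fun w => Ring.inverse (cb - w • 1)
  have hne : ∀ w ∈ Metric.ball b r, ∀ θ : Set.Icc 0 (2 * π), circleMap b r θ - w ≠ 0 := fun w hw θ h0 => by
    rw [sub_eq_zero] at h0
    rw [Metric.mem_ball, ← h0] at hw
    exact hw.ne (circleMap_mem_sphere b hr0 θ)
  have hunit : ∀ w ∈ Metric.ball b r, ∃ u : C(Set.Icc 0 (2 * π), ℂ)ˣ, (u : C(Set.Icc 0 (2 * π), ℂ)) = cb - w • 1 ∧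
      ∀ θ, (↑u⁻¹ : C(Set.Icc 0 (2 * π), ℂ)) θ = (circleMap b r θ - w)⁻¹ := fun w hw =>
    ⟨⟨cb - w • 1, ⟨fun θ => (circleMap b r θ - w)⁻¹,
      Continuous.inv₀ (by fun_prop) (hne w hw)⟩, by ext θ; simp [cb, hne w hw θ],
      by ext θ; simp [cb, hne w hw θ]⟩, rfl, fun θ => rfl⟩
  have hκan : AnalyticAt ℂ κ b := by
    obtain ⟨u, hu, -⟩ := hunit b (Metric.mem_ball_self hr)
    have h3 := analyticAt_inverse (𝕜 := ℂ) u
    rw [hu] at h3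
    refine h3.comp_of_eq (f := fun w : ℂ => cb - w • (1 : C(Set.Icc 0 (2 * π), ℂ))) ?_ rfl
    exact analyticAt_const.sub (analyticAt_id.smul analyticAt_const)
  have hκeval : ∀ w ∈ Metric.ball b r, ∀ θ, κ w θ = (circleMap b r θ - w)⁻¹ := fun w hw θ => by
    obtain ⟨u, hu, hu'⟩ := hunit w hw
    simp only [κ, ← hu, Ring.inverse_unit, hu']
  have key : ∀ z ∈ Metric.ball a r, ∀ w ∈ Metric.ball b r,
      (2 * π * Complex.I : ℂ)⁻¹ • circleFunctional b r (κ w * F z) = g (z, w) := by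
    intro z hz w hw
    have hd : DifferentiableOn ℂ (fun w => g (z, w)) (Metric.closedBall b r) := fun w hw =>
      (h2 (z, w) (hmem z (Metric.ball_subset_closedBall hz) _ hw)).differentiableWithinAt
    have := hd.diffContOnCl_ball subset_rfl |>.two_pi_i_inv_smul_circleIntegral_sub_inv_smul hw
    rw [← this, circleFunctional_apply b r _ fun ζ => (ζ - w)⁻¹ • g (z, ζ)]
    intro θ
    rw [ContinuousMap.mul_apply, hκeval w hw, hFeval z hz, smul_eq_mul]
  -- Joint analyticity is now clear: a product of a function of `w` and a function of `z` in a
  -- Banach algebra, followed by a continuous linear functional.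
  have hfinal : AnalyticAt ℂ (fun p : ℂ × ℂ =>
      (2 * π * Complex.I : ℂ)⁻¹ • circleFunctional b r (κ p.2 * F p.1)) (a, b) := by
    have h3 : AnalyticAt ℂ (fun p : ℂ × ℂ => κ p.2 * F p.1) (a, b) :=
      (hκan.comp_of_eq (f := fun p : ℂ × ℂ => p.2) analyticAt_snd rfl).mul
        (hFan.comp_of_eq (f := fun p : ℂ × ℂ => p.1) analyticAt_fst rfl)
    have h4 : AnalyticAt ℂ (fun p : ℂ × ℂ => circleFunctional b r (κ p.2 * F p.1)) (a, b) :=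
      ((circleFunctional b r).analyticAt (κ b * F a)).comp_of_eq
        (f := fun p : ℂ × ℂ => κ p.2 * F p.1) h3 rfl
    exact (analyticAt_const (𝕜 := ℂ) (v := (2 * π * Complex.I : ℂ)⁻¹)).smul h4
  refine hfinal.congr ?_
  filter_upwards [prod_mem_nhds (Metric.ball_mem_nhds a hr) (Metric.ball_mem_nhds b hr)] with p hp
  exact key _ hp.1 _ hp.2

lemma isOpen_Omega (ρ : ℝ) : IsOpen (Omega ρ) :=
  (isOpen_lt (f := fun z : ℂ × ℂ => |z.1.im|) (by fun_prop) continuous_const).inter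
    (isOpen_lt (f := fun z : ℂ × ℂ => |z.2.im|) (by fun_prop) continuous_const)

/-- Uniform limits of holomorphic functions of two variables are analytic. -/
theorem analyticOnNhd_of_tendstoUniformlyOn {F : ℕ → ℂ × ℂ → ℂ} {g : ℂ × ℂ → ℂ} {U : Set (ℂ × ℂ)}
    (hU : IsOpen U) (hF : ∀ n, Differentiable ℂ (F n)) (h : TendstoUniformlyOn F g atTop U) :
    AnalyticOnNhd ℂ g U := by
  -- One-variable locally uniform convergence along each coordinate line gives separate
  -- differentiability; continuity of the limit then allows Osgood's lemma.
  have aux : ∀ (ι : ℂ → ℂ × ℂ), Differentiable ℂ ι → ∀ w, ι w ∈ U → DifferentiableAt ℂ (g ∘ ι) w := by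
    intro ι hι w hw
    have hV : IsOpen (ι ⁻¹' U) := hU.preimage hι.continuous
    exact ((h.comp ι).tendstoLocallyUniformlyOn.differentiableOn
      (Eventually.of_forall fun n => ((hF n).comp hι).differentiableOn) hV).differentiableAt
      (hV.mem_nhds hw)
  refine analyticOnNhd_of_separately hU
    (h.continuousOn (Frequently.of_forall fun n => (hF n).continuous.continuousOn))
    (fun z hz => aux (fun w => (w, z.2)) (by fun_prop) z.1 hz)
    fun z hz => aux (fun w => (z.1, w)) (by fun_prop) z.2 hz

/-- The periodic displacement of a limit of holomorphic maps belongs to `C^ω_ρ(𝕋²)`. -/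
theorem mem_COmega_of_tendstoUniformlyOn {ρ : ℝ} (hρ : 0 < ρ) {F : ℕ → ℂ × ℂ → ℂ} {g : ℂ × ℂ → ℂ}
    (hF : ∀ n, Differentiable ℂ (F n)) (hper : ∀ n z (a b : ℤ), F n (z.1 + a, z.2 + b) = F n z)
    (hreal : ∀ n (x : ℝ × ℝ), (F n (x.1, x.2)).im = 0) (h : TendstoUniformlyOn F g atTop (Omega ρ))
    (hb : ∃ M : ℝ, ∀ z ∈ Omega ρ, ‖g z‖ ≤ M) :
    (fun x : ℝ × ℝ => (g (x.1, x.2)).re) ∈ COmega ρ := by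
  have hmem : ∀ x : ℝ × ℝ, ((x.1 : ℂ), (x.2 : ℂ)) ∈ Omega ρ := fun x => by simp [Omega, hρ]
  have hlim := fun z hz => h.tendsto_at (x := z) hz
  have han := analyticOnNhd_of_tendstoUniformlyOn (isOpen_Omega ρ) hF h
  refine ⟨fun x a b => ?_, fun x _ => ?_, g, han.differentiableOn, fun x => ?_, hb⟩
  · refine congrArg Complex.re
      (tendsto_nhds_unique (hlim _ (hmem (x.1 + a, x.2 + b))) ((hlim _ (hmem x)).congr fun n => ?_))
    rw [← hper n (x.1, x.2) a b]
    push_cast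
    rfl
  · have h3 : AnalyticAt ℝ g (x.1, x.2) := (han _ (hmem x)).restrictScalars
    refine (Complex.reCLM.analyticAt _).comp (h3.comp_of_eq (f := fun x : ℝ × ℝ => ((x.1 : ℂ), (x.2 : ℂ))) ?_ rfl)
    exact ((Complex.ofRealCLM.comp (.fst ℝ ℝ ℝ)).prod (Complex.ofRealCLM.comp (.snd ℝ ℝ ℝ))).analyticAt x
  · have : (g (x.1, x.2)).im = 0 := tendsto_nhds_unique
      ((Complex.continuous_im.tendsto _).comp (hlim _ (hmem x)))
      (by simp only [Function.comp_def, hreal]; exact tendsto_const_nhds)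
    apply Complex.ext <;> simp [this]

/-! ### Entire functions of period one -/

/-- `c` is the restriction to the reals of an entire function of period one. -/
def IsEntirePeriodic (c : UnitAddCircle → ℝ) : Prop :=
  ∃ u : ℂ → ℂ, Differentiable ℂ u ∧ (∀ z, u (z + 1) = u z) ∧ ∀ x : ℝ, u x = (c x : ℂ)

lemma volume_unitAddCircle : (volume : Measure UnitAddCircle) = AddCircle.haarAddCircle := by
  simp [AddCircle.volume_eq_smul_haarAddCircle]

instance : IsProbabilityMeasure (volume : Measure UnitAddCircle) :=
  volume_unitAddCircle ▸ inferInstance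

lemma IsEntirePeriodic.zero : IsEntirePeriodic 0 :=
  ⟨0, differentiable_const _, by simp, by simp⟩

lemma IsEntirePeriodic.add {c d : UnitAddCircle → ℝ} (hc : IsEntirePeriodic c)
    (hd : IsEntirePeriodic d) : IsEntirePeriodic (c + d) := by
  obtain ⟨u, hu, hu1, hu2⟩ := hc
  obtain ⟨v, hv, hv1, hv2⟩ := hd
  exact ⟨u + v, hu.add hv, by simp [hu1, hv1], by simp [hu2, hv2]⟩

lemma IsEntirePeriodic.continuous {c : UnitAddCircle → ℝ} (hc : IsEntirePeriodic c) :
    Continuous c := by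
  obtain ⟨u, hu, -, hu2⟩ := hc
  refine (QuotientAddGroup.isQuotientMap_mk (N := AddSubgroup.zmultiples (1 : ℝ))).continuous_iff.2 ?_
  have : c ∘ (QuotientAddGroup.mk : ℝ → UnitAddCircle) = fun x : ℝ => (u x).re := by
    ext x; rw [hu2]; simp
  rw [this]
  exact Complex.continuous_re.comp (hu.continuous.comp Complex.continuous_ofReal)

lemma IsEntirePeriodic.nsmul {c : UnitAddCircle → ℝ} (hc : IsEntirePeriodic c) (q : ℕ) :
    IsEntirePeriodic fun x => c (q • x) := by
  obtain ⟨u, hu, hu1, hu2⟩ := hc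
  have hper : Function.Periodic u 1 := hu1
  refine ⟨fun z => u (q * z), hu.comp (by fun_prop), fun z => ?_, fun x => ?_⟩
  · simpa [mul_add] using (hper.nat_mul q) (q * z)
  · show u (q * x) = ((c (q • (x : UnitAddCircle)) : ℝ) : ℂ)
    rw [← AddCircle.coe_nsmul, ← hu2]; simp

/-- The real part of `a e^{2πinx}` extends to an entire function as half the sum of `a e^{2πinz}`
and its reflected conjugate. -/
lemma isEntirePeriodic_re_fourier (a : ℂ) (n : ℤ) :
    IsEntirePeriodic fun x => (a * fourier (T := 1) n x).re := by
  refine ⟨fun z => (a * Complex.exp (2 * Real.pi * Complex.I * n * z) +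
    (starRingEnd ℂ) a * Complex.exp (2 * Real.pi * Complex.I * (-n : ℤ) * z)) / 2, by fun_prop, fun z => ?_,
    fun x => ?_⟩
  · have : ∀ m : ℤ, Complex.exp (2 * Real.pi * Complex.I * m * (z + 1)) =
        Complex.exp (2 * Real.pi * Complex.I * m * z) := fun m => by
      rw [mul_add, Complex.exp_add, mul_one, mul_comm _ (m : ℂ), Complex.exp_int_mul_two_pi_mul_I, mul_one]
    simp only [this]
  · have h1 : ∀ m : ℤ, fourier (T := 1) m x = Complex.exp (2 * Real.pi * Complex.I * m * x) := fun m => by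
      rw [fourier_coe_apply]; simp
    simp only [← h1]
    rw [fourier_neg, ← map_mul, Complex.add_conj]
    push_cast
    ring

/-- The entire periodic functions are dense in measure. -/
theorem exists_isEntirePeriodic_approx {v : UnitAddCircle → ℝ} (hv : Measurable v) {B : ℝ}
    (hB : ∀ x, |v x| ≤ B) {ε : ℝ} (hε : 0 < ε) :
    ∃ c, IsEntirePeriodic c ∧ volume {x | ε ≤ |c x - v x|} ≤ ENNReal.ofReal ε := by
  rw [volume_unitAddCircle]
  have hmem : MemLp (fun x => (v x : ℂ)) 1 (AddCircle.haarAddCircle (T := 1)) :=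
    MemLp.of_bound (Complex.measurable_ofReal.comp hv).aestronglyMeasurable B
      (Eventually.of_forall fun x => by simpa using hB x)
  -- Taking real parts is not complex linear; the free factor `a` absorbs scalars in the induction
  -- over the span.
  have hspan : ∀ f ∈ Submodule.span ℂ (Set.range (fourierLp (T := 1) 1)), ∀ a : ℂ,
      ∃ c, IsEntirePeriodic c ∧ ∀ᵐ x ∂AddCircle.haarAddCircle, (a * f x).re = c x := by
    intro f hf
    induction hf using Submodule.span_induction with
    | mem f hf =>
      obtain ⟨n, rfl⟩ := hf
      exact fun a => ⟨_, isEntirePeriodic_re_fourier a n, by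
        filter_upwards [coeFn_fourierLp (T := 1) 1 n] with x hx
        rw [hx]⟩
    | zero =>
      exact fun a => ⟨0, .zero, by
        filter_upwards [Lp.coeFn_zero ℂ 1 (AddCircle.haarAddCircle (T := 1))] with x _
        simp⟩
    | add f g _ _ ihf ihg =>
      intro a
      obtain ⟨c, hc, hc'⟩ := ihf a
      obtain ⟨d, hd, hd'⟩ := ihg a
      refine ⟨c + d, hc.add hd, ?_⟩
      filter_upwards [hc', hd', Lp.coeFn_add f g] with x h1 h2 h3
      rw [h3, Pi.add_apply, mul_add, Complex.add_re, h1, h2, Pi.add_apply]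
    | smul b f _ ih =>
      intro a
      obtain ⟨c, hc, hc'⟩ := ih (a * b)
      refine ⟨c, hc, ?_⟩
      filter_upwards [hc', Lp.coeFn_smul b f] with x h1 h2
      rw [h2, Pi.smul_apply, smul_eq_mul, ← mul_assoc, h1]
  have hdense : hmem.toLp ∈ (Submodule.span ℂ (Set.range (fourierLp (T := 1) 1))).topologicalClosure := by
    rw [span_fourierLp_closure_eq_top (by simp)]; trivial
  rw [← SetLike.mem_coe, Submodule.topologicalClosure_coe, Metric.mem_closure_iff] at hdense
  -- An `L¹` error of `ε²` gives, by Markov's inequality, a set of measure at most `ε` where the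
  -- error reaches `ε`.
  obtain ⟨f, hf, hdist⟩ := hdense (ε * ε) (by positivity)
  obtain ⟨c, hc, hcf⟩ := hspan f hf 1
  refine ⟨c, hc, ?_⟩
  have h1 : eLpNorm (fun x => c x - v x) 1 (AddCircle.haarAddCircle (T := 1)) ≤ ENNReal.ofReal (ε * ε) := by
    rw [Lp.dist_def] at hdist
    have hfin : eLpNorm (⇑hmem.toLp - ⇑f) 1 AddCircle.haarAddCircle ≠ ⊤ :=
      ((Lp.memLp _).sub (Lp.memLp _)).eLpNorm_ne_top
    refine le_trans ?_ ((ENNReal.le_ofReal_iff_toReal_le hfin (by positivity)).2 hdist.le)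
    refine eLpNorm_mono_ae ?_
    filter_upwards [hcf, hmem.coeFn_toLp] with x h2 h3
    rw [Pi.sub_apply, h3, ← h2, one_mul, Real.norm_eq_abs, abs_sub_comm]
    refine le_trans (le_of_eq ?_) (Complex.abs_re_le_norm _)
    simp
  have h2 := meas_ge_le_mul_pow_eLpNorm_enorm (AddCircle.haarAddCircle (T := 1)) (p := 1) one_ne_zero (by simp)
    (f := fun x => c x - v x) (hc.continuous.measurable.sub hv).aestronglyMeasurable
    (ε := ENNReal.ofReal ε) (by simpa using hε) (by simp)
  simp only [ENNReal.toReal_one, ENNReal.rpow_one] at h2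
  have hset : {x : UnitAddCircle | ε ≤ |c x - v x|} = {x | ENNReal.ofReal ε ≤ ‖c x - v x‖ₑ} := by
    ext x
    simp only [Set.mem_ofPred_eq]
    rw [← ofReal_norm, ENNReal.ofReal_le_ofReal_iff (norm_nonneg _), Real.norm_eq_abs]
  rw [hset]
  refine h2.trans ((mul_le_mul_right h1 _).trans ?_)
  rw [← ENNReal.ofReal_inv_of_pos hε, ← ENNReal.ofReal_mul (by positivity)]
  exact ENNReal.ofReal_le_ofReal (by field_simp; exact le_refl _)

/-! ### The group of entire torus maps -/

/-- `F` is an entire extension of a lift of `T`. -/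
structure IsEntireLift (F : ℂ × ℂ → ℂ × ℂ) (T : Torus → Torus) : Prop where
  differentiable : Differentiable ℂ F
  periodic : ∀ z (a b : ℤ), F (z.1 + a, z.2 + b) = ((F z).1 + a, (F z).2 + b)
  real : ∀ x : ℝ × ℝ, ∃ y : ℝ × ℝ, F (x.1, x.2) = (↑y.1, ↑y.2) ∧ T (toTorus x) = toTorus y

lemma IsEntireLift.comp {F G : ℂ × ℂ → ℂ × ℂ} {S T : Torus → Torus} (hF : IsEntireLift F S)
    (hG : IsEntireLift G T) : IsEntireLift (F ∘ G) (S ∘ T) where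
  differentiable := hF.differentiable.comp hG.differentiable
  periodic z a b := by rw [Function.comp_apply, hG.periodic, hF.periodic]; rfl
  real x := by
    obtain ⟨y, hy, hy'⟩ := hG.real x
    obtain ⟨w, hw, hw'⟩ := hF.real y
    exact ⟨w, by rw [Function.comp_apply, hy, hw], by rw [Function.comp_apply, hy', hw']⟩

/-- A homeomorphism of `ℂ²` together with a homeomorphism of the torus. -/
abbrev MapPair := ((ℂ × ℂ) ≃ₜ (ℂ × ℂ)) × (Torus ≃ₜ Torus)

/-- The measure-preserving torus homeomorphisms that have, with their inverses, entire lifts. -/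
def entireGroup : Subgroup MapPair where
  carrier := {h | IsEntireLift h.1 h.2 ∧ IsEntireLift h.1.symm h.2.symm ∧
    MeasurePreserving h.2 volume volume}
  mul_mem' {g h} hg hh := ⟨hg.1.comp hh.1, hh.2.1.comp hg.2.1, hg.2.2.comp hh.2.2⟩
  one_mem' := by
    have : IsEntireLift (id : ℂ × ℂ → ℂ × ℂ) (id : Torus → Torus) :=
      ⟨differentiable_id, fun _ _ _ => rfl, fun x => ⟨x, rfl, rfl⟩⟩
    exact ⟨this, this, MeasurePreserving.id _⟩
  inv_mem' {h} hh := ⟨hh.2.1, hh.1, MeasurePreserving.symm h.2.toMeasurableEquiv hh.2.2⟩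

lemma entireGroup.measurePreserving {h : MapPair} (hh : h ∈ entireGroup) :
    MeasurePreserving h.2 volume volume := hh.2.2

/-- The exchange of coordinates. -/
noncomputable def exchange : MapPair := (Homeomorph.prodComm ℂ ℂ, Homeomorph.prodComm UnitAddCircle UnitAddCircle)

lemma IsEntireLift.swap {F : ℂ × ℂ → ℂ × ℂ} {T : Torus → Torus} (hF : IsEntireLift F T) :
    IsEntireLift (fun z => (F z.swap).swap) (fun x => (T x.swap).swap) where
  differentiable := by
    have h1 : Differentiable ℂ (Prod.swap : ℂ × ℂ → ℂ × ℂ) := differentiable_snd.prodMk differentiable_fst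
    exact h1.comp (hF.differentiable.comp h1)
  periodic z a b := by
    have := hF.periodic z.swap b a
    simp only [Prod.fst_swap, Prod.snd_swap] at this
    simp [this]
  real x := by
    obtain ⟨y, hy, hy'⟩ := hF.real x.swap
    simp only [Prod.fst_swap, Prod.snd_swap] at hy
    have : (toTorus x).swap = toTorus x.swap := rfl
    exact ⟨y.swap, by simp [hy], by simp only [this, hy']; rfl⟩

/-- The exchange itself is not in the group, since it also exchanges the integer translations;
conjugating by it does that twice. -/
lemma exchange_conj_mem {h : MapPair} (hh : h ∈ entireGroup) :
    exchange * h * exchange ∈ entireGroup := by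
  have hs : MeasurePreserving (Prod.swap : Torus → Torus) volume volume := Measure.measurePreserving_swap
  exact ⟨hh.1.swap, hh.2.1.swap, hs.comp (hh.2.2.comp hs)⟩

/-- The shear of a product of groups along a function. -/
def shear {α : Type*} [TopologicalSpace α] [AddGroup α] [IsTopologicalAddGroup α] (u : α → α)
    (hu : Continuous u) : (α × α) ≃ₜ (α × α) where
  toFun z := (z.1, z.2 + u z.1)
  invFun z := (z.1, z.2 - u z.1)
  left_inv z := by simp
  right_inv z := by simp
  continuous_toFun := by fun_prop
  continuous_invFun := by fun_prop

lemma measurePreserving_shear {v : UnitAddCircle → UnitAddCircle} (hv : Measurable v) :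
    MeasurePreserving (fun x : Torus => (x.1, x.2 + v x.1)) volume volume :=
  MeasurePreserving.skew_product (g := fun x y => y + v x) (MeasurePreserving.id _)
    (measurable_snd.add (hv.comp measurable_fst))
    (Eventually.of_forall fun _ => map_add_right_eq_self _ _)

lemma isEntireLift_shear {c : UnitAddCircle → ℝ} {u : ℂ → ℂ} (hu : Differentiable ℂ u)
    (hu1 : ∀ z, u (z + 1) = u z) (hu2 : ∀ x : ℝ, u x = (c x : ℂ)) :
    IsEntireLift (fun z => (z.1, z.2 + u z.1)) (fun x => (x.1, x.2 + (c x.1 : UnitAddCircle))) where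
  differentiable := by fun_prop
  periodic z a b := by
    have hper : Function.Periodic u 1 := hu1
    have := hper.int_mul a z.1
    rw [mul_one] at this
    simp only [this, Prod.mk.injEq, true_and]
    ring
  real x := ⟨(x.1, x.2 + c x.1), by simp [hu2], rfl⟩

/-- Entire shears along the second coordinate. -/
lemma exists_shear_mem {c : UnitAddCircle → ℝ} (hc : IsEntirePeriodic c) :
    ∃ h ∈ entireGroup, (∃ u : ℂ → ℂ, (∀ z, h.1 z = (z.1, z.2 + u z.1)) ∧
      ∀ a : ℝ, (∀ x, c (x + a) = c x) → ∀ z, u (z + a) = u z) ∧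
      ∀ x, h.2 x = (x.1, x.2 + (c x.1 : UnitAddCircle)) := by
  have hcc := hc.continuous
  have hcoe : Continuous fun x : UnitAddCircle => (c x : UnitAddCircle) :=
    (AddCircle.continuous_mk' 1).comp hcc
  obtain ⟨u, hu, hu1, hu2⟩ := hc
  refine ⟨(shear u hu.continuous, shear (fun x => (c x : UnitAddCircle)) hcoe),
    ⟨isEntireLift_shear hu hu1 hu2, ?_, measurePreserving_shear hcoe.measurable⟩,
    ⟨u, fun z => rfl, fun a ha z => ?_⟩, fun x => rfl⟩
  · convert isEntireLift_shear (u := -u) (c := -c) hu.neg (by simp [hu1]) (by simp [hu2]) using 2 with x x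
    · exact Prod.ext rfl (sub_eq_add_neg _ _)
    · exact Prod.ext rfl ((sub_eq_add_neg _ _).trans (by simp))
  -- A real period of the restriction is a period of the entire function, by the identity theorem
  -- along points `1/(n+1)`. It is used for the commutation with rotations on `ℂ²`.
  · have h1 : AnalyticOnNhd ℂ (fun z => u (z + a)) Set.univ :=
      (hu.comp (by fun_prop : Differentiable ℂ fun z : ℂ => z + a)).differentiableOn.analyticOnNhd isOpen_univ
    have h2 : AnalyticOnNhd ℂ u Set.univ := hu.differentiableOn.analyticOnNhd isOpen_univ
    have h3 : ∃ᶠ z in 𝓝[≠] (0 : ℂ), u (z + a) = u z := by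
      have ht : Tendsto (fun n : ℕ => ((1 / ((n : ℝ) + 1) : ℝ) : ℂ)) atTop (𝓝[≠] 0) := by
        refine tendsto_nhdsWithin_iff.2 ⟨?_, Eventually.of_forall fun n => ?_⟩
        · rw [← Complex.ofReal_zero]
          exact (Complex.continuous_ofReal.tendsto _).comp tendsto_one_div_add_atTop_nhds_zero_nat
        · simp only [Set.mem_compl_iff, Set.mem_singleton_iff, Complex.ofReal_eq_zero]
          positivity
      refine ht.frequently (Frequently.of_forall fun n => ?_)
      rw [← Complex.ofReal_add, hu2, hu2, AddCircle.coe_add, ha]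
    exact congrFun (h1.eq_of_frequently_eq h2 h3) z

/-- The rotations in the first coordinate. -/
noncomputable def rot (α : ℝ) : MapPair :=
  (Homeomorph.addRight ((α : ℂ), 0), Homeomorph.addRight ((α : UnitAddCircle), 0))

lemma rot_fst (α : ℝ) (z : ℂ × ℂ) : (rot α).1 z = (z.1 + α, z.2) :=
  Prod.ext rfl (add_zero _)

lemma rot_snd (α : ℝ) (x : Torus) : (rot α).2 x = (x.1 + (α : UnitAddCircle), x.2) :=
  Prod.ext rfl (add_zero _)

lemma rot_add (α β : ℝ) : rot (α + β) = rot α * rot β := by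
  refine Prod.ext (Homeomorph.ext fun z => ?_) (Homeomorph.ext fun x => ?_)
  · rw [Prod.fst_mul, Homeomorph.mul_apply, rot_fst, rot_fst, rot_fst]
    push_cast
    exact Prod.ext (by ring) rfl
  · rw [Prod.snd_mul, Homeomorph.mul_apply, rot_snd, rot_snd, rot_snd, AddCircle.coe_add]
    exact Prod.ext (by simp only [add_comm (α : UnitAddCircle), add_assoc]) rfl

lemma rot_zero : rot 0 = 1 := by
  have := rot_add 0 0
  rwa [add_zero, left_eq_mul] at this

lemma rot_neg (α : ℝ) : rot (-α) = (rot α)⁻¹ := by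
  rw [eq_inv_iff_mul_eq_one, ← rot_add, neg_add_cancel, rot_zero]

lemma rot_nat_mul (m : ℕ) (α : ℝ) : rot (m * α) = rot α ^ m := by
  induction m with
  | zero => simp [rot_zero]
  | succ m ih => rw [pow_succ, ← ih, ← rot_add]; push_cast; ring_nf

lemma rot_mem (α : ℝ) : rot α ∈ entireGroup := by
  have h1 : ∀ α : ℝ, IsEntireLift (fun z => (z.1 + α, z.2)) (fun x => (x.1 + (α : UnitAddCircle), x.2)) :=
    fun α => ⟨by fun_prop, fun z a b => by simp [add_right_comm], fun x => ⟨(x.1 + α, x.2), by simp, rfl⟩⟩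
  have h2 : ∀ α : ℝ, IsEntireLift (rot α).1 (rot α).2 := fun α => by
    convert h1 α using 1
    · ext1 z; exact rot_fst α z
    · ext1 x; exact rot_snd α x
  refine ⟨h2 α, ?_, ?_⟩
  · have := h2 (-α)
    rwa [rot_neg] at this
  · have := (measurePreserving_add_right (volume : Measure UnitAddCircle) (α : UnitAddCircle)).prod
      (MeasurePreserving.id (volume : Measure UnitAddCircle))
    have h3 : ⇑(rot α).2 = Prod.map (· + (α : UnitAddCircle)) id := funext fun x => rot_snd α x
    show MeasurePreserving (rot α).2 volume volume
    rw [h3]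
    exact this

/-! ### Approximation in measure by entire maps -/

/-- `g` preserves the measure and is a limit in measure of entire maps commuting with the rotation
by `1 / q`. -/
def Approximable (q : ℕ) (g : Torus → Torus) : Prop :=
  MeasurePreserving g volume volume ∧ ∀ ε > 0, ∃ h ∈ entireGroup, Commute h (rot (1 / q)) ∧
    volume {x | ε ≤ dist (h.2 x) (g x)} ≤ ENNReal.ofReal ε

/-- First approximate `f` by `h`, then `g` within the modulus of uniform continuity of `h`. As `g`
preserves the measure, the bad set of `h` pulls back to a set of the same size. -/
lemma Approximable.comp {q : ℕ} {f g : Torus → Torus} (hf : Approximable q f) (hg : Approximable q g) :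
    Approximable q (f ∘ g) := by
  refine ⟨hf.1.comp hg.1, fun ε hε => ?_⟩
  obtain ⟨h, hh, hcomm, hvol⟩ := hf.2 (ε / 2) (by positivity)
  obtain ⟨δ, hδ, huc⟩ := Metric.uniformContinuous_iff.1
    (CompactSpace.uniformContinuous_of_continuous h.2.continuous) (ε / 2) (by positivity)
  obtain ⟨h', hh', hcomm', hvol'⟩ := hg.2 (min δ (ε / 2)) (by positivity)
  refine ⟨h * h', mul_mem hh hh', hcomm.mul_left hcomm', ?_⟩
  have hmeas : MeasurableSet {x | ε / 2 ≤ dist (h.2 x) (f x)} :=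
    measurableSet_le measurable_const (h.2.continuous.measurable.dist hf.1.measurable)
  have hsub : {x | ε ≤ dist ((h * h').2 x) ((f ∘ g) x)} ⊆
      {x | min δ (ε / 2) ≤ dist (h'.2 x) (g x)} ∪ g ⁻¹' {x | ε / 2 ≤ dist (h.2 x) (f x)} := by
    intro x hx
    by_contra hc
    simp only [Set.mem_union, Set.mem_ofPred_eq, Set.mem_preimage, not_or, not_le] at hc hx
    have h1 := huc (hc.1.trans_le (min_le_left _ _))
    have h2 := dist_triangle (h.2 (h'.2 x)) (h.2 (g x)) (f (g x))
    have h3 : ε ≤ dist (h.2 (h'.2 x)) (f (g x)) := hx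
    linarith [hc.2]
  calc _ ≤ _ := measure_mono hsub
    _ ≤ _ := measure_union_le _ _
    _ ≤ ENNReal.ofReal (ε / 2) + ENNReal.ofReal (ε / 2) := by
      rw [hg.1.measure_preimage hmeas.nullMeasurableSet]
      exact add_le_add (hvol'.trans (ENNReal.ofReal_le_ofReal (min_le_right _ _))) hvol
    _ = _ := by rw [← ENNReal.ofReal_add (by positivity) (by positivity), add_halves]

lemma dist_coe_le (a b : ℝ) (x : UnitAddCircle) :
    dist (x + (a : UnitAddCircle)) (x + (b : UnitAddCircle)) ≤ |a - b| := by
  rw [dist_add_left, dist_eq_norm, ← AddCircle.coe_sub]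
  exact QuotientAddGroup.norm_mk_le_norm

lemma measurePreserving_nsmul {q : ℕ} (hq : 0 < q) :
    MeasurePreserving (fun x : UnitAddCircle => q • x) volume volume := by
  have := Measure.measurePreserving_zsmul (volume : Measure UnitAddCircle) (n := q) (by omega)
  simpa only [natCast_zsmul] using this

/-- Approximate `v` in measure by an entire periodic `c`. Composing with multiplication by `q`,
which preserves the measure, keeps the approximation and makes the shear commute with the rotation
by `1 / q`. -/
lemma approximable_shear {q : ℕ} (hq : 0 < q) {v : UnitAddCircle → ℝ} (hv : Measurable v) {B : ℝ}
    (hB : ∀ x, |v x| ≤ B) :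
    Approximable q fun x => (x.1, x.2 + ((v (q • x.1) : ℝ) : UnitAddCircle)) := by
  have hmul := measurePreserving_nsmul hq
  refine ⟨measurePreserving_shear (v := fun x => ((v (q • x) : ℝ) : UnitAddCircle))
    ((AddCircle.measurable_mk' (a := 1)).comp (hv.comp hmul.measurable)), fun ε hε => ?_⟩
  obtain ⟨c, hc, hvol⟩ := exists_isEntirePeriodic_approx hv hB hε
  obtain ⟨h, hh, ⟨u, hu, hper⟩, hh2⟩ := exists_shear_mem (hc.nsmul q)
  refine ⟨h, hh, ?_, ?_⟩
  · have hq0 : (q : ℝ) ≠ 0 := by positivity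
    have hper1 : ∀ x : UnitAddCircle, c (q • (x + ((1 / q : ℝ) : UnitAddCircle))) = c (q • x) := fun x => by
      rw [smul_add, ← AddCircle.coe_nsmul, nsmul_eq_mul, mul_one_div_cancel hq0, AddCircle.coe_period,
        add_zero]
    refine Prod.ext (Homeomorph.ext fun z => ?_) (Homeomorph.ext fun x => ?_)
    · show h.1 ((rot (1 / q)).1 z) = (rot (1 / q)).1 (h.1 z)
      rw [rot_fst, rot_fst, hu, hu]
      simp only [hper _ hper1]
    · show h.2 ((rot (1 / q)).2 x) = (rot (1 / q)).2 (h.2 x)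
      rw [rot_snd, rot_snd, hh2, hh2]
      simp only [hper1]
  · have hsub : {x : Torus | ε ≤ dist (h.2 x) (x.1, x.2 + ((v (q • x.1) : ℝ) : UnitAddCircle))} ⊆
        ((fun x : UnitAddCircle => q • x) ⁻¹' {x | ε ≤ |c x - v x|}) ×ˢ Set.univ := by
      intro x hx
      refine ⟨?_, trivial⟩
      simp only [Set.mem_ofPred_eq, hh2, Prod.dist_eq, dist_self] at hx
      simp only [Set.mem_preimage, Set.mem_ofPred_eq]
      rw [max_eq_right dist_nonneg] at hx
      exact hx.trans (dist_coe_le _ _ _)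
    have hmeas : MeasurableSet {x | ε ≤ |c x - v x|} :=
      measurableSet_le measurable_const ((hc.continuous.measurable.sub hv).abs)
    refine (measure_mono hsub).trans ?_
    rw [Measure.volume_eq_prod, Measure.prod_prod, measure_univ, mul_one,
      hmul.measure_preimage hmeas.nullMeasurableSet]
    exact hvol

/-- A displacement of the first coordinate that depends on the second alone commutes with every
rotation, so no periodicity is needed. -/
lemma approximable_shear_swap (q : ℕ) {v : UnitAddCircle → ℝ} (hv : Measurable v) {B : ℝ}
    (hB : ∀ x, |v x| ≤ B) :
    Approximable q fun x => (x.1 + ((v x.2 : ℝ) : UnitAddCircle), x.2) := by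
  have hs : MeasurePreserving (Prod.swap : Torus → Torus) volume volume := Measure.measurePreserving_swap
  have hmp := hs.comp ((measurePreserving_shear (v := fun x => ((v x : ℝ) : UnitAddCircle))
    ((AddCircle.measurable_mk' (a := 1)).comp hv)).comp hs)
  refine ⟨hmp, fun ε hε => ?_⟩
  obtain ⟨c, hc, hvol⟩ := exists_isEntirePeriodic_approx hv hB hε
  obtain ⟨h, hh, ⟨u, hu, -⟩, hh2⟩ := exists_shear_mem hc
  have e1 : ∀ z, (exchange * h * exchange).1 z = (z.1 + u z.2, z.2) := fun z => by
    show (h.1 z.swap).swap = _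
    rw [hu]; rfl
  have e2 : ∀ x, (exchange * h * exchange).2 x = (x.1 + (c x.2 : UnitAddCircle), x.2) := fun x => by
    show (h.2 x.swap).swap = _
    rw [hh2]; rfl
  refine ⟨_, exchange_conj_mem hh, ?_, ?_⟩
  · refine Prod.ext (Homeomorph.ext fun z => ?_) (Homeomorph.ext fun x => ?_)
    · show (exchange * h * exchange).1 ((rot (1 / q)).1 z) = (rot (1 / q)).1 ((exchange * h * exchange).1 z)
      rw [rot_fst, rot_fst, e1, e1]
      simp only [add_right_comm]
    · show (exchange * h * exchange).2 ((rot (1 / q)).2 x) = (rot (1 / q)).2 ((exchange * h * exchange).2 x)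
      rw [rot_snd, rot_snd, e2, e2]
      simp only [add_right_comm]
  · have hsub : {x : Torus | ε ≤ dist ((exchange * h * exchange).2 x)
        (x.1 + ((v x.2 : ℝ) : UnitAddCircle), x.2)} ⊆ Set.univ ×ˢ {x | ε ≤ |c x - v x|} := by
      intro x hx
      refine ⟨trivial, ?_⟩
      simp only [Set.mem_ofPred_eq, e2, Prod.dist_eq, dist_self] at hx
      rw [max_eq_left dist_nonneg] at hx
      exact hx.trans (dist_coe_le _ _ _)
    refine (measure_mono hsub).trans ?_
    rw [Measure.volume_eq_prod, Measure.prod_prod, measure_univ, one_mul]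
    exact hvol

/-! ### Partitions of the circle into arcs of equal length -/

/-- The index `j` of the arc `[j / Q, (j + 1) / Q)` containing a point of the circle. -/
noncomputable def idx (Q : ℕ) : UnitAddCircle → ℕ :=
  Function.Periodic.lift (f := fun y : ℝ => (⌊Q * y⌋ % (Q : ℤ)).toNat) (c := 1) fun y => by
    have : (Q : ℝ) * (y + 1) = Q * y + (Q : ℤ) := by push_cast; ring
    simp only [this, Int.floor_add_intCast, Int.add_emod_right]

lemma idx_coe (Q : ℕ) (y : ℝ) : idx Q (y : UnitAddCircle) = (⌊Q * y⌋ % (Q : ℤ)).toNat := rfl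

lemma exists_rep (x : UnitAddCircle) : ∃ y : ℝ, 0 ≤ y ∧ y < 1 ∧ (y : UnitAddCircle) = x := by
  refine ⟨AddCircle.equivIco 1 0 x, ?_, ?_, AddCircle.coe_equivIco⟩
  · exact (AddCircle.equivIco 1 0 x).2.1
  · simpa using (AddCircle.equivIco 1 0 x).2.2

lemma idx_coe_of_mem {Q : ℕ} {y : ℝ} (h0 : 0 ≤ y) (h1 : y < 1) :
    idx Q (y : UnitAddCircle) = ⌊Q * y⌋₊ := by
  rw [idx_coe, ← Int.floor_toNat]
  rcases Nat.eq_zero_or_pos Q with rfl | hQ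
  · simp
  have hQ' : (0 : ℝ) < Q := by exact_mod_cast hQ
  rw [Int.emod_eq_of_lt (Int.floor_nonneg.2 (by positivity))]
  rw [Int.floor_lt]
  push_cast
  nlinarith

lemma idx_lt {Q : ℕ} (hQ : 0 < Q) (x : UnitAddCircle) : idx Q x < Q := by
  obtain ⟨y, -, -, rfl⟩ := exists_rep x
  rw [idx_coe]
  have h1 := Int.emod_lt_of_pos ⌊(Q : ℝ) * y⌋ (Int.natCast_pos.2 hQ)
  have h2 := Int.emod_nonneg ⌊(Q : ℝ) * y⌋ (Int.natCast_pos.2 hQ).ne'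
  omega

lemma idx_add {Q : ℕ} (hQ : 0 < Q) (x : UnitAddCircle) (j : ℕ) :
    idx Q (x + ((j / Q : ℝ) : UnitAddCircle)) = (idx Q x + j) % Q := by
  obtain ⟨y, -, -, rfl⟩ := exists_rep x
  have hQ' : (Q : ℝ) ≠ 0 := by positivity
  rw [← AddCircle.coe_add, idx_coe, idx_coe]
  have : (Q : ℝ) * (y + j / Q) = Q * y + (j : ℤ) := by push_cast; field_simp
  rw [this, Int.floor_add_intCast]
  have h2 := Int.emod_nonneg ⌊(Q : ℝ) * y⌋ (Int.natCast_pos.2 hQ).ne'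
  zify
  rw [Int.toNat_of_nonneg h2, Int.toNat_of_nonneg (Int.emod_nonneg _ (Int.natCast_pos.2 hQ).ne'),
    Int.emod_add_emod]

lemma idx_div {Q N : ℕ} (hN : 0 < N) (x : UnitAddCircle) : idx (Q * N) x / N = idx Q x := by
  obtain ⟨y, h0, h1, rfl⟩ := exists_rep x
  have hN' : (N : ℝ) ≠ 0 := by positivity
  rw [idx_coe_of_mem h0 h1, idx_coe_of_mem h0 h1, ← Nat.floor_div_natCast]
  congr 1
  push_cast
  field_simp

lemma idx_nsmul {q k : ℕ} (x : UnitAddCircle) : idx k (q • x) = idx (q * k) x % k := by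
  obtain ⟨y, h0, h1, rfl⟩ := exists_rep x
  rw [idx_coe_of_mem h0 h1, ← AddCircle.coe_nsmul, idx_coe, nsmul_eq_mul]
  have h2 : (k : ℝ) * (q * y) = (q * k : ℕ) * y := by push_cast; ring
  have h3 : 0 ≤ ((q * k : ℕ) : ℝ) * y := by positivity
  rw [h2, ← Int.floor_toNat]
  have h4 := Int.floor_nonneg.2 h3
  generalize ⌊((q * k : ℕ) : ℝ) * y⌋ = z at *
  lift z to ℕ using h4
  rw [Int.toNat_natCast, ← Int.natCast_mod, Int.toNat_natCast]

lemma measurable_idx (Q : ℕ) : Measurable (idx Q) := by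
  have : idx Q = fun x => (⌊Q * ((AddCircle.equivIco (1 : ℝ) 0 x : ℝ))⌋ % (Q : ℤ)).toNat := by
    ext x
    rw [← idx_coe, AddCircle.coe_equivIco]
  rw [this]
  have h1 : Measurable fun x : UnitAddCircle => (AddCircle.equivIco (1 : ℝ) 0 x : ℝ) :=
    measurable_subtype_coe.comp (AddCircle.measurableEquivIco 1 0).measurable
  exact (measurable_of_countable fun z : ℤ => (z % (Q : ℤ)).toNat).comp
    (Int.measurable_floor.comp (h1.const_mul _))

lemma eventually_idx_eq {Q : ℕ} {y : ℝ} (hy : ∀ m : ℤ, (Q : ℝ) * y ≠ m) :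
    ∀ᶠ x in 𝓝 (y : UnitAddCircle), idx Q x = idx Q (y : UnitAddCircle) := by
  have h1 : 𝓝 (y : UnitAddCircle) = map (QuotientAddGroup.mk : ℝ → UnitAddCircle) (𝓝 y) :=
    (QuotientAddGroup.nhds_eq _ _)
  rw [h1, eventually_map]
  have hc : Tendsto (fun w : ℝ => (Q : ℝ) * w) (𝓝 y) (𝓝 (Q * y)) := by
    exact (continuous_const.mul continuous_id).tendsto _
  have h2 : ∀ᶠ w in 𝓝 y, (⌊(Q : ℝ) * y⌋ : ℝ) < Q * w ∧ (Q : ℝ) * w < ⌊(Q : ℝ) * y⌋ + 1 :=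
    (hc.eventually_const_lt (lt_of_le_of_ne (Int.floor_le _) (hy _).symm)).and
      (hc.eventually_lt_const (Int.lt_floor_add_one _))
  filter_upwards [h2] with w hw
  show idx Q (w : UnitAddCircle) = _
  rw [idx_coe, idx_coe, Int.floor_eq_iff.2 ⟨hw.1.le, hw.2⟩]

instance : NullSingletonClass (volume : Measure UnitAddCircle) where
  measure_singleton x := by
    have h := AddCircle.volume_closedBall (T := 1) (x := x) 0
    rw [Metric.closedBall_zero] at h
    simp [h]

/-- Only the countably many endpoints of arcs are excluded. This turns convergence in measure of
maps into eventual equality of cells. -/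
lemma ae_eventually_idx_eq (Q : ℕ) :
    ∀ᵐ x : UnitAddCircle, ∀ᶠ y in 𝓝 x, idx Q y = idx Q x := by
  rcases Nat.eq_zero_or_pos Q with rfl | hQ
  · refine Eventually.of_forall fun x => Eventually.of_forall fun y => ?_
    obtain ⟨u, -, -, rfl⟩ := exists_rep x
    obtain ⟨w, -, -, rfl⟩ := exists_rep y
    simp [idx_coe]
  have hcount : (Set.range fun m : ℤ => ((m / Q : ℝ) : UnitAddCircle)).Countable :=
    Set.countable_range _
  have hnull := hcount.measure_zero (volume : Measure UnitAddCircle)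
  refine (measure_eq_zero_iff_ae_notMem.1 hnull).mono fun x hx => ?_
  obtain ⟨y, -, -, rfl⟩ := exists_rep x
  refine eventually_idx_eq fun m hm => hx ⟨m, ?_⟩
  have hQ' : (Q : ℝ) ≠ 0 := by positivity
  simp only [← hm]
  rw [mul_div_cancel_left₀ _ hQ']

lemma dist_le_of_idx_eq {Q : ℕ} (hQ : 0 < Q) {x y : UnitAddCircle} (h : idx Q x = idx Q y) :
    dist x y ≤ 1 / Q := by
  obtain ⟨u, u0, u1, rfl⟩ := exists_rep x
  obtain ⟨w, w0, w1, rfl⟩ := exists_rep y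
  rw [idx_coe_of_mem u0 u1, idx_coe_of_mem w0 w1] at h
  have hQ' : (0 : ℝ) < Q := by exact_mod_cast hQ
  rw [dist_eq_norm, ← AddCircle.coe_sub]
  refine QuotientAddGroup.norm_mk_le_norm.trans ?_
  have h0 : u - w = (Q * u - Q * w) / Q := by field_simp
  rw [Real.norm_eq_abs, h0, abs_div, abs_of_pos hQ']
  refine div_le_div_of_nonneg_right ?_ hQ'.le
  have h1 := Nat.floor_le (show 0 ≤ (Q : ℝ) * u by positivity)
  have h2 := Nat.lt_floor_add_one ((Q : ℝ) * u)
  have h3 := Nat.floor_le (show 0 ≤ (Q : ℝ) * w by positivity)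
  have h4 := Nat.lt_floor_add_one ((Q : ℝ) * w)
  rw [h] at h1 h2
  rw [abs_le]
  constructor <;> linarith

lemma volume_idx_eq_le {Q : ℕ} (hQ : 0 < Q) (j : ℕ) :
    volume {x | idx Q x = j} ≤ ENNReal.ofReal (1 / Q) := by
  have hQ' : (0 : ℝ) < Q := by exact_mod_cast hQ
  have hsub : {x | idx Q x = j} ⊆ Metric.closedBall (((j + 1 / 2) / Q : ℝ) : UnitAddCircle) (1 / (2 * Q)) := by
    intro x hx
    obtain ⟨u, u0, u1, rfl⟩ := exists_rep x
    simp only [Set.mem_ofPred_eq, idx_coe_of_mem u0 u1] at hx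
    rw [Metric.mem_closedBall, dist_eq_norm, ← AddCircle.coe_sub]
    refine QuotientAddGroup.norm_mk_le_norm.trans ?_
    have h1 := Nat.floor_le (show 0 ≤ (Q : ℝ) * u by positivity)
    have h2 := Nat.lt_floor_add_one ((Q : ℝ) * u)
    rw [hx] at h1 h2
    have : u - (j + 1 / 2) / Q = (Q * u - (j + 1 / 2)) / Q := by field_simp
    rw [Real.norm_eq_abs, this, abs_div, abs_of_pos hQ', ← div_div]
    refine div_le_div_of_nonneg_right (abs_le.2 ⟨?_, ?_⟩) hQ'.le <;> linarith
  refine (measure_mono hsub).trans ?_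
  rw [AddCircle.volume_closedBall]
  refine ENNReal.ofReal_le_ofReal ((min_le_right _ _).trans (le_of_eq ?_))
  field_simp

lemma volume_idx_mem_le {Q : ℕ} (hQ : 0 < Q) (S : Finset ℕ) :
    volume {x | idx Q x ∈ S} ≤ ENNReal.ofReal (S.card / Q) := by
  have : {x | idx Q x ∈ S} = ⋃ j ∈ S, {x | idx Q x = j} := by ext; simp
  rw [this]
  refine (measure_biUnion_finset_le _ _).trans ((Finset.sum_le_sum fun j _ => volume_idx_eq_le hQ j).trans ?_)
  rw [Finset.sum_const, ← ENNReal.ofReal_nsmul]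
  refine ENNReal.ofReal_le_ofReal (le_of_eq ?_)
  rw [nsmul_eq_mul]; ring

/-! ### Permutations of a grid generated by shears -/

section Grid

variable {α β γ : Type*}

/-- The shear moving the row `r` by `v r`. -/
def rowShear [AddCommGroup α] (v : β → α) : Equiv.Perm (α × β) where
  toFun x := (x.1 + v x.2, x.2)
  invFun x := (x.1 - v x.2, x.2)
  left_inv x := by simp
  right_inv x := by simp

/-- The shear moving the column `c` by `u c`. -/
def columnShear [AddCommGroup β] (u : α → β) : Equiv.Perm (α × β) where
  toFun x := (x.1, x.2 + u x.1)
  invFun x := (x.1, x.2 - u x.1)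
  left_inv x := by simp
  right_inv x := by simp

open Classical in
/-- Permute the rows in the columns from `J`. -/
noncomputable def rowPerm (J : Set α) : Equiv.Perm β →* Equiv.Perm (α × β) where
  toFun σ :=
    { toFun := fun x => (x.1, if x.1 ∈ J then σ x.2 else x.2)
      invFun := fun x => (x.1, if x.1 ∈ J then σ⁻¹ x.2 else x.2)
      left_inv := fun x => by by_cases h : x.1 ∈ J <;> simp [h]
      right_inv := fun x => by by_cases h : x.1 ∈ J <;> simp [h] }
  map_one' := by ext x <;> simp
  map_mul' σ τ := by
    ext x
    · rfl
    · by_cases h : x.1 ∈ J <;> simp [h]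

lemma rowPerm_of_mem {J : Set α} (σ : Equiv.Perm β) {x : α × β} (h : x.1 ∈ J) :
    rowPerm J σ x = (x.1, σ x.2) :=
  Prod.ext rfl (if_pos h)

lemma rowPerm_of_notMem {J : Set α} (σ : Equiv.Perm β) {x : α × β} (h : x.1 ∉ J) :
    rowPerm J σ x = x :=
  Prod.ext rfl (if_neg h)

/-- Permute the rows in every column, by a permutation depending on the class of the column. -/
def columnwisePerm {ι : Type*} (col : α → ι) : (ι → Equiv.Perm β) →* Equiv.Perm (α × β) where
  toFun π :=
    { toFun := fun x => (x.1, π (col x.1) x.2)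
      invFun := fun x => (x.1, (π (col x.1))⁻¹ x.2)
      left_inv := fun x => by simp
      right_inv := fun x => by simp }
  map_one' := rfl
  map_mul' _ _ := rfl

variable [AddCommGroup α] [AddCommGroup β] [AddCommGroup γ] {Γ : Subgroup (Equiv.Perm (α × β))} {φ : α →+ γ} {t : α}

set_option linter.unusedSimpArgs false in
-- A product of conjugates of the shift `A` of one row by vertical shears `V`, multiplied by `A⁻¹`
-- on both sides, acts trivially except in two column classes, where it exchanges the two rows. Only
-- vertical shears that factor through `φ` enter, which forces the result to act on whole classes,
-- and on a pair of them.
lemma rowPerm_swap_mem [DecidableEq β] (hrow : ∀ v, rowShear v ∈ Γ) (hcol : ∀ u : γ → β, columnShear (u ∘ φ) ∈ Γ)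
    (ht : φ t ≠ 0) (j : γ) {r₀ r₁ : β} (hr : r₀ ≠ r₁) :
    rowPerm {c | φ c = j ∨ φ c = j + φ t} (Equiv.swap r₀ r₁) ∈ Γ := by
  classical
  let A : Equiv.Perm (α × β) := rowShear fun r => if r = r₀ then t else 0
  let V : γ → Equiv.Perm (α × β) := fun j => columnShear ((fun c => if c = j then r₁ - r₀ else 0) ∘ φ)
  have hA : A ∈ Γ := hrow _
  have hV : ∀ j, V j ∈ Γ := fun j => hcol _
  have hAi : ∀ x, A⁻¹ x = (x.1 - if x.2 = r₀ then t else 0, x.2) := fun x => rfl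
  have hVi : ∀ j x, (V j)⁻¹ x = (x.1, x.2 - if φ x.1 = j then r₁ - r₀ else 0) := fun j x => rfl
  have hAa : ∀ x, A x = (x.1 + if x.2 = r₀ then t else 0, x.2) := fun x => rfl
  have hVa : ∀ j x, V j x = (x.1, x.2 + if φ x.1 = j then r₁ - r₀ else 0) := fun j x => rfl
  have key : rowPerm {c | φ c = j ∨ φ c = j + φ t} (Equiv.swap r₀ r₁) =
      A⁻¹ * V (j + φ t) * A * (V (j + φ t))⁻¹ * V j * A * (V j)⁻¹ * A⁻¹ := by
    ext1 ⟨c, r⟩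
    have hL : rowPerm {c | φ c = j ∨ φ c = j + φ t} (Equiv.swap r₀ r₁) (c, r) =
      (c, if φ c = j ∨ φ c = j + φ t then Equiv.swap r₀ r₁ r else r) := by
      split_ifs with h
      exacts [rowPerm_of_mem _ h, rowPerm_of_notMem _ h]
    have hne1 : j + φ t ≠ j := by simpa using ht
    have hne3 : j - φ t ≠ j := by simpa using ht
    have hne4 : j ≠ j + φ t := hne1.symm
    rw [hL]
    simp only [Equiv.Perm.mul_apply]
    have e1 : ∀ r : β, r - (r₁ - r₀) = r₀ ↔ r = r₁ := fun r => by
      rw [sub_eq_iff_eq_add]; simp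
    by_cases h0 : r = r₀
    · subst h0
      by_cases h1 : φ c = j
      · simp [hAi, hVi, hAa, hVa, h1, hne1, hne3, hne4, hr, hr.symm, e1, ht]
      · by_cases h2 : φ c = j + φ t
        · simp [hAi, hVi, hAa, hVa, h1, h2, hne1, hne3, hne4, hr, hr.symm, e1, ht]
        · have h3 : φ c - φ t ≠ j := fun h => h2 (by rw [← h]; abel)
          simp [hAi, hVi, hAa, hVa, h1, h2, h3, hne1, hne3, hne4, hr, hr.symm, e1, ht]
    · by_cases h3 : r = r₁
      · subst h3
        by_cases h1 : φ c = j
        · simp [hAi, hVi, hAa, hVa, h1, hne1, hne3, hne4, hr, hr.symm, e1, ht]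
        · by_cases h2 : φ c = j + φ t
          · simp [hAi, hVi, hAa, hVa, h1, h2, hne1, hne3, hne4, hr, hr.symm, e1, ht]
          · simp [hAi, hVi, hAa, hVa, h1, h2, hne1, hne3, hne4, hr, hr.symm, e1, ht]
      · by_cases h1 : φ c = j
        · simp [hAi, hVi, hAa, hVa, h1, hne1, hne3, hne4, hr, hr.symm, e1, ht, h0, h3, Equiv.swap_apply_of_ne_of_ne]
        · by_cases h2 : φ c = j + φ t
          · simp [hAi, hVi, hAa, hVa, h1, h2, hne1, hne3, hne4, hr, hr.symm, e1, ht, h0, h3, Equiv.swap_apply_of_ne_of_ne]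
          · simp [hAi, hVi, hAa, hVa, h1, h2, hne1, hne3, hne4, hr, hr.symm, e1, ht, h0, h3, Equiv.swap_apply_of_ne_of_ne]
  rw [key]
  exact mul_mem (mul_mem (mul_mem (mul_mem (mul_mem (mul_mem (mul_mem (inv_mem hA) (hV _)) hA)
    (inv_mem (hV _))) (hV _)) hA) (inv_mem (hV _))) (inv_mem hA)

/-- Transpositions generate the symmetric group, and `rowPerm` is a homomorphism. -/
lemma rowPerm_mem [Finite β] (hrow : ∀ v, rowShear v ∈ Γ) (hcol : ∀ u : γ → β, columnShear (u ∘ φ) ∈ Γ)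
    (ht : φ t ≠ 0) (j : γ) (σ : Equiv.Perm β) :
    rowPerm {c | φ c = j ∨ φ c = j + φ t} σ ∈ Γ := by
  classical
  have : Subgroup.comap (rowPerm {c | φ c = j ∨ φ c = j + φ t}) Γ = ⊤ := by
    rw [eq_top_iff, ← Equiv.Perm.closure_isSwap, Subgroup.closure_le]
    rintro _ ⟨x, y, hxy, rfl⟩
    exact rowPerm_swap_mem hrow hcol ht j hxy
  rw [← Subgroup.mem_comap, this]
  trivial

/-- The columns are partitioned into pairs of classes, indexed by `ι`; the permutation is the
product of its parts on the single pairs. -/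
lemma columnwisePerm_mem [Finite β] {ι : Type*} [Finite ι] {col : α → ι} {j : ι → γ}
    (hrow : ∀ v, rowShear v ∈ Γ) (hcol : ∀ u : γ → β, columnShear (u ∘ φ) ∈ Γ) (ht : φ t ≠ 0)
    (hj : ∀ c i, col c = i ↔ φ c = j i ∨ φ c = j i + φ t) (π : ι → Equiv.Perm β) :
    columnwisePerm col π ∈ Γ := by
  classical
  rw [← Subgroup.mem_comap]
  refine Subgroup.pi_mem_of_mulSingle_mem _ fun i => ?_
  rw [Subgroup.mem_comap]
  convert rowPerm_mem hrow hcol ht (j i) (π i) using 1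
  refine Equiv.ext fun x => ?_
  by_cases h : col x.1 = i
  · rw [rowPerm_of_mem _ (show x.1 ∈ _ from (hj _ _).1 h)]
    refine Prod.ext rfl ?_
    show (Pi.mulSingle i (π i) : ι → Equiv.Perm β) (col x.1) x.2 = π i x.2
    rw [h, Pi.mulSingle_eq_same]
  · rw [rowPerm_of_notMem _ (show x.1 ∉ _ from fun hc => h ((hj _ _).2 hc))]
    refine Prod.ext rfl ?_
    show (Pi.mulSingle i (π i) : ι → Equiv.Perm β) (col x.1) x.2 = x.2
    rw [Pi.mulSingle_eq_of_ne h]; rfl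

end Grid

/-! ### Cell permutations of the torus -/

section Cells

variable (P R : ℕ) [NeZero P] [NeZero R]

/-- The cell of the `P × R` grid containing a point of the torus. -/
noncomputable def cell (x : Torus) : ZMod P × ZMod R := (idx P x.1, idx R x.2)

/-- Move the cells of the `P × R` grid by translations, according to a permutation. -/
noncomputable def cellMap (π : Equiv.Perm (ZMod P × ZMod R)) (x : Torus) : Torus :=
  (x.1 + ZMod.toAddCircle ((π (cell P R x)).1 - (cell P R x).1),
    x.2 + ZMod.toAddCircle ((π (cell P R x)).2 - (cell P R x).2))

variable {P R}

lemma idx_add_toAddCircle (x : UnitAddCircle) (j : ZMod P) :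
    (idx P (x + ZMod.toAddCircle j) : ZMod P) = idx P x + j := by
  rw [ZMod.toAddCircle_apply, idx_add (NeZero.pos P), ZMod.natCast_mod]
  simp

lemma cell_cellMap (π : Equiv.Perm (ZMod P × ZMod R)) (x : Torus) :
    cell P R (cellMap P R π x) = π (cell P R x) := by
  refine Prod.ext ?_ ?_
  · show (idx P (x.1 + _) : ZMod P) = _
    rw [idx_add_toAddCircle]
    show (cell P R x).1 + _ = _
    abel
  · show (idx R (x.2 + _) : ZMod R) = _
    rw [idx_add_toAddCircle]
    show (cell P R x).2 + _ = _
    abel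

lemma cellMap_one : cellMap P R 1 = id := by
  ext x <;> simp [cellMap]

lemma cellMap_mul (π σ : Equiv.Perm (ZMod P × ZMod R)) :
    cellMap P R (π * σ) = cellMap P R π ∘ cellMap P R σ := by
  funext x
  have h := cell_cellMap σ x
  refine Prod.ext ?_ ?_
  · show _ = (cellMap P R σ x).1 + ZMod.toAddCircle _
    rw [h]
    show _ = x.1 + _ + _
    rw [add_assoc, ← map_add, sub_add_sub_cancel']
    rfl
  · show _ = (cellMap P R σ x).2 + ZMod.toAddCircle _
    rw [h]
    show _ = x.2 + _ + _
    rw [add_assoc, ← map_add, sub_add_sub_cancel']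
    rfl

lemma approximable_id (q : ℕ) : Approximable q id :=
  ⟨MeasurePreserving.id _, fun ε hε => ⟨1, one_mem _, Commute.one_left _, by
    have : {x : Torus | ε ≤ dist ((1 : MapPair).2 x) (id x)} = ∅ := by
      ext x
      simp [hε]
    rw [this, measure_empty]
    exact zero_le⟩⟩

variable (P R) in
/-- The permutations of the grid whose cell maps are approximable. -/
noncomputable def approximablePerms (q : ℕ) : Subgroup (Equiv.Perm (ZMod P × ZMod R)) where
  carrier := {π | Approximable q (cellMap P R π) ∧ Approximable q (cellMap P R π⁻¹)}
  mul_mem' {π σ} hπ hσ := by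
    refine ⟨?_, ?_⟩
    · rw [cellMap_mul]; exact hπ.1.comp hσ.1
    · rw [mul_inv_rev, cellMap_mul]; exact hσ.2.comp hπ.2
  one_mem' := by
    have h := approximable_id q
    rw [← cellMap_one (P := P) (R := R)] at h
    refine ⟨h, ?_⟩
    rw [inv_one]; exact h
  inv_mem' {π} hπ := ⟨hπ.2, by rw [inv_inv]; exact hπ.1⟩

lemma measurable_comp_idx {Q : ℕ} {δ : Type*} [MeasurableSpace δ] (f : ℕ → δ) :
    Measurable fun x => f (idx Q x) :=
  (measurable_of_countable f).comp (measurable_idx Q)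

lemma abs_val_div_le {N : ℕ} [NeZero N] (j : ZMod N) : |(j.val / N : ℝ)| ≤ 1 := by
  have h1 : (j.val : ℝ) ≤ N := by exact_mod_cast (ZMod.val_lt j).le
  have h2 : (0 : ℝ) < N := by exact_mod_cast NeZero.pos N
  rw [abs_of_nonneg (by positivity), div_le_one h2]
  exact h1

lemma rowShear_mem (q : ℕ) (v : ZMod R → ZMod P) : rowShear v ∈ approximablePerms P R q := by
  have h : ∀ v : ZMod R → ZMod P, Approximable q (cellMap P R (rowShear v)) := fun v => by
    convert approximable_shear_swap q (v := fun x => ((v (idx R x)).val / P : ℝ))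
      (measurable_comp_idx fun i => ((v i).val / P : ℝ)) (B := 1) (fun x => abs_val_div_le _) using 2 with x
    refine Prod.ext ?_ ?_
    · simp only [← ZMod.toAddCircle_apply]
      show x.1 + ZMod.toAddCircle ((cell P R x).1 + v (cell P R x).2 - (cell P R x).1) = _
      rw [add_sub_cancel_left]; rfl
    · show x.2 + ZMod.toAddCircle ((cell P R x).2 - (cell P R x).2) = x.2
      simp
  refine ⟨h v, ?_⟩
  convert h (-v) using 2
  exact Equiv.ext fun x => Prod.ext (sub_eq_add_neg _ _) rfl

/-- That the column shift factors through `ZMod N` is the discrete form of `1/q`-periodicity in the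
first coordinate. -/
lemma columnShear_mem {q N : ℕ} (hq : 0 < q) (hP : P = q * N) (u : ZMod N → ZMod R) :
    columnShear (u ∘ ZMod.castHom (Dvd.intro_left q hP.symm) (ZMod N)) ∈ approximablePerms P R q := by
  have h : ∀ u : ZMod N → ZMod R, Approximable q (cellMap P R
      (columnShear (u ∘ ZMod.castHom (Dvd.intro_left q hP.symm) (ZMod N)))) := fun u => by
    convert approximable_shear hq (v := fun x => ((u (idx N x)).val / R : ℝ))
      (measurable_comp_idx fun i => ((u i).val / R : ℝ)) (B := 1) (fun x => abs_val_div_le _) using 2 with x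
    refine Prod.ext ?_ ?_
    · show x.1 + ZMod.toAddCircle ((cell P R x).1 - (cell P R x).1) = x.1
      simp
    · simp only [← ZMod.toAddCircle_apply]
      show x.2 + ZMod.toAddCircle ((cell P R x).2 + u (ZMod.castHom _ (ZMod N) (cell P R x).1) -
        (cell P R x).2) = _
      rw [add_sub_cancel_left]
      congr 3
      show ZMod.castHom _ (ZMod N) ((idx P x.1 : ℕ) : ZMod P) = _
      rw [map_natCast, idx_nsmul, ← hP, ZMod.natCast_mod]
  refine ⟨h u, ?_⟩
  convert h (-u) using 2
  exact Equiv.ext fun x => Prod.ext rfl (sub_eq_add_neg _ _)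

end Cells

/-! ### Rearranging cells into full rows of the strips. -/

/-- Position of a row of the fine grid: its place in its strip, and the strip. -/
noncomputable def rowEquiv (k M : ℕ) [NeZero k] [NeZero M] : ZMod (k * M) ≃ ZMod k × Fin M :=
  have : NeZero (k * M) := ⟨mul_ne_zero (NeZero.ne k) (NeZero.ne M)⟩
  Equiv.ofBijective (fun r => (r.val, ⟨r.val / k, Nat.div_lt_of_lt_mul (ZMod.val_lt r)⟩)) <| by
    rw [Fintype.bijective_iff_injective_and_card]
    refine ⟨fun r r' h => ?_, by simp [ZMod.card]⟩
    simp only [Prod.mk.injEq, Fin.mk.injEq, ZMod.natCast_eq_natCast_iff'] at h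
    refine ZMod.val_injective _ ?_
    rw [← Nat.div_add_mod r.val k, ← Nat.div_add_mod r'.val k, h.1, h.2]

lemma rowEquiv_apply (k M : ℕ) [NeZero k] [NeZero M] (r : ZMod (k * M)) :
    (rowEquiv k M r).1 = r.val ∧ ((rowEquiv k M r).2 : ℕ) = r.val / k := ⟨rfl, rfl⟩

/-- The torus is approximately rearranged such that the cells `(i, s)` of the `k × M` grid in each
strip of width `1 / q` become full rows of the strip, with prescribed shifts of the strips. -/
theorem exists_rearrangement {q k M : ℕ} (hq : 0 < q) [NeZero k] [NeZero M] (a : ZMod k → ℕ)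
    (ρ : ZMod k × Fin M ≃ ZMod (k * M)) :
    ∃ g, Approximable q g ∧ ∀ x, idx q (g x).1 = (idx q x.1 + a (idx (q * k) x.1)) % q ∧
      ∀ hs : idx M x.2 < M, (idx (k * M) (g x).2 : ZMod (k * M)) = ρ (idx (q * k) x.1, ⟨idx M x.2, hs⟩) := by
  have hk := NeZero.pos k
  have hM := NeZero.pos M
  have : NeZero (k * M) := ⟨by positivity⟩
  have : NeZero (k * 2) := ⟨by positivity⟩
  have : NeZero (q * (k * 2)) := ⟨by positivity⟩
  -- Columns are halved, hence `k * 2`, because row permutations are available only on pairs of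
  -- column classes: the two halves of column `i` form such a pair.
  let φ := ZMod.castHom (Dvd.intro_left q rfl : k * 2 ∣ q * (k * 2)) (ZMod (k * 2))
  let col : ZMod (q * (k * 2)) → ZMod k := fun c => ((φ c).val / 2 : ℕ)
  let π : ZMod k → Equiv.Perm (ZMod (k * M)) := fun i =>
    (rowEquiv k M).trans (((Equiv.subLeft i).prodCongr (Equiv.refl _)).trans ρ)
  -- The rearrangement in three moves. `S₁` shifts the fine row at place `p` of its row by `p`
  -- columns. In column `i + p`, `π` recovers `i` by subtracting `p` and sends the row to the target
  -- of `(i, s)`. `S₃` undoes the offset `i` and adds `a i` strips, so the `k` slices of the cell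
  -- `(i, s)` lie side by side in one row.
  let S₁ : Equiv.Perm (ZMod (q * (k * 2)) × ZMod (k * M)) :=
    rowShear fun r => ((2 * (rowEquiv k M r).1.val : ℕ) : ZMod (q * (k * 2)))
  let S₃ : Equiv.Perm (ZMod (q * (k * 2)) × ZMod (k * M)) :=
    rowShear fun r => ((2 * (a (ρ.symm r).1 * k) : ℕ) : ZMod (q * (k * 2))) - (2 * (ρ.symm r).1.val : ℕ)
  have hCP : columnwisePerm col π ∈ approximablePerms (q * (k * 2)) (k * M) q := by
    refine columnwisePerm_mem (φ := (φ : ZMod (q * (k * 2)) →+ ZMod (k * 2))) (t := 1)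
      (j := fun i : ZMod k => ((2 * i.val : ℕ) : ZMod (k * 2))) (rowShear_mem q)
      (columnShear_mem hq rfl) ?_ (fun c i => ?_) π
    · have h2 : Fact (1 < k * 2) := ⟨by omega⟩
      show φ 1 ≠ 0
      rw [map_one]; exact one_ne_zero
    · have h1 := ZMod.val_lt (φ c)
      have h2 := ZMod.val_lt i
      have e1 : col c = i ↔ (φ c).val / 2 = i.val := by
        show (((φ c).val / 2 : ℕ) : ZMod k) = i ↔ _
        constructor
        · rintro rfl
          rw [ZMod.val_natCast, Nat.mod_eq_of_lt (by omega)]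
        · intro h
          rw [h, ZMod.natCast_zmod_val]
      have e2 : ∀ m < k * 2, φ c = (m : ZMod (k * 2)) ↔ (φ c).val = m := fun m hm => by
        constructor
        · intro h; rw [h, ZMod.val_natCast, Nat.mod_eq_of_lt hm]
        · intro h; rw [← h, ZMod.natCast_zmod_val]
      show col c = i ↔ φ c = ((2 * i.val : ℕ) : ZMod (k * 2)) ∨ φ c = ((2 * i.val : ℕ) : ZMod (k * 2)) + φ 1
      rw [map_one, ← Nat.cast_succ, e2 _ (by omega), e2 _ (by omega), e1]
      omega
  have hmem := mul_mem (rowShear_mem (P := q * (k * 2)) (R := k * M) q _ : S₃ ∈ _)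
    (mul_mem hCP (rowShear_mem (P := q * (k * 2)) (R := k * M) q _ : S₁ ∈ _))
  refine ⟨_, hmem.1, fun x => ?_⟩
  have hcell := cell_cellMap (S₃ * (columnwisePerm col π * S₁)) x
  set y := cellMap (q * (k * 2)) (k * M) (S₃ * (columnwisePerm col π * S₁)) x with hy
  set c := idx (q * (k * 2)) x.1 with hc
  set r := rowEquiv k M (idx (k * M) x.2 : ZMod (k * M)) with hr
  have hcell' : cell (q * (k * 2)) (k * M) x = ((c : ZMod (q * (k * 2))), (idx (k * M) x.2 : ZMod (k * M))) := rfl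
  have hi : idx (q * k) x.1 = c / 2 := by
    rw [hc, ← mul_assoc, idx_div two_pos]
  have hqi : idx q x.1 = c / (k * 2) := by rw [hc, idx_div (by omega)]
  have hs : ∀ hs : idx M x.2 < M, (⟨idx M x.2, hs⟩ : Fin M) = r.2 := fun hs => by
    refine Fin.ext ?_
    show idx M x.2 = _
    rw [hr, (rowEquiv_apply k M _).2, ZMod.val_natCast, Nat.mod_eq_of_lt (idx_lt (by positivity) _),
      mul_comm k M, idx_div hk]
  have h1 : S₁ (cell (q * (k * 2)) (k * M) x) = (((c + 2 * r.1.val : ℕ) : ZMod (q * (k * 2))), (idx (k * M) x.2 : ZMod (k * M))) := by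
    rw [hcell']
    refine Prod.ext ?_ rfl
    show (c : ZMod (q * (k * 2))) + ((2 * r.1.val : ℕ) : ZMod (q * (k * 2))) = _
    push_cast; rfl
  have hcol : col ((c + 2 * r.1.val : ℕ) : ZMod (q * (k * 2))) = ((c / 2 : ℕ) : ZMod k) + r.1 := by
    show (((φ _).val / 2 : ℕ) : ZMod k) = _
    rw [map_natCast, ZMod.val_natCast, mul_comm k 2, Nat.mod_mul_right_div_self, ZMod.natCast_mod,
      Nat.add_mul_div_left _ _ two_pos]
    simp
  have h2 : columnwisePerm col π (S₁ (cell (q * (k * 2)) (k * M) x)) =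
      (((c + 2 * r.1.val : ℕ) : ZMod (q * (k * 2))), ρ (((c / 2 : ℕ) : ZMod k), r.2)) := by
    rw [h1]
    refine Prod.ext rfl ?_
    show π (col ((c + 2 * r.1.val : ℕ) : ZMod (q * (k * 2)))) (idx (k * M) x.2 : ZMod (k * M)) = _
    rw [hcol]
    show ρ ((((c / 2 : ℕ) : ZMod k) + r.1) - r.1, r.2) = _
    rw [add_sub_cancel_right]
  have h3 : (S₃ * (columnwisePerm col π * S₁)) (cell (q * (k * 2)) (k * M) x) =
      (((c + 2 * r.1.val : ℕ) : ZMod (q * (k * 2))) + (((2 * (a (c / 2 : ℕ) * k) : ℕ) : ZMod (q * (k * 2))) -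
        ((2 * ((c / 2) % k) : ℕ) : ZMod (q * (k * 2)))), ρ (((c / 2 : ℕ) : ZMod k), r.2)) := by
    rw [Equiv.Perm.mul_apply, Equiv.Perm.mul_apply, h2]
    refine Prod.ext ?_ rfl
    show _ + (_ - _) = _
    rw [Equiv.symm_apply_apply, ZMod.val_natCast]
  rw [h3] at hcell
  constructor
  · have h4 : (idx (q * (k * 2)) y.1 : ZMod (q * (k * 2))) =
        ((c / (k * 2) + a (c / 2 : ℕ)) * (k * 2) + (2 * r.1.val + c % 2) : ℕ) := by
      refine (congrArg Prod.fst hcell).trans ?_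
      have h5 : (c : ℕ) = c / (k * 2) * (k * 2) + 2 * ((c / 2) % k) + c % 2 := by
        have e1 := Nat.div_add_mod c 2
        have e2 := Nat.div_add_mod (c / 2) k
        rw [Nat.div_div_eq_div_mul, mul_comm 2 k] at e2
        nlinarith
      show (((c + 2 * r.1.val : ℕ) : ZMod (q * (k * 2))) + (((2 * (a (c / 2 : ℕ) * k) : ℕ) : ZMod (q * (k * 2))) -
        ((2 * ((c / 2) % k) : ℕ) : ZMod (q * (k * 2))))) = _
      have h6 := congrArg (Nat.cast : ℕ → ZMod (q * (k * 2))) h5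
      rw [Nat.cast_add c, h6]
      push_cast
      ring
    rw [ZMod.natCast_eq_natCast_iff', Nat.mod_eq_of_lt (idx_lt (by positivity) _)] at h4
    have h7 : idx q y.1 = idx (q * (k * 2)) y.1 / (k * 2) := (idx_div (by omega) _).symm
    have h8 : 2 * r.1.val + c % 2 < k * 2 := by have := ZMod.val_lt r.1; omega
    rw [h7, h4, mul_comm q, Nat.mod_mul_right_div_self, add_comm, Nat.add_mul_div_right _ _ (by omega),
      Nat.div_eq_of_lt h8, zero_add, hqi, hi]
  · intro hs'
    refine (congrArg Prod.snd hcell).trans ?_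
    rw [hs, hi]

/-! ### One step of the construction of the conjugating maps -/

lemma tendsto_volume_of_eventually_notMem {ι : Type*} {L : Filter ι} [L.IsCountablyGenerated]
    {B : ι → Set Torus} (hB : ∀ i, MeasurableSet (B i)) (h : ∀ᵐ x, ∀ᶠ i in L, x ∉ B i) :
    Tendsto (fun i => volume (B i)) L (𝓝 0) := by
  have := tendsto_measure_of_ae_tendsto_indicator_of_isFiniteMeasure (μ := (volume : Measure Torus))
    L MeasurableSet.empty hB (by simpa using h)
  simpa using this

lemma ae_eventually_idx_fst_eq (Q : ℕ) : ∀ᵐ x : Torus, ∀ᶠ y in 𝓝 x, idx Q y.1 = idx Q x.1 := by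
  filter_upwards [(Measure.quasiMeasurePreserving_fst (μ := (volume : Measure UnitAddCircle))
    (ν := (volume : Measure UnitAddCircle))).ae (ae_eventually_idx_eq Q)] with x hx
  exact (continuous_fst.tendsto x).eventually hx

lemma ae_eventually_idx_snd_eq (Q : ℕ) : ∀ᵐ x : Torus, ∀ᶠ y in 𝓝 x, idx Q y.2 = idx Q x.2 := by
  filter_upwards [(Measure.quasiMeasurePreserving_snd (μ := (volume : Measure UnitAddCircle))
    (ν := (volume : Measure UnitAddCircle))).ae (ae_eventually_idx_eq Q)] with x hx
  exact (continuous_snd.tendsto x).eventually hx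

/-- The strip of `z` is the strip of `y` moved by `a`, and the fine row of `z` is given by `ρ`
in terms of the cell of `y`. -/
def IsRearranged {k M : ℕ} (q : ℕ) (a : ℕ → ℕ) (ρ : Fin k × Fin M ≃ Fin (k * M)) (z y : Torus) : Prop :=
  idx q z.1 = (idx q y.1 + a (idx (q * k) y.1 % k)) % q ∧
    ∀ (hi : idx (q * k) y.1 % k < k) (hs : idx M y.2 < M),
      idx (k * M) z.2 = ρ (⟨idx (q * k) y.1 % k, hi⟩, ⟨idx M y.2, hs⟩)

/-- Natural representatives identify `ZMod n` with `Fin n`. -/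
def zmodEquivFin (n : ℕ) [NeZero n] : ZMod n ≃ Fin n where
  toFun x := ⟨x.val, ZMod.val_lt x⟩
  invFun j := (j : ℕ)
  left_inv x := by simp
  right_inv j := by simp [ZMod.val_natCast, Nat.mod_eq_of_lt j.2]

lemma exists_approximable_isRearranged {q k M : ℕ} (hq : 0 < q) (hk : 0 < k) (hM : 0 < M) (a : ℕ → ℕ)
    (ρ : Fin k × Fin M ≃ Fin (k * M)) : ∃ g, Approximable q g ∧ ∀ y, IsRearranged q a ρ (g y) y := by
  have : NeZero k := ⟨hk.ne'⟩
  have : NeZero M := ⟨hM.ne'⟩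
  have : NeZero (k * M) := ⟨by positivity⟩
  obtain ⟨g, hg, hgx⟩ := exists_rearrangement hq (fun i => a i.val)
    (((zmodEquivFin k).prodCongr (Equiv.refl (Fin M))).trans (ρ.trans (zmodEquivFin (k * M)).symm))
  refine ⟨g, hg, fun y => ⟨?_, fun hi hs => ?_⟩⟩
  · rw [(hgx y).1, ZMod.val_natCast]
  · have h := congrArg (zmodEquivFin (k * M)) ((hgx y).2 hs)
    have h' := congrArg Fin.val h
    have e1 : (zmodEquivFin (k * M) (idx (k * M) (g y).2 : ZMod (k * M)) : ℕ) = idx (k * M) (g y).2 := by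
      show (idx (k * M) (g y).2 : ZMod (k * M)).val = _
      rw [ZMod.val_natCast, Nat.mod_eq_of_lt (idx_lt (by positivity) _)]
    have e2 : zmodEquivFin k (idx (q * k) y.1 : ZMod k) = ⟨idx (q * k) y.1 % k, hi⟩ :=
      Fin.ext (ZMod.val_natCast _ _)
    rw [e1] at h'
    rw [h', ← e2]
    simp

lemma measurableSet_isRearranged {k M : ℕ} (q : ℕ) (a : ℕ → ℕ) (ρ : Fin k × Fin M ≃ Fin (k * M))
    {h : Torus → Torus} (hh : Measurable h) : MeasurableSet {y | IsRearranged q a ρ (h y) y} := by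
  have hm : Measurable fun y : Torus =>
      ((idx q (h y).1, idx (k * M) (h y).2), (idx q y.1, idx (q * k) y.1), idx M y.2) :=
    (((measurable_idx _).comp (measurable_fst.comp hh)).prodMk
      ((measurable_idx _).comp (measurable_snd.comp hh))).prodMk
    ((((measurable_idx _).comp measurable_fst).prodMk ((measurable_idx _).comp measurable_fst)).prodMk
      ((measurable_idx _).comp measurable_snd))
  exact hm (MeasurableSet.of_discrete (s := {t : (ℕ × ℕ) × (ℕ × ℕ) × ℕ |
    t.1.1 = (t.2.1.1 + a (t.2.1.2 % k)) % q ∧ ∀ (hi : t.2.1.2 % k < k) (hs : t.2.2 < M),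
      t.1.2 = ρ (⟨t.2.1.2 % k, hi⟩, ⟨t.2.2, hs⟩)}))

/-- Pass to a subsequence of approximations converging almost everywhere. Cells are locally constant
almost everywhere and `g` preserves the measure, so the exact rearrangement rule eventually holds at
almost every point. Positivity is a hypothesis of the last clause only, so that a map is available
for arbitrary parameters, as in the definition of the threshold. -/
theorem exists_isRearranged (q k M : ℕ) (a : ℕ → ℕ) (ρ : Fin k × Fin M ≃ Fin (k * M)) {ε : ℝ}
    (hε : 0 < ε) : ∃ h ∈ entireGroup, Commute h (rot (1 / q)) ∧ (0 < q → 0 < k → 0 < M →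
      volume {y | ¬ IsRearranged q a ρ (h.2 y) y} ≤ ENNReal.ofReal ε) := by
  by_cases hpos : 0 < q ∧ 0 < k ∧ 0 < M
  swap
  · exact ⟨1, one_mem _, Commute.one_left _, fun h1 h2 h3 => absurd ⟨h1, h2, h3⟩ hpos⟩
  obtain ⟨hq, hk, hM⟩ := hpos
  obtain ⟨g, hg, hgy⟩ := exists_approximable_isRearranged hq hk hM a ρ
  choose h hmem hcomm hvol using fun m : ℕ => hg.2 (1 / ((m : ℝ) + 1)) (by positivity)
  have htm : TendstoInMeasure volume (fun m => ⇑(h m).2) atTop g := by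
    rw [tendstoInMeasure_iff_dist]
    intro δ hδ
    have h0 : Tendsto (fun m : ℕ => ENNReal.ofReal (1 / ((m : ℝ) + 1))) atTop (𝓝 0) := by
      rw [← ENNReal.ofReal_zero]
      exact ENNReal.tendsto_ofReal tendsto_one_div_add_atTop_nhds_zero_nat
    refine tendsto_of_tendsto_of_tendsto_of_le_of_le' tendsto_const_nhds h0
      (Eventually.of_forall fun _ => zero_le) ?_
    filter_upwards [tendsto_one_div_add_atTop_nhds_zero_nat.eventually_le_const hδ] with m hm
    exact (measure_mono fun x hx => hm.trans hx).trans (hvol m)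
  obtain ⟨ns, -, hns⟩ := htm.exists_seq_tendsto_ae
  have hlim : Tendsto (fun m => volume {y | ¬ IsRearranged q a ρ ((h (ns m)).2 y) y}) atTop (𝓝 0) := by
    refine tendsto_volume_of_eventually_notMem
      (fun m => (measurableSet_isRearranged q a ρ (h (ns m)).2.continuous.measurable).compl) ?_
    filter_upwards [hns, hg.1.quasiMeasurePreserving.ae (ae_eventually_idx_fst_eq q),
      hg.1.quasiMeasurePreserving.ae (ae_eventually_idx_snd_eq (k * M))] with x h1 h2 h3
    filter_upwards [h1.eventually h2, h1.eventually h3] with m h4 h5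
    simp only [not_not]
    have := hgy x
    refine ⟨h4.trans this.1, fun hi hs => h5.trans (this.2 hi hs)⟩
  obtain ⟨m, hm⟩ := (hlim.eventually_le_const (ENNReal.ofReal_pos.2 hε)).exists
  exact ⟨h (ns m), hmem _, hcomm _, fun _ _ _ => hm⟩

/-! ### Dependence on the angle of rotation -/

lemma exists_int_translate (t : ℝ) : ∃ a : ℤ, t + a ∈ Set.Icc (0 : ℝ) 1 :=
  ⟨-⌊t⌋, by push_cast; constructor <;> linarith [Int.floor_le t, Int.lt_floor_add_one t]⟩

lemma IsEntireLift.dist_translate {F G : ℂ × ℂ → ℂ × ℂ} {S T : Torus → Torus} (hF : IsEntireLift F S)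
    (hG : IsEntireLift G T) (z : ℂ × ℂ) (a b : ℤ) :
    dist (F (z.1 + a, z.2 + b)) (G (z.1 + a, z.2 + b)) = dist (F z) (G z) := by
  rw [hF.periodic, hG.periodic, Prod.dist_eq, Prod.dist_eq]
  simp

lemma continuous_rot_fst : Continuous fun p : ℝ × (ℂ × ℂ) => (rot p.1).1 p.2 := by
  simp only [rot_fst]; fun_prop

lemma continuous_rot_snd : Continuous fun p : ℝ × Torus => (rot p.1).2 p.2 := by
  simp only [rot_snd]
  have : Continuous fun p : ℝ × Torus => (p.1 : UnitAddCircle) :=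
    (AddCircle.continuous_mk' 1).comp continuous_fst
  fun_prop

lemma entireGroup.conj_rot_mem {H : MapPair} (hH : H ∈ entireGroup) (α : ℝ) :
    H * rot α * H⁻¹ ∈ entireGroup :=
  mul_mem (mul_mem hH (rot_mem α)) (inv_mem hH)

/-- The distance is invariant under integer translations, so it suffices to consider the compact set
of points with real parts in `[0, 1]` and imaginary parts in `[-r, r]`. -/
lemma eventually_conj_rot_dist_le {H : MapPair} (hH : H ∈ entireGroup) (r α : ℝ) {ε : ℝ} (hε : 0 < ε) :
    ∀ᶠ β in 𝓝 (0 : ℝ), ∀ z ∈ Omega r,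
      dist ((H * rot (α + β) * H⁻¹).1 z) ((H * rot α * H⁻¹).1 z) ≤ ε := by
  let I := Set.Icc (0 : ℝ) 1 ×ℂ Set.Icc (-r) r
  have hI : IsCompact I := isCompact_Icc.reProdIm isCompact_Icc
  have hcont : Continuous fun p : ℝ × (ℂ × ℂ) =>
      dist ((H * rot (α + p.1) * H⁻¹).1 p.2) ((H * rot α * H⁻¹).1 p.2) := by
    have h1 : Continuous fun p : ℝ × (ℂ × ℂ) => (H * rot (α + p.1) * H⁻¹).1 p.2 :=
      H.1.continuous.comp (continuous_rot_fst.comp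
        (show Continuous fun p : ℝ × (ℂ × ℂ) => ((α + p.1 : ℝ), H⁻¹.1 p.2) by
          have := H⁻¹.1.continuous
          fun_prop))
    exact h1.dist ((H * rot α * H⁻¹).1.continuous.comp continuous_snd)
  have hev := (hI.prod hI).eventually_forall_of_forall_eventually (x₀ := (0 : ℝ))
    (P := fun β z => dist ((H * rot (α + β) * H⁻¹).1 z) ((H * rot α * H⁻¹).1 z) ≤ ε) fun z _ => by
      exact ((hcont.tendsto (0, z)).eventually_lt_const (u := ε) (by simpa using hε)).mono
        fun _ h => h.le
  filter_upwards [hev] with β hβ z hz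
  obtain ⟨a, ha⟩ := exists_int_translate z.1.re
  obtain ⟨b, hb⟩ := exists_int_translate z.2.re
  rw [← (entireGroup.conj_rot_mem hH (α + β)).1.dist_translate (entireGroup.conj_rot_mem hH α).1 z a b]
  refine hβ _ ⟨⟨?_, ?_⟩, ⟨?_, ?_⟩⟩
  · simpa using ha
  · simpa using abs_le.1 hz.1.le
  · simpa using hb
  · simpa using abs_le.1 hz.2.le

/-- The cell of the preimage of a point under `H`. -/
noncomputable def code (H : MapPair) (q s : ℕ) (x : Torus) : ℕ × ℕ :=
  (idx q (H⁻¹.2 x).1, idx s (H⁻¹.2 x).2)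

lemma measurable_code (H : MapPair) (q s : ℕ) : Measurable (code H q s) :=
  ((measurable_idx _).comp (measurable_fst.comp H⁻¹.2.continuous.measurable)).prodMk
    ((measurable_idx _).comp (measurable_snd.comp H⁻¹.2.continuous.measurable))

lemma ae_eventually_code_eq {H : MapPair} (hH : H ∈ entireGroup) (q s : ℕ) :
    ∀ᵐ x, ∀ᶠ y in 𝓝 x, code H q s y = code H q s x := by
  have hqmp := (entireGroup.measurePreserving (inv_mem hH)).quasiMeasurePreserving
  filter_upwards [hqmp.ae (ae_eventually_idx_fst_eq q), hqmp.ae (ae_eventually_idx_snd_eq s)] with x h1 h2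
  have hc := H⁻¹.2.continuous.tendsto x
  filter_upwards [hc.eventually h1, hc.eventually h2] with y h3 h4
  exact Prod.ext h3 h4

/-- At almost every point the finitely many codes are locally constant near its image, so a small
change of angle leaves them unchanged. -/
lemma eventually_volume_code_ne_le {H : MapPair} (hH : H ∈ entireGroup) (α : ℝ) (n : ℕ) {K : ℕ → MapPair}
    (hK : ∀ j, K j ∈ entireGroup) (q s : ℕ → ℕ) {ε : ℝ} (hε : 0 < ε) :
    ∀ᶠ β in 𝓝 (0 : ℝ), volume {x | ∃ j ≤ n, code (K j) (q j) (s j) ((H * rot (α + β) * H⁻¹).2 x) ≠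
      code (K j) (q j) (s j) ((H * rot α * H⁻¹).2 x)} ≤ ENNReal.ofReal ε := by
  refine Tendsto.eventually_le_const (ENNReal.ofReal_pos.2 hε) (tendsto_volume_of_eventually_notMem
    (fun β => ?_) ?_)
  · have : {x | ∃ j ≤ n, code (K j) (q j) (s j) ((H * rot (α + β) * H⁻¹).2 x) ≠
        code (K j) (q j) (s j) ((H * rot α * H⁻¹).2 x)} =
        ⋃ j, ⋃ _ : j ≤ n, {x | code (K j) (q j) (s j) ((H * rot (α + β) * H⁻¹).2 x) =
        code (K j) (q j) (s j) ((H * rot α * H⁻¹).2 x)}ᶜ := by ext; simp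
    rw [this]
    exact .iUnion fun j => .iUnion fun _ => (measurableSet_eq_fun
      ((measurable_code _ _ _).comp (H * rot (α + β) * H⁻¹).2.continuous.measurable)
      ((measurable_code _ _ _).comp (H * rot α * H⁻¹).2.continuous.measurable)).compl
  · have hqmp := (entireGroup.measurePreserving (entireGroup.conj_rot_mem hH α)).quasiMeasurePreserving
    filter_upwards [hqmp.ae (ae_all_iff.2 fun j => ae_eventually_code_eq (hK j) (q j) (s j))] with x hx
    have hc : Tendsto (fun β : ℝ => (H * rot (α + β) * H⁻¹).2 x) (𝓝 0) (𝓝 ((H * rot α * H⁻¹).2 x)) := by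
      have h1 : Continuous fun β : ℝ => (H * rot (α + β) * H⁻¹).2 x :=
        H.2.continuous.comp (continuous_rot_snd.comp
          (show Continuous fun β : ℝ => ((α + β : ℝ), H⁻¹.2 x) by fun_prop))
      have := h1.tendsto 0
      rwa [add_zero] at this
    have hall : ∀ᶠ β in 𝓝 (0 : ℝ), ∀ j ∈ Finset.range (n + 1), code (K j) (q j) (s j)
        ((H * rot (α + β) * H⁻¹).2 x) = code (K j) (q j) (s j) ((H * rot α * H⁻¹).2 x) :=
      (eventually_all_finset _).2 fun j _ => hc.eventually (hx j)
    filter_upwards [hall] with β hβ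
    rintro ⟨j, hj, hne⟩
    exact hne (hβ j (by simp; omega))

lemma eventually_dist_le_imp (H : MapPair) {ε : ℝ} (hε : 0 < ε) :
    ∀ᶠ β in 𝓝 (0 : ℝ), ∀ x y, dist x y ≤ β → dist (H.2 x) (H.2 y) ≤ ε := by
  obtain ⟨δ, hδ, h⟩ := Metric.uniformContinuous_iff.1
    (CompactSpace.uniformContinuous_of_continuous H.2.continuous) ε hε
  filter_upwards [gt_mem_nhds hδ] with β hβ x y hxy
  exact (h (hxy.trans_lt hβ)).le

/-! ### The conjugating maps and the growth threshold -/

open Classical in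
/-- An enumeration of the bijections between cells and fine rows. -/
noncomputable def rowCode (k M c : ℕ) : Fin k × Fin M ≃ Fin (k * M) :=
  if h : c < Fintype.card (Fin k × Fin M ≃ Fin (k * M)) then (Fintype.equivFin _).symm ⟨c, h⟩
  else finProdFinEquiv

/-- Bijections are coded by bounded natural numbers so that the growth threshold can range over all
of them. -/
lemma exists_rowCode_eq {k M : ℕ} (ρ : Fin k × Fin M ≃ Fin (k * M)) :
    ∃ c < (k * M).factorial, rowCode k M c = ρ := by
  classical
  have hcard : Fintype.card (Fin k × Fin M ≃ Fin (k * M)) = (k * M).factorial := by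
    rw [Fintype.card_equiv finProdFinEquiv]; simp
  refine ⟨Fintype.equivFin _ ρ, ?_, ?_⟩
  · rw [← hcard]; exact Fin.is_lt _
  · rw [rowCode, dif_pos (by convert Fin.is_lt _)]
    convert (Fintype.equivFin _).symm_apply_apply ρ

variable (C l s c : ℕ → ℕ)

/-- The shift of strips, as a function of the column. -/
def stripShift (n I : ℕ) : ℕ := pSeq C l n * psi C l n (I / C n)

/-- A choice of an entire map rearranging the cells. -/
noncomputable def rearrangingMap (q k M : ℕ) (a : ℕ → ℕ) (c n : ℕ) : MapPair :=
  (exists_isRearranged q k M a (rowCode k M c) (ε := (1 / 2) ^ n) (by positivity)).choose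

/-- The map rearranging the cells of level `n + 1`. -/
noncomputable def stepMap (n : ℕ) : MapPair :=
  rearrangingMap (qSeq C l n) (kSeq C l n) (s (n + 1)) (stripShift C l n) (c n) n

lemma stepMap_spec (n : ℕ) : stepMap C l s c n ∈ entireGroup ∧
    Commute (stepMap C l s c n) (rot (1 / qSeq C l n)) ∧
    (0 < qSeq C l n → 0 < kSeq C l n → 0 < s (n + 1) → volume {y | ¬ IsRearranged (qSeq C l n)
      (stripShift C l n) (rowCode (kSeq C l n) (s (n + 1)) (c n)) ((stepMap C l s c n).2 y) y} ≤
        ENNReal.ofReal ((1 / 2) ^ n)) :=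
  (exists_isRearranged (qSeq C l n) (kSeq C l n) (s (n + 1)) (stripShift C l n)
    (rowCode (kSeq C l n) (s (n + 1)) (c n)) (ε := (1 / 2) ^ n) (by positivity)).choose_spec

/-- The conjugating maps. -/
noncomputable def conjMap : ℕ → MapPair
  | 0 => 1
  | n + 1 => conjMap n * stepMap C l s c n

lemma conjMap_mem (n : ℕ) : conjMap C l s c n ∈ entireGroup := by
  induction n with
  | zero => exact one_mem _
  | succ n ih => exact mul_mem ih (stepMap_spec C l s c n).1

/-- The angles of rotation. -/
noncomputable def angle (n : ℕ) : ℝ := pSeq C l n / qSeq C l n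

/-- The periodic approximations. -/
noncomputable def approx (n : ℕ) : MapPair :=
  conjMap C l s c n * rot (angle C l n) * (conjMap C l s c n)⁻¹

/-- `stepMap` commutes with the rotation by `1 / q_n`, hence with its power by `p_n`. So consecutive
approximations are conjugates by one map of rotations whose angles differ by `1 / q_{n+1}`. -/
lemma approx_eq (n : ℕ) : approx C l s c n =
    conjMap C l s c (n + 1) * rot (angle C l n) * (conjMap C l s c (n + 1))⁻¹ := by
  have h1 : Commute (stepMap C l s c n) (rot (angle C l n)) := by
    have : angle C l n = pSeq C l n * (1 / qSeq C l n) := by rw [angle]; ring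
    rw [this, rot_nat_mul]
    exact (stepMap_spec C l s c n).2.1.pow_right _
  rw [conjMap, mul_inv_rev, mul_assoc (conjMap C l s c n), h1.eq]
  group
  rfl

/-- The requirements on the rotation by an additional angle `β` at stage `n`. -/
structure IsSmallAngle (r : ℝ) (n : ℕ) (β : ℝ) : Prop where
  dist_le : ∀ z ∈ Omega r, dist
    ((conjMap C l s c (n + 1) * rot (angle C l n + β) * (conjMap C l s c (n + 1))⁻¹).1 z)
    ((conjMap C l s c (n + 1) * rot (angle C l n) * (conjMap C l s c (n + 1))⁻¹).1 z) ≤ (1 / 2) ^ n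
  dist_inv_le : ∀ z ∈ Omega r, dist
    ((conjMap C l s c (n + 1) * rot (-angle C l n + -β) * (conjMap C l s c (n + 1))⁻¹).1 z)
    ((conjMap C l s c (n + 1) * rot (-angle C l n) * (conjMap C l s c (n + 1))⁻¹).1 z) ≤ (1 / 2) ^ n
  volume_le : volume {x | ∃ j ≤ n, code (conjMap C l s c j) (qSeq C l j) (s j)
    ((conjMap C l s c (n + 1) * rot (angle C l n + β) * (conjMap C l s c (n + 1))⁻¹).2 x) ≠
    code (conjMap C l s c j) (qSeq C l j) (s j)
    ((conjMap C l s c (n + 1) * rot (angle C l n) * (conjMap C l s c (n + 1))⁻¹).2 x)} ≤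
      ENNReal.ofReal ((1 / 2) ^ n)
  dist_conj_le : ∀ x y, dist x y ≤ β →
    dist ((conjMap C l s c (n + 1)).2 x) ((conjMap C l s c (n + 1)).2 y) ≤ (1 / 2) ^ n

lemma eventually_isSmallAngle (r : ℝ) (n : ℕ) : ∀ᶠ β in 𝓝 (0 : ℝ), IsSmallAngle C l s c r n β := by
  have hH := conjMap_mem C l s c (n + 1)
  have hε : (0 : ℝ) < (1 / 2) ^ n := by positivity
  have hneg : Tendsto (fun β : ℝ => -β) (𝓝 0) (𝓝 0) := by
    have := (continuous_neg (G := ℝ)).tendsto 0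
    rwa [neg_zero] at this
  filter_upwards [eventually_conj_rot_dist_le hH r (angle C l n) hε,
    hneg.eventually (eventually_conj_rot_dist_le hH r (-angle C l n) hε),
    eventually_volume_code_ne_le hH (angle C l n) n (conjMap_mem C l s c) (qSeq C l) s hε,
    eventually_dist_le_imp (conjMap C l s c (n + 1)) hε] with β h1 h2 h3 h4
  exact ⟨h1, h2, h3, h4⟩

lemma exists_threshold (r : ℝ) (n : ℕ) :
    ∃ θ : ℕ, ∀ β : ℝ, 0 < β → β * θ ≤ 1 → IsSmallAngle C l s c r n β := by
  obtain ⟨δ, hδ, h⟩ := Metric.eventually_nhds_iff.1 (eventually_isSmallAngle C l s c r n)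
  obtain ⟨θ, hθ⟩ := exists_nat_gt (1 / δ)
  refine ⟨θ, fun β hβ hle => h ?_⟩
  rw [Real.dist_eq, sub_zero, abs_of_pos hβ]
  rw [div_lt_iff₀ hδ] at hθ
  by_contra! hc
  have : δ * θ ≤ β * θ := mul_le_mul_of_nonneg_right hc (Nat.cast_nonneg _)
  linarith [mul_comm (θ : ℝ) δ]

/-- A bound on `1 / β` that makes the angle `β` small enough at stage `n`. -/
noncomputable def threshold (r : ℝ) (n : ℕ) : ℕ := (exists_threshold C l s c r n).choose

lemma isSmallAngle_of_threshold (r : ℝ) (n : ℕ) {β : ℝ} (h0 : 0 < β)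
    (h1 : β * threshold C l s c r n ≤ 1) : IsSmallAngle C l s c r n β :=
  (exists_threshold C l s c r n).choose_spec β h0 h1

variable {C l s c} {C' l' s' c' : ℕ → ℕ}

lemma qSeq_congr {n : ℕ} (hC : ∀ m < n, C m = C' m) (hl : ∀ m < n, l m = l' m) :
    qSeq C l n = qSeq C' l' n := by
  induction n with
  | zero => rfl
  | succ n ih =>
    rw [TwistedSystem.qSeq, TwistedSystem.qSeq, ih (fun m hm => hC m (by omega)) fun m hm => hl m (by omega),
      hC n (by omega), hl n (by omega)]

lemma kSeq_congr {n : ℕ} (hC : ∀ m < n + 1, C m = C' m) (hl : ∀ m < n, l m = l' m) :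
    kSeq C l n = kSeq C' l' n := by
  rw [kSeq, kSeq, qSeq_congr (fun m hm => hC m (by omega)) hl, hC n (by omega)]

lemma pSeq_congr {n : ℕ} (hC : ∀ m < n, C m = C' m) (hl : ∀ m < n, l m = l' m) :
    pSeq C l n = pSeq C' l' n := by
  induction n with
  | zero => rfl
  | succ n ih =>
    rw [TwistedSystem.pSeq, TwistedSystem.pSeq, ih (fun m hm => hC m (by omega)) fun m hm => hl m (by omega),
      kSeq_congr hC fun m hm => hl m (by omega), hl n (by omega),
      qSeq_congr (fun m hm => hC m (by omega)) fun m hm => hl m (by omega)]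

lemma stripShift_congr {n : ℕ} (hC : ∀ m < n + 1, C m = C' m) (hl : ∀ m < n, l m = l' m) :
    stripShift C l n = stripShift C' l' n := by
  have hq := qSeq_congr (C := C) (C' := C') (fun m hm => hC m (by omega)) hl
  have hp := pSeq_congr (C := C) (C' := C') (fun m hm => hC m (by omega)) hl
  have hj : jNum C l n = jNum C' l' n := by
    funext i
    rw [jNum, jNum, hp, hq]
  funext I
  simp only [stripShift, psi, hp, hq, hj, hC n (by omega)]

lemma stepMap_congr {n : ℕ} (hC : ∀ m < n + 1, C m = C' m) (hl : ∀ m < n, l m = l' m)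
    (hs : s (n + 1) = s' (n + 1)) (hc : c n = c' n) : stepMap C l s c n = stepMap C' l' s' c' n := by
  have hq := qSeq_congr (C := C) (C' := C') (fun m hm => hC m (by omega)) hl
  have hk := kSeq_congr hC hl
  have ha := stripShift_congr hC hl
  simp only [stepMap, hq, hk, ha, hs, hc]

lemma conjMap_congr {n : ℕ} (hC : ∀ m < n, C m = C' m) (hl : ∀ m < n - 1, l m = l' m)
    (hs : ∀ m < n + 1, s m = s' m) (hc : ∀ m < n, c m = c' m) :
    conjMap C l s c n = conjMap C' l' s' c' n := by
  induction n with
  | zero => rfl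
  | succ n ih =>
    rw [conjMap, conjMap, ih (fun m hm => hC m (by omega)) (fun m hm => hl m (by omega))
      (fun m hm => hs m (by omega)) (fun m hm => hc m (by omega)),
      stepMap_congr hC (fun m hm => hl m (by omega)) (hs _ (by omega)) (hc n (by omega))]

/-- The conditions at stage `n` involve `l` only below `n`. This makes it legitimate to bound `l n`
below by a threshold computed from them. -/
lemma isSmallAngle_congr {n : ℕ} (hC : ∀ m < n + 1, C m = C' m) (hl : ∀ m < n, l m = l' m)
    (hs : ∀ m < n + 2, s m = s' m) (hc : ∀ m < n + 1, c m = c' m) {r β : ℝ}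
    (h : IsSmallAngle C l s c r n β) : IsSmallAngle C' l' s' c' r n β := by
  have hH : ∀ j < n + 2, conjMap C l s c j = conjMap C' l' s' c' j := fun j hj =>
    conjMap_congr (fun m hm => hC m (by omega)) (fun m hm => hl m (by omega))
      (fun m hm => hs m (by omega)) (fun m hm => hc m (by omega))
  have ha : angle C l n = angle C' l' n := by
    rw [angle, angle, qSeq_congr (fun m hm => hC m (by omega)) hl,
      pSeq_congr (fun m hm => hC m (by omega)) hl]
  obtain ⟨h1, h2, h3, h4⟩ := h
  rw [hH _ (by omega), ha] at h1 h2 h3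
  rw [hH _ (by omega)] at h4
  refine ⟨h1, h2, le_trans (measure_mono ?_) h3, h4⟩
  rintro x ⟨j, hj, hne⟩
  refine ⟨j, hj, ?_⟩
  rwa [hH j (by omega), qSeq_congr (C' := C') (l' := l') (fun m hm => hC m (by omega)) (fun m hm => hl m (by omega)),
    hs j (by omega)]

/-- Extend a finite sequence by zero. -/
def extendFin {n B : ℕ} (d : Fin n → Fin B) (m : ℕ) : ℕ := if h : m < n then d ⟨m, h⟩ else 0

/-- The growth condition on `l n`, in terms of the preceding data. -/
noncomputable def growthBound (r : ℝ) (k l s : List ℕ) : ℕ :=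
  (Finset.univ.sup fun d : (Fin k.length → Fin (k.sum + 1)) ×
      (Fin k.length → Fin (k.sum * s.sum).factorial) =>
    threshold (extendFin d.1) (fun m => l.getD m 0) (fun m => s.getD m 0) (extendFin d.2) r (k.length - 1)) +
  2 ^ k.length + 10

/-- The bound does not see `C` and `c`, but these are limited by `k m` and `(k m * s (m + 1))!`; the
supremum in `growthBound` is over all such data, extended by zero, and the true ones are among them.
-/
lemma isSmallAngle_of_growthBound {r : ℝ} {k : ℕ → ℕ} {n : ℕ}
    (hL : growthBound r ((List.range (n + 1)).map k) ((List.range n).map l) ((List.range (n + 2)).map s) ≤ l n)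
    (hC : ∀ m < n + 1, C m ≤ k m) (hc : ∀ m < n + 1, c m < (k m * s (m + 1)).factorial)
    {β : ℝ} (hβ : 0 < β) (hβl : β * l n ≤ 1) : IsSmallAngle C l s c r n β := by
  have hlen : ((List.range (n + 1)).map k).length = n + 1 := by simp
  set K := (List.range (n + 1)).map k with hK
  set S := (List.range (n + 2)).map s with hS
  have hkle : ∀ m < n + 1, k m ≤ K.sum := fun m hm =>
    List.le_sum_of_mem (List.mem_map.2 ⟨m, by simpa using hm, rfl⟩)
  have hsle : ∀ m < n + 2, s m ≤ S.sum := fun m hm =>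
    List.le_sum_of_mem (List.mem_map.2 ⟨m, by simpa using hm, rfl⟩)
  let d : (Fin K.length → Fin (K.sum + 1)) × (Fin K.length → Fin (K.sum * S.sum).factorial) :=
    (fun m => ⟨C m, by
      have := hC m (by omega); have := hkle m (by omega); omega⟩,
     fun m => ⟨c m, (hc m (by omega)).trans_le (Nat.factorial_le
      (Nat.mul_le_mul (hkle m (by omega)) (hsle _ (by omega))))⟩)
  have hle := Finset.le_sup (f := fun d : (Fin K.length → Fin (K.sum + 1)) ×
      (Fin K.length → Fin (K.sum * S.sum).factorial) =>
    threshold (extendFin d.1) (fun m => ((List.range n).map l).getD m 0) (fun m => S.getD m 0)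
      (extendFin d.2) r (K.length - 1)) (Finset.mem_univ d)
  have hle2 : threshold (extendFin d.1) (fun m => ((List.range n).map l).getD m 0) (fun m => S.getD m 0)
      (extendFin d.2) r n ≤ l n := by
    have e : K.length - 1 = n := by omega
    rw [← e]
    rw [e] at hle ⊢
    refine le_trans hle (le_trans ?_ hL)
    rw [growthBound, e]
    have := Nat.one_le_two_pow (n := K.length)
    omega
  have hsm := isSmallAngle_of_threshold (extendFin d.1) (fun m => ((List.range n).map l).getD m 0)
    (fun m => S.getD m 0) (extendFin d.2) r n hβ
    ((mul_le_mul_of_nonneg_left (Nat.cast_le.2 hle2) hβ.le).trans hβl)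
  refine isSmallAngle_congr (fun m hm => ?_) (fun m hm => ?_) (fun m hm => ?_) (fun m hm => ?_) hsm
  · rw [extendFin, dif_pos (by omega)]
  · simp [hm]
  · simp [hS, hm]
  · rw [extendFin, dif_pos (by omega)]

lemma le_of_growthBound {r : ℝ} {k : ℕ → ℕ} {n : ℕ}
    (hL : growthBound r ((List.range (n + 1)).map k) ((List.range n).map l) ((List.range (n + 2)).map s) ≤ l n) :
    10 ≤ l n ∧ 2 ^ n ≤ l n := by
  have hlen : ((List.range (n + 1)).map k).length = n + 1 := by simp
  rw [growthBound] at hL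
  have : 2 ^ n ≤ 2 ^ ((List.range (n + 1)).map k).length := Nat.pow_le_pow_right two_pos (by omega)
  have := Nat.one_le_two_pow (n := n)
  omega

/-! ### Limits of entire torus maps -/

lemma dist_toTorus_le (x y : ℝ × ℝ) : dist (toTorus x) (toTorus y) ≤ dist x y := by
  rw [Prod.dist_eq, Prod.dist_eq]
  refine max_le_max ?_ ?_
  all_goals
    show dist ((_ : ℝ) : UnitAddCircle) ((_ : ℝ) : UnitAddCircle) ≤ _
    rw [dist_eq_norm, ← AddCircle.coe_sub, Real.dist_eq]
    exact QuotientAddGroup.norm_mk_le_norm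

lemma toTorus_surjective : Function.Surjective toTorus := fun x => by
  obtain ⟨y, -, -, hy⟩ := exists_rep x.1
  obtain ⟨z, -, -, hz⟩ := exists_rep x.2
  exact ⟨(y, z), Prod.ext hy hz⟩

lemma dist_ofReal_prod (x y : ℝ × ℝ) :
    dist ((x.1 : ℂ), (x.2 : ℂ)) ((y.1 : ℂ), (y.2 : ℂ)) = dist x y := by
  simp only [Prod.dist_eq, Complex.isometry_ofReal.dist_eq]

/-- The lifts converge geometrically on `Ω_ρ`. Starting from the identity, the displacement of the
limit is bounded by `2`; it is periodic and real on the reals as a limit of such functions. -/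
lemma exists_hasLift_of_dist_le {ρ : ℝ} (hρ : 0 < ρ) {F : ℕ → ℂ × ℂ → ℂ × ℂ} {T : ℕ → Torus → Torus}
    (hF : ∀ n, IsEntireLift (F n) (T n)) (h0 : F 0 = id)
    (h : ∀ n, ∀ z ∈ Omega ρ, dist (F (n + 1) z) (F n z) ≤ (1 / 2) ^ n) :
    ∃ T' : Torus → Torus, HasLift ρ T' ∧ TendstoUniformly T T' atTop := by
  have hmem : ∀ x : ℝ × ℝ, ((x.1 : ℂ), (x.2 : ℂ)) ∈ Omega ρ := fun x => by simp [Omega, hρ]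
  have hstep : ∀ z ∈ Omega ρ, ∀ n, dist (F n z) (F (n + 1) z) ≤ 1 * (1 / 2) ^ n := fun z hz n => by
    rw [one_mul, dist_comm]; exact h n z hz
  have hlim : ∀ z, ∃ w, z ∈ Omega ρ → Tendsto (fun n => F n z) atTop (𝓝 w) := fun z => by
    by_cases hz : z ∈ Omega ρ
    · obtain ⟨w, hw⟩ := cauchySeq_tendsto_of_complete
        (cauchySeq_of_le_geometric (1 / 2) 1 (by norm_num) (hstep z hz))
      exact ⟨w, fun _ => hw⟩
    · exact ⟨0, fun hz' => absurd hz' hz⟩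
  choose G hG using hlim
  have hdist : ∀ z ∈ Omega ρ, ∀ n, dist (F n z) (G z) ≤ 2 * (1 / 2) ^ n := fun z hz n => by
    refine (dist_le_of_le_geometric_of_tendsto (1 / 2) 1 (by norm_num) (hstep z hz) (hG z hz) n).trans
      (le_of_eq ?_)
    ring
  have hpow : Tendsto (fun n : ℕ => 2 * (1 / 2 : ℝ) ^ n) atTop (𝓝 0) := by
    have := (tendsto_pow_atTop_nhds_zero_of_lt_one (r := (1 / 2 : ℝ)) (by norm_num) (by norm_num)).const_mul 2
    simpa using this
  have huni : TendstoUniformlyOn F G atTop (Omega ρ) := by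
    refine Metric.tendstoUniformlyOn_iff.2 fun ε hε => ?_
    filter_upwards [hpow.eventually_lt_const hε] with n hn z hz
    rw [dist_comm]
    exact (hdist z hz n).trans_lt hn
  have hreal : ∀ n (x : ℝ × ℝ), ∃ y : ℝ × ℝ, F n (x.1, x.2) = (↑y.1, ↑y.2) ∧ T n (toTorus x) = toTorus y :=
    fun n x => (hF n).real x
  have hGreal : ∀ x : ℝ × ℝ, G (x.1, x.2) = (((G (x.1, x.2)).1.re : ℂ), ((G (x.1, x.2)).2.re : ℂ)) := by
    intro x
    have hc : IsClosed {w : ℂ × ℂ | w.1.im = 0 ∧ w.2.im = 0} :=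
      (isClosed_eq (by fun_prop : Continuous fun w : ℂ × ℂ => w.1.im) continuous_const).inter
        (isClosed_eq (by fun_prop : Continuous fun w : ℂ × ℂ => w.2.im) continuous_const)
    have := hc.mem_of_tendsto (hG _ (hmem x)) (Eventually.of_forall fun n => by
      obtain ⟨y, hy, -⟩ := hreal n x
      rw [hy]
      exact ⟨Complex.ofReal_im _, Complex.ofReal_im _⟩)
    exact Prod.ext (Complex.ext (by simp) (by simpa using this.1)) (Complex.ext (by simp) (by simpa using this.2))
  let g : ℝ × ℝ → ℝ × ℝ := fun x => ((G (x.1, x.2)).1.re, (G (x.1, x.2)).2.re)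
  have hTg : ∀ x n, dist (T n (toTorus x)) (toTorus (g x)) ≤ 2 * (1 / 2) ^ n := by
    intro x n
    obtain ⟨y, hy, hy'⟩ := hreal n x
    rw [hy']
    refine (dist_toTorus_le _ _).trans ?_
    rw [← dist_ofReal_prod, ← hy]
    have := hdist _ (hmem x) n
    rwa [hGreal x] at this
  choose rep hrep using toTorus_surjective
  have hT' : ∀ t n, dist (T n t) (toTorus (g (rep t))) ≤ 2 * (1 / 2) ^ n := fun t n => by
    have := hTg (rep t) n
    rwa [hrep] at this
  refine ⟨fun t => toTorus (g (rep t)), ?_, ?_⟩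
  · have hcomp : ∀ (pr : ℂ × ℂ →L[ℂ] ℂ), (∀ (w : ℂ × ℂ), ‖pr w‖ ≤ ‖w‖) →
        (∀ (w : ℂ × ℂ) (a b : ℤ), pr (w.1 + a, w.2 + b) - pr w = pr (a, b)) →
        (∀ y : ℝ × ℝ, (pr (y.1, y.2)).im = 0) →
        (fun x : ℝ × ℝ => (pr (G (x.1, x.2)) - pr (x.1, x.2)).re) ∈ COmega ρ := by
      intro pr hn hpr him
      refine mem_COmega_of_tendstoUniformlyOn hρ (F := fun n z => pr (F n z) - pr z)
        (g := fun z => pr (G z) - pr z) (fun n => ?_) (fun n z a b => ?_) (fun n x => ?_) ?_ ⟨2, fun z hz => ?_⟩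
      · exact (pr.differentiable.comp (hF n).differentiable).sub pr.differentiable
      · rw [(hF n).periodic]
        have h1 := hpr (F n z) a b
        have h2 := hpr z a b
        linear_combination h1 - h2
      · obtain ⟨y, hy, -⟩ := hreal n x
        rw [hy, Complex.sub_im, him, him, sub_zero]
      · refine Metric.tendstoUniformlyOn_iff.2 fun ε hε => ?_
        filter_upwards [Metric.tendstoUniformlyOn_iff.1 huni ε hε] with n hn' z hz
        rw [dist_sub_right, dist_eq_norm, ← map_sub]
        refine (hn _).trans_lt ?_
        rw [← dist_eq_norm]
        exact hn' z hz
      · rw [← map_sub]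
        refine (hn _).trans ?_
        have := hdist z hz 0
        rw [h0, pow_zero, mul_one, dist_comm, dist_eq_norm] at this
        exact this
    refine ⟨_, hcomp (.fst ℂ ℂ ℂ) (fun w => norm_fst_le w) (by simp) (by simp),
      _, hcomp (.snd ℂ ℂ ℂ) (fun w => norm_snd_le w) (by simp) (by simp), fun x => ?_⟩
    have h1 : toTorus (g (rep (toTorus x))) = toTorus (g x) := by
      refine tendsto_nhds_unique (f := fun n => T n (toTorus x)) (l := atTop) ?_ ?_
      · exact tendsto_iff_dist_tendsto_zero.2 (squeeze_zero (fun _ => dist_nonneg) (hT' (toTorus x)) hpow)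
      · exact tendsto_iff_dist_tendsto_zero.2 (squeeze_zero (fun _ => dist_nonneg) (hTg x) hpow)
    show toTorus (g (rep (toTorus x))) = _
    rw [h1]
    simp [g]
  · refine Metric.tendstoUniformly_iff.2 fun ε hε => ?_
    filter_upwards [hpow.eventually_lt_const hε] with n hn t
    rw [dist_comm]
    exact (hT' t n).trans_lt hn

/-- Integrals of bounded continuous functions pass to the limit by dominated convergence, and they
determine the image measure. -/
lemma measurePreserving_of_tendsto {T : ℕ → Torus → Torus} {T' : Torus → Torus}
    (hT : ∀ n, MeasurePreserving (T n) volume volume) (hT' : Measurable T')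
    (h : ∀ x, Tendsto (fun n => T n x) atTop (𝓝 (T' x))) : MeasurePreserving T' volume volume := by
  refine ⟨hT', ?_⟩
  have : IsProbabilityMeasure (Measure.map T' volume) := Measure.isProbabilityMeasure_map hT'.aemeasurable
  refine ext_of_forall_integral_eq_of_IsFiniteMeasure fun f => ?_
  rw [integral_map hT'.aemeasurable f.continuous.measurable.aestronglyMeasurable]
  have h1 : Tendsto (fun n => ∫ x, f (T n x)) atTop (𝓝 (∫ x, f (T' x))) := by
    refine tendsto_integral_of_dominated_convergence (fun _ => ‖f‖)
      (fun n => (f.continuous.measurable.comp (hT n).measurable).aestronglyMeasurable) (integrable_const _)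
      (fun n => Eventually.of_forall fun x => f.norm_coe_le_norm _)
      (Eventually.of_forall fun x => (f.continuous.tendsto _).comp (h x))
  have h2 : ∀ n, ∫ x, f (T n x) = ∫ x, f x := fun n => by
    rw [← integral_map (hT n).measurable.aemeasurable f.continuous.measurable.aestronglyMeasurable,
      (hT n).map_eq]
  simp only [h2] at h1
  exact tendsto_nhds_unique h1 tendsto_const_nhds

/-- The maps and their inverses converge separately; by uniform convergence the two limits are
inverse to each other. -/
theorem exists_limit_mem_DiffOmega {ρ : ℝ} (hρ : 0 < ρ) {F : ℕ → MapPair} (hF : ∀ n, F n ∈ entireGroup)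
    (h0 : F 0 = 1) (h1 : ∀ n, ∀ z ∈ Omega ρ, dist ((F (n + 1)).1 z) ((F n).1 z) ≤ (1 / 2) ^ n)
    (h2 : ∀ n, ∀ z ∈ Omega ρ, dist ((F (n + 1))⁻¹.1 z) ((F n)⁻¹.1 z) ≤ (1 / 2) ^ n) :
    ∃ T ∈ DiffOmega ρ, ∀ x, Tendsto (fun n => (F n).2 x) atTop (𝓝 (T x)) := by
  obtain ⟨T, hT, hTu⟩ := exists_hasLift_of_dist_le hρ (F := fun n => (F n).1) (T := fun n => (F n).2)
    (fun n => (hF n).1) (by rw [h0]; rfl) h1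
  obtain ⟨S, hS, hSu⟩ := exists_hasLift_of_dist_le hρ (F := fun n => (F n)⁻¹.1) (T := fun n => (F n)⁻¹.2)
    (fun n => (inv_mem (hF n)).1) (by rw [h0]; rfl) h2
  have hTc : Continuous T := hTu.continuous (Frequently.of_forall fun n => (F n).2.continuous)
  have hSc : Continuous S := hSu.continuous (Frequently.of_forall fun n => (F n)⁻¹.2.continuous)
  have hTt := fun x => hTu.tendsto_at x
  have hSt := fun x => hSu.tendsto_at x
  have hST : ∀ x, S (T x) = x := fun x => by
    refine tendsto_nhds_unique (hSu.tendsto_comp hSc.continuousAt (hTt x)) ?_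
    have : ∀ n, (F n)⁻¹.2 ((F n).2 x) = x := fun n => (F n).2.symm_apply_apply x
    simp only [this]
    exact tendsto_const_nhds
  have hTS : ∀ x, T (S x) = x := fun x => by
    refine tendsto_nhds_unique (hTu.tendsto_comp hTc.continuousAt (hSt x)) ?_
    have : ∀ n, (F n).2 ((F n)⁻¹.2 x) = x := fun n => (F n).2.apply_symm_apply x
    simp only [this]
    exact tendsto_const_nhds
  exact ⟨⟨⟨T, S, hST, hTS⟩, hTc, hSc⟩, ⟨measurePreserving_of_tendsto
    (fun n => entireGroup.measurePreserving (hF n)) hTc.measurable hTt, hT, hS⟩, hTt⟩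

/-! ### Positions in words of consecutive levels -/

section Positions

variable {C l : ℕ → ℕ} (hC : ∀ n, 0 < C n) (hl : ∀ n, 0 < l n)

lemma eq_of_natCast_zmod_eq {q a b : ℕ} (ha : a < q) (hb : b < q) (h : (a : ZMod q) = b) : a = b := by
  have := (ZMod.natCast_eq_natCast_iff' _ _ _).1 h
  rwa [Nat.mod_eq_of_lt ha, Nat.mod_eq_of_lt hb] at this

include hC hl

/-- Rotating by `p_n / q_n` moves the strip by `p_n`, hence the position by one. -/
lemma jNum_add_pSeq (n i : ℕ) :
    jNum C l n ((i + pSeq C l n) % qSeq C l n) = (jNum C l n i + 1) % qSeq C l n := by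
  refine eq_of_natCast_zmod_eq (jNum_lt hC hl _ _) (Nat.mod_lt _ (qSeq_pos hC hl n)) ?_
  rw [natCast_jNum hC hl, ZMod.natCast_mod, ZMod.natCast_mod]
  push_cast
  rw [natCast_jNum hC hl, mul_add, mul_comm _ (pSeq C l n : ZMod (qSeq C l n)), pSeq_mul_inv]

lemma pSeq_mul_jNum (n i : ℕ) :
    ((pSeq C l n * jNum C l n i : ℕ) : ZMod (qSeq C l n)) = i := by
  push_cast
  rw [natCast_jNum hC hl, ← mul_assoc, pSeq_mul_inv, one_mul]

lemma jNum_injOn (n : ℕ) {i j : ℕ} (hi : i < qSeq C l n) (hj : j < qSeq C l n)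
    (h : jNum C l n i = jNum C l n j) : i = j :=
  eq_of_natCast_zmod_eq hi hj (by rw [← pSeq_mul_jNum hC hl, h, pSeq_mul_jNum hC hl])

/-- With `N = k l q` and `P` the position, `p_{n+1} = p_n N + 1` gives `J ≡ P + N p_n P` modulo `q
N`; split this into remainder and quotient by `N`. -/
lemma index_mod_div (n : ℕ) {J : ℕ} (hJ : J < qSeq C l (n + 1)) :
    J % (kSeq C l n * (l n * qSeq C l n)) =
      jNum C l (n + 1) J % (kSeq C l n * (l n * qSeq C l n)) ∧
    J / (kSeq C l n * (l n * qSeq C l n)) = (pSeq C l n * jNum C l (n + 1) J +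
      jNum C l (n + 1) J / (kSeq C l n * (l n * qSeq C l n))) % qSeq C l n := by
  have h1 := pSeq_mul_jNum hC hl (n + 1) J
  rw [ZMod.natCast_eq_natCast_iff', Nat.mod_eq_of_lt hJ] at h1
  generalize jNum C l (n + 1) J = P at *
  have hN : 0 < kSeq C l n * (l n * qSeq C l n) :=
    Nat.mul_pos (kSeq_pos hC hl n) (Nat.mul_pos (hl n) (qSeq_pos hC hl n))
  rw [pSeq_succ, qSeq_succ, mul_assoc (qSeq C l n), mul_comm (qSeq C l n)] at h1
  generalize kSeq C l n * (l n * qSeq C l n) = N at *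
  have h2 : (pSeq C l n * N + 1) * P = P + N * (pSeq C l n * P) := by ring
  rw [h2] at h1
  rw [← h1]
  constructor
  · rw [Nat.mod_mul_right_mod, Nat.add_mul_mod_self_left]
  · rw [Nat.mod_mul_right_div_self, Nat.add_mul_div_left _ _ hN, add_comm]

/-- This is the reason for the choice of `ψ_n` and of the exponents. Multiplying the strip `p_n P +
P / N + p_n ψ` by `p_n⁻¹` gives `P + j_{P/N} + ψ`, the place in the block plus the exponent of `e`
modulo `q_n`. -/
lemma jNum_rearranged (n : ℕ) {J : ℕ} (hJ : J < qSeq C l (n + 1)) :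
    jNum C l n ((J / (kSeq C l n * (l n * qSeq C l n)) +
      stripShift C l n (J / (l n * qSeq C l n) % kSeq C l n)) % qSeq C l n) =
    (jNum C l (n + 1) J % (l n * qSeq C l n) +
      blockExp C l n (jNum C l (n + 1) J / (l n * qSeq C l n))) % qSeq C l n := by
  obtain ⟨h1, h2⟩ := index_mod_div hC hl n hJ
  refine eq_of_natCast_zmod_eq (jNum_lt hC hl _ _) (Nat.mod_lt _ (qSeq_pos hC hl n)) ?_
  have h3 : J / (l n * qSeq C l n) % kSeq C l n =
      jNum C l (n + 1) J / (l n * qSeq C l n) % kSeq C l n := by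
    rw [mul_comm (kSeq C l n)] at h1
    rw [← Nat.mod_mul_right_div_self, h1, Nat.mod_mul_right_div_self]
  rw [h3, h2]
  generalize jNum C l (n + 1) J = P at *
  have h4 : ((P % (l n * qSeq C l n) : ℕ) : ZMod (qSeq C l n)) = P := by
    rw [ZMod.natCast_eq_natCast_iff']
    exact Nat.mod_mul_left_mod _ _ _
  rw [natCast_jNum hC hl, blockExp, eExp, stripShift, Nat.div_div_eq_div_mul,
    mul_comm (l n * qSeq C l n) (kSeq C l n)]
  simp only [ZMod.natCast_mod, Nat.cast_add, Nat.cast_mul (pSeq C l n), natCast_jNum hC hl, h4]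
  have h5 := pSeq_mul_inv C l n
  linear_combination ((P : ZMod (qSeq C l n)) +
    (psi C l n (P / (l n * qSeq C l n) % kSeq C l n / C n) : ZMod (qSeq C l n))) * h5

end Positions

/-- Going back by the place plus the exponent, modulo `q`, reaches the start of a copy of `w`. The
margins `2q` and `3q` keep two full copies from there inside the power of `w`. -/
lemma IsBlockStream.getElem_sub {A : Type*} {q b N : ℕ} {e : ℕ → ℕ} {w : ℕ → Word A}
    {z : ℕ → Option (Letter A)} (hz : IsBlockStream q b N e w z) (hq : 0 < q) (he : ∀ α, e α < q)
    {P : ℕ} (hP : P / b < N) (h1 : 2 * q ≤ P % b) (h2 : P % b + 3 * q < b) {i : ℕ} (hi : i < 2 * q) :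
    z (P - (P % b + e (P / b)) % q + i) = (w (P / b))[i % q]? := by
  have hdm := Nat.div_add_mod' P b
  set t := P % b with ht
  set α := P / b with hα
  have heα := he α
  have h3 := Nat.mod_lt (t + e α) hq
  have h4 := Nat.div_add_mod' (t + e α) q
  set π := (t + e α) % q with hπ
  have h5 := hz.at_w α hP (t + e α - π - q + i) (by omega)
  have h6 : α * b + (q - e α) + (t + e α - π - q + i) = P - π + i := by omega
  rw [h6] at h5
  rw [h5]
  congr 1
  set D := (t + e α) / q with hD
  have hDpos : 1 ≤ D := by
    by_contra! h0
    have : D = 0 := Nat.lt_one_iff.1 h0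
    rw [this] at h4
    omega
  have h7 : t + e α - π - q + i = i + q * (D - 1) := by
    obtain ⟨D', hD'⟩ := Nat.exists_eq_add_of_le hDpos
    rw [hD'] at h4 ⊢
    rw [Nat.add_sub_cancel_left]
    have : (1 + D') * q = q + q * D' := by ring
    omega
  rw [h7, Nat.add_mul_mod_self_left]

/-! ### Distributing points over fibres -/

/-- A map with fibres of equal size is the integer part of a bijection. -/
lemma exists_equiv_div_eq {ι : Type*} [Fintype ι] {K N : ℕ} (f : ι → Fin K)
    (h : ∀ c, Nat.card {i // f i = c} = N) : ∃ ρ : ι ≃ Fin (K * N), ∀ i, (ρ i : ℕ) / N = f i := by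
  classical
  have hfib : ∀ c, Nonempty ({i // f i = c} ≃ Fin N) := fun c =>
    ⟨Finite.equivFinOfCardEq (h c)⟩
  let g := fun c => (hfib c).some
  let ρ := ((Equiv.sigmaFiberEquiv f).symm.trans (Equiv.sigmaCongrRight g)).trans
    ((Equiv.sigmaEquivProd (Fin K) (Fin N)).trans finProdFinEquiv)
  refine ⟨ρ, fun i => ?_⟩
  have hρ : (ρ i : ℕ) = g (f i) ⟨i, rfl⟩ + N * (f i) := rfl
  have hN : 0 < N := Fin.pos (g (f i) ⟨i, rfl⟩)
  rw [hρ, Nat.add_mul_div_left _ _ hN, Nat.div_eq_of_lt (Fin.is_lt _), zero_add]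

lemma card_sigma_fiber {k M K r : ℕ} (f : Fin k × Fin M → Fin K)
    (h : ∀ t c, Nat.card {i // f (i, t) = c} = r) (c : Fin K) :
    Nat.card {x // f x = c} = M * r := by
  have e : {x // f x = c} ≃ Σ t : Fin M, {i // f (i, t) = c} :=
    { toFun := fun x => ⟨x.1.2, x.1.1, x.2⟩
      invFun := fun y => ⟨(y.2.1, y.1), y.2.2⟩
      left_inv := fun _ => rfl
      right_inv := fun _ => rfl }
  rw [Nat.card_congr e, Nat.card_sigma]
  simp only [h, Finset.sum_const, Finset.card_univ, Fintype.card_fin, smul_eq_mul]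

/-! ### Choosing the rearrangements according to the words -/

section Words

variable {A : Type*} {C l s : ℕ → ℕ} {W : ℕ → Set (Word A)}

/-- An enumeration of the words, their pre-words, and bijections between cells and fine rows that
put the cell `(I, t)` in a row in the strip of the `I`-th word of the `t`-th pre-word. -/
structure RowData (C l s : ℕ → ℕ) (W : ℕ → Set (Word A)) where
  e : ∀ n, Fin (s n) → Word A
  e_mem : ∀ n t, e n t ∈ W n
  e_inj : ∀ n, Function.Injective (e n)
  u : ∀ n, Fin (s (n + 1)) → List (Word A)
  u_mem : ∀ n t, u n t ∈ tuples (W n) (kSeq C l n)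
  e_succ : ∀ n t, e (n + 1) t = twist C l n (u n t)
  c : ℕ → ℕ
  c_lt : ∀ n, c n < (kSeq C l n * s (n + 1)).factorial
  row : ∀ n (I : Fin (kSeq C l n)) (t : Fin (s (n + 1))), ∃ j : Fin (s n), (u n t)[(I : ℕ)]? = some (e n j) ∧
    (rowCode (kSeq C l n) (s (n + 1)) (c n) (I, t) : ℕ) / (s (n + 1) * (kSeq C l n / s n)) = j

/-- Sending the cell `(I, t)` to the `I`-th word of the `t`-th pre-word has fibres of equal size by
balance. Hence it is the strip index of some bijection onto fine rows, and such a bijection has a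
code. -/
lemma nonempty_rowData (h : IsTwistedSequence C l W) (hcard : ∀ n, (W n).ncard = s n)
    (hs : ∀ n, 0 < s n) (hdiv : ∀ n, s n ∣ kSeq C l n)
    (hbal : IsBalanced C l W fun n => kSeq C l n / s n) : Nonempty (RowData C l s W) := by
  have hfin : ∀ n, (W n).Finite := fun n => Set.finite_of_ncard_pos (by rw [hcard]; exact hs n)
  have hE : ∀ n, Nonempty (W n ≃ Fin (s n)) := fun n => by
    have := (hfin n).to_subtype
    exact ⟨Finite.equivFinOfCardEq (hcard n)⟩
  let E := fun n => (hE n).some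
  have hpre : ∀ n (t : Fin (s (n + 1))), ∃ u ∈ tuples (W n) (kSeq C l n),
      ((E (n + 1)).symm t : Word A) = twist C l n u := fun n t => by
    obtain ⟨P, hP, -, hW⟩ := h.succ n
    obtain ⟨u, hu, hu'⟩ := hW.subset ((E (n + 1)).symm t).2
    exact ⟨u, hP hu, hu'.symm⟩
  choose u hu hu' using hpre
  have hget : ∀ n (x : Fin (kSeq C l n) × Fin (s (n + 1))), ∃ j : Fin (s n),
      (u n x.2)[(x.1 : ℕ)]? = some ((E n).symm j : Word A) := fun n x => by
    have hlt : (x.1 : ℕ) < (u n x.2).length := by rw [(hu n x.2).1]; exact x.1.2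
    refine ⟨E n ⟨(u n x.2)[(x.1 : ℕ)], (hu n x.2).2 _ (List.getElem_mem hlt)⟩, ?_⟩
    rw [List.getElem?_eq_getElem hlt, Equiv.symm_apply_apply]
  choose f hf using hget
  have hcount : ∀ n (t : Fin (s (n + 1))) (j : Fin (s n)),
      Nat.card {i // f n (i, t) = j} = kSeq C l n / s n := fun n t j => by
    refine Eq.trans ?_ (hbal n _ ((E (n + 1)).symm t).2 _ ((E n).symm j).2 _ (hu n t) (hu' n t))
    rw [← Nat.card_coe_set_eq]
    have hiff : ∀ i : Fin (kSeq C l n), f n (i, t) = j ↔ (u n t)[(i : ℕ)]? = some ((E n).symm j : Word A) :=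
      fun i => by
        rw [hf n (i, t), Option.some_inj, Subtype.coe_inj, Equiv.apply_eq_iff_eq]
    exact Nat.card_congr
      { toFun := fun i => ⟨i.1, i.1.2, (hiff i.1).1 i.2⟩
        invFun := fun i => ⟨⟨i.1, i.2.1⟩, (hiff ⟨i.1, i.2.1⟩).2 i.2.2⟩
        left_inv := fun _ => rfl
        right_inv := fun _ => rfl }
  have hρ : ∀ n, ∃ c < (kSeq C l n * s (n + 1)).factorial, ∀ x,
      (rowCode (kSeq C l n) (s (n + 1)) c x : ℕ) / (s (n + 1) * (kSeq C l n / s n)) = f n x := fun n => by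
    obtain ⟨ρ, hρ⟩ := exists_equiv_div_eq (f n) (card_sigma_fiber (f n) (hcount n))
    have hmul : s n * (s (n + 1) * (kSeq C l n / s n)) = kSeq C l n * s (n + 1) := by
      rw [mul_left_comm, Nat.mul_div_cancel' (hdiv n), mul_comm]
    obtain ⟨c, hc, hc'⟩ := exists_rowCode_eq (ρ.trans (finCongr hmul))
    exact ⟨c, hc, fun x => by rw [hc', ← hρ x]; rfl⟩
  choose c hc hc' using hρ
  exact ⟨{
    e := fun n t => (E n).symm t
    e_mem := fun n t => ((E n).symm t).2
    e_inj := fun n => Subtype.val_injective.comp (E n).symm.injective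
    u := u
    u_mem := hu
    e_succ := hu'
    c := c
    c_lt := hc
    row := fun n I t => ⟨f n (I, t), hf n (I, t), hc' n (I, t)⟩ }⟩

end Words

/-- Borel–Cantelli for geometrically decreasing measures. -/
lemma ae_eventually_notMem_of_le {B : ℕ → Set Torus} {K : ℝ} (hK : 0 ≤ K)
    (h : ∀ n, volume (B n) ≤ ENNReal.ofReal (K * (1 / 2) ^ n)) : ∀ᵐ x, ∀ᶠ n in atTop, x ∉ B n := by
  refine ae_eventually_notMem (ne_top_of_le_ne_top ?_ (ENNReal.tsum_le_tsum h))
  rw [← ENNReal.ofReal_tsum_of_nonneg (fun n => by positivity)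
    ((summable_geometric_of_lt_one (by norm_num) (by norm_num)).mul_left K)]
  exact ENNReal.ofReal_ne_top

/-! ### The limit is isomorphic to the symbolic system -/

section Limit

variable {A : Type*} {C l s : ℕ → ℕ} {W : ℕ → Set (Word A)} (D : RowData C l s W)
  (h : IsTwistedSequence C l W) (hs : ∀ n, 0 < s n)

namespace RowData

/-- The conjugating maps belonging to the row data. -/
noncomputable def conj (n : ℕ) : MapPair := conjMap C l s D.c n

/-- The cell of level `n`. -/
noncomputable def cellCode (n : ℕ) (x : Torus) : ℕ × ℕ := code (D.conj n) (qSeq C l n) (s n) x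

/-- The coding scheme on the torus. -/
noncomputable def scheme : CodingScheme A Torus where
  pos n x := jNum C l n (D.cellCode n x).1
  word n x := if hs : (D.cellCode n x).2 < s n then D.e n ⟨(D.cellCode n x).2, hs⟩ else []

/-- Points whose cell of level `n + 1` lies properly inside their cell of level `n`. -/
structure IsGood (n : ℕ) (x : Torus) : Prop where
  rearranged : IsRearranged (qSeq C l n) (stripShift C l n) (rowCode (kSeq C l n) (s (n + 1)) (D.c n))
    ((D.conj n)⁻¹.2 x) ((D.conj (n + 1))⁻¹.2 x)
  left : 2 * qSeq C l n ≤ (D.cellCode (n + 1) x).1 % (l n * qSeq C l n)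
  right : (D.cellCode (n + 1) x).1 % (l n * qSeq C l n) + 3 * qSeq C l n < l n * qSeq C l n

include hs in
lemma word_eq (n : ℕ) (x : Torus) : D.scheme.word n x = D.e n ⟨(D.cellCode n x).2, idx_lt (hs n) _⟩ :=
  dif_pos (idx_lt (hs n) _)

include h in
-- Because `H_n⁻¹ = h_n H_{n+1}⁻¹`, this set is the preimage of the exceptional set of `stepMap`
-- under a measure-preserving map.
lemma volume_not_rearranged_le (hs : ∀ n, 0 < s n) (n : ℕ) :
    volume {x | ¬ IsRearranged (qSeq C l n) (stripShift C l n)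
      (rowCode (kSeq C l n) (s (n + 1)) (D.c n)) ((D.conj n)⁻¹.2 x) ((D.conj (n + 1))⁻¹.2 x)} ≤
      ENNReal.ofReal (1 * (1 / 2) ^ n) := by
  rw [one_mul]
  have hspec := stepMap_spec C l s D.c n
  refine le_trans (le_of_eq ?_) (hspec.2.2 (qSeq_pos h.coeff.C_pos h.coeff.l_pos n)
    (kSeq_pos h.coeff.C_pos h.coeff.l_pos n) (hs _))
  have hmp := entireGroup.measurePreserving (inv_mem (conjMap_mem C l s D.c (n + 1)))
  refine Eq.trans ?_ (hmp.measure_preimage (measurableSet_isRearranged _ _ _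
    (stepMap C l s D.c n).2.continuous.measurable).compl.nullMeasurableSet)
  congr 1
  ext x
  have : (stepMap C l s D.c n).2 ((conjMap C l s D.c (n + 1))⁻¹.2 x) = (D.conj n)⁻¹.2 x := by
    have e : stepMap C l s D.c n * (conjMap C l s D.c (n + 1))⁻¹ = (D.conj n)⁻¹ := by
      rw [conjMap, conj]; group
    rw [← e]; rfl
  show ¬ _ ↔ ¬ _
  rw [this]; rfl

include h in
-- At most `5 q` of the `l q` residues are bad, and the residue of the strip is equidistributed,
-- being the arc index of the image under multiplication by `q k`. So the measure is at most `5 /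
-- l_n`.
lemma volume_not_inner_le (hl : ∀ n, 2 ^ n ≤ l n) (n : ℕ) :
    volume {x | ¬ (2 * qSeq C l n ≤ (D.cellCode (n + 1) x).1 % (l n * qSeq C l n) ∧
      (D.cellCode (n + 1) x).1 % (l n * qSeq C l n) + 3 * qSeq C l n < l n * qSeq C l n)} ≤
      ENNReal.ofReal (5 * (1 / 2) ^ n) := by
  have hq := qSeq_pos h.coeff.C_pos h.coeff.l_pos n
  have hk := kSeq_pos h.coeff.C_pos h.coeff.l_pos n
  have hln := h.coeff.l_pos n
  have hqk : 0 < qSeq C l n * kSeq C l n := Nat.mul_pos hq hk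
  have hB : 0 < l n * qSeq C l n := Nat.mul_pos hln hq
  have hmp := ((measurePreserving_nsmul hqk).comp (measurePreserving_fst (μ := (volume : Measure UnitAddCircle))
    (ν := (volume : Measure UnitAddCircle)))).comp
    (entireGroup.measurePreserving (inv_mem (conjMap_mem C l s D.c (n + 1))))
  set S := Finset.range (2 * qSeq C l n) ∪
    Finset.Ico (l n * qSeq C l n - 3 * qSeq C l n) (l n * qSeq C l n) with hS
  have hcard : S.card ≤ 5 * qSeq C l n := by
    refine (Finset.card_union_le _ _).trans ?_
    rw [Finset.card_range, Nat.card_Ico]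
    omega
  have hmeas : MeasurableSet {w | idx (l n * qSeq C l n) w ∈ S} :=
    measurable_idx _ (MeasurableSet.of_discrete (s := {i | i ∈ S}))
  have hidx : ∀ x, (D.cellCode (n + 1) x).1 % (l n * qSeq C l n) =
      idx (l n * qSeq C l n) ((qSeq C l n * kSeq C l n) • ((conjMap C l s D.c (n + 1))⁻¹.2 x).1) := fun x => by
    rw [idx_nsmul]
    show idx (qSeq C l (n + 1)) _ % _ = _
    rw [qSeq_succ]; rfl
  refine le_trans ?_ (le_trans (volume_idx_mem_le hB S) ?_)
  · rw [← hmp.measure_preimage hmeas.nullMeasurableSet]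
    refine measure_mono fun x hx => ?_
    show idx (l n * qSeq C l n) ((qSeq C l n * kSeq C l n) • ((conjMap C l s D.c (n + 1))⁻¹.2 x).1) ∈ S
    rw [← hidx]
    have hlt : (D.cellCode (n + 1) x).1 % (l n * qSeq C l n) < l n * qSeq C l n := Nat.mod_lt _ hB
    have hx' : ¬ (2 * qSeq C l n ≤ (D.cellCode (n + 1) x).1 % (l n * qSeq C l n) ∧
      (D.cellCode (n + 1) x).1 % (l n * qSeq C l n) + 3 * qSeq C l n < l n * qSeq C l n) := hx
    rw [hS, Finset.mem_union, Finset.mem_range, Finset.mem_Ico]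
    omega
  · refine ENNReal.ofReal_le_ofReal ?_
    have h1 : (S.card : ℝ) ≤ 5 * qSeq C l n := by exact_mod_cast hcard
    have h2 : (0 : ℝ) < qSeq C l n := by exact_mod_cast hq
    have h3 : (2 : ℝ) ^ n ≤ l n := by exact_mod_cast hl n
    have h4 : (0 : ℝ) < l n := by exact_mod_cast hln
    push_cast
    rw [div_le_iff₀ (by positivity)]
    refine h1.trans ?_
    have h5 : (1 : ℝ) ≤ (1 / 2) ^ n * l n := by
      rw [one_div, inv_pow, ← div_eq_inv_mul, one_le_div (by positivity)]
      exact h3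
    nlinarith

include h in
lemma ae_eventually_isGood (hs : ∀ n, 0 < s n) (hl : ∀ n, 2 ^ n ≤ l n) :
    ∀ᵐ x, ∀ᶠ n in atTop, D.IsGood n x := by
  filter_upwards [ae_eventually_notMem_of_le zero_le_one (D.volume_not_rearranged_le h hs),
    ae_eventually_notMem_of_le (by norm_num) (D.volume_not_inner_le h hl)] with x h1 h2
  filter_upwards [h1, h2] with n h3 h4
  simp only [not_not] at h3 h4
  exact ⟨h3, h4.1, h4.2⟩

include h in
-- `jNum_rearranged` places the level-`n` position inside the block containing the level-`n+1`
-- position, and `row` identifies the word of that block with the word of level `n`; `getElem_sub`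
-- then reads off two copies.
lemma nested (hdiv : ∀ n, s n ∣ kSeq C l n) {n : ℕ} {x : Torus} (hx : D.IsGood n x) :
    D.scheme.pos n x ≤ D.scheme.pos (n + 1) x ∧
    D.scheme.pos (n + 1) x + 3 * qSeq C l n < qSeq C l (n + 1) ∧ ∀ i < 2 * qSeq C l n,
      (D.scheme.word (n + 1) x)[D.scheme.pos (n + 1) x - D.scheme.pos n x + i]? =
        (D.scheme.word n x)[i % qSeq C l n]? := by
  have hC := h.coeff.C_pos
  have hl := h.coeff.l_pos
  have hs : ∀ n, 0 < s n := fun n => Nat.pos_of_dvd_of_pos (hdiv n) (kSeq_pos hC hl n)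
  have hq := qSeq_pos hC hl n
  have hk := kSeq_pos hC hl n
  have hB : 0 < l n * qSeq C l n := Nat.mul_pos (hl n) hq
  obtain ⟨⟨hr1, hr2⟩, hleft, hright⟩ := hx
  set y := (D.conj (n + 1))⁻¹.2 x with hy
  set z := (D.conj n)⁻¹.2 x with hz
  set J := (D.cellCode (n + 1) x).1 with hJ
  have hJ' : J = idx (qSeq C l n * kSeq C l n * (l n * qSeq C l n)) y.1 := by
    rw [← qSeq_succ]; rfl
  have hJlt : J < qSeq C l (n + 1) := idx_lt (qSeq_pos hC hl _) _
  have hJB : idx (qSeq C l n * kSeq C l n) y.1 = J / (l n * qSeq C l n) := by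
    rw [hJ', idx_div hB]
  have hJN : idx (qSeq C l n) y.1 = J / (kSeq C l n * (l n * qSeq C l n)) := by
    rw [hJ', mul_assoc, idx_div (Nat.mul_pos hk hB)]
  obtain ⟨hm, -⟩ := index_mod_div hC hl n hJlt
  have hposn : D.scheme.pos n x = (jNum C l (n + 1) J % (l n * qSeq C l n) +
      blockExp C l n (jNum C l (n + 1) J / (l n * qSeq C l n))) % qSeq C l n := by
    rw [← jNum_rearranged hC hl n hJlt, ← hJB, ← hJN, ← hr1]; rfl
  have hP : D.scheme.pos (n + 1) x = jNum C l (n + 1) J := rfl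
  have hPlt : jNum C l (n + 1) J < qSeq C l (n + 1) := jNum_lt hC hl _ _
  rw [hP]
  have hmB : J % (l n * qSeq C l n) = jNum C l (n + 1) J % (l n * qSeq C l n) := by
    have h1 := congrArg (· % (l n * qSeq C l n)) hm
    simpa only [Nat.mod_mul_left_mod] using h1
  have hI : J / (l n * qSeq C l n) % kSeq C l n = jNum C l (n + 1) J / (l n * qSeq C l n) % kSeq C l n := by
    rw [mul_comm (kSeq C l n)] at hm
    rw [← Nat.mod_mul_right_div_self, hm, Nat.mod_mul_right_div_self]
  rw [hmB] at hleft hright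
  set P := jNum C l (n + 1) J with hPdef
  have hαlt : P / (l n * qSeq C l n) < qSeq C l n * kSeq C l n := by
    rw [Nat.div_lt_iff_lt_mul hB, ← qSeq_succ]; exact hPlt
  have hdm := Nat.div_add_mod' P (l n * qSeq C l n)
  have hposlt : D.scheme.pos n x < qSeq C l n := jNum_lt hC hl _ _
  refine ⟨by omega, ?_, fun i hi => ?_⟩
  · have h1 : (P / (l n * qSeq C l n) + 1) * (l n * qSeq C l n) ≤
        qSeq C l n * kSeq C l n * (l n * qSeq C l n) := Nat.mul_le_mul_right _ hαlt
    rw [qSeq_succ]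
    rw [Nat.succ_mul] at h1
    omega
  · rw [D.word_eq hs, D.word_eq hs, D.e_succ]
    set t : Fin (s (n + 1)) := ⟨(D.cellCode (n + 1) x).2, idx_lt (hs (n + 1)) _⟩ with ht
    obtain ⟨hulen, humem⟩ := D.u_mem n t
    have hbs := isBlockStream_twist hC hl (n := n) rfl rfl hulen
      (fun w hw => h.length_eq n w (humem w hw))
    have hget := hbs.getElem_sub hq (blockExp_lt hC hl n) hαlt hleft hright hi
    rw [hposn]
    refine hget.trans ?_
    congr 1
    have hIlt : idx (qSeq C l n * kSeq C l n) y.1 % kSeq C l n < kSeq C l n := Nat.mod_lt _ hk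
    obtain ⟨j, hj, hj'⟩ := D.row n ⟨_, hIlt⟩ t
    have hrow := hr2 hIlt (idx_lt (hs (n + 1)) _)
    have hzj : idx (s n) z.2 = j := by
      have hmul : s n * (s (n + 1) * (kSeq C l n / s n)) = kSeq C l n * s (n + 1) := by
        rw [mul_left_comm, Nat.mul_div_cancel' (hdiv n), mul_comm]
      have hNpos : 0 < s (n + 1) * (kSeq C l n / s n) :=
        Nat.mul_pos (hs _) (Nat.div_pos (Nat.le_of_dvd hk (hdiv n)) (hs n))
      rw [← idx_div hNpos z.2, hmul, hrow]
      exact hj'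
    have hfin : (⟨(D.cellCode n x).2, idx_lt (hs n) _⟩ : Fin (s n)) = j := Fin.ext hzj
    rw [hfin, List.getD_eq_getElem?_getD, ← hI, ← hJB, hj]
    rfl

end RowData

end Limit

/-! ### From the periodic approximations to the limit diffeomorphism. -/

lemma angle_succ {C l : ℕ → ℕ} (hC : ∀ n, 0 < C n) (hl : ∀ n, 0 < l n) (n : ℕ) :
    angle C l (n + 1) = angle C l n + 1 / qSeq C l (n + 1) := by
  have hq : (qSeq C l n : ℝ) ≠ 0 := by exact_mod_cast (qSeq_pos hC hl n).ne'
  have hk : (kSeq C l n : ℝ) ≠ 0 := by exact_mod_cast (kSeq_pos hC hl n).ne'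
  have hl' : (l n : ℝ) ≠ 0 := by exact_mod_cast (hl n).ne'
  rw [angle, angle, pSeq_succ, qSeq_succ]
  push_cast
  field_simp

lemma approx_zero (C l s c : ℕ → ℕ) : approx C l s c 0 = 1 := by
  have : angle C l 0 = 0 := by simp [angle, pSeq]
  rw [approx, this, rot_zero, conjMap]
  simp

lemma approx_inv (C l s c : ℕ → ℕ) (n : ℕ) : (approx C l s c n)⁻¹ =
    conjMap C l s c n * rot (-angle C l n) * (conjMap C l s c n)⁻¹ := by
  rw [approx, rot_neg]; group

lemma approx_inv_eq (C l s c : ℕ → ℕ) (n : ℕ) : (approx C l s c n)⁻¹ =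
    conjMap C l s c (n + 1) * rot (-angle C l n) * (conjMap C l s c (n + 1))⁻¹ := by
  rw [approx_eq, rot_neg]; group

lemma approx_mem (C l s c : ℕ → ℕ) (n : ℕ) : approx C l s c n ∈ entireGroup :=
  entireGroup.conj_rot_mem (conjMap_mem C l s c n) _

lemma tendsto_qSeq {A : Type*} {C l : ℕ → ℕ} {W : ℕ → Set (Word A)} (h : IsTwistedSequence C l W) :
    Tendsto (qSeq C l) atTop atTop :=
  tendsto_atTop_mono (fun n => n.lt_two_pow_self.le.trans (h.two_pow_le_qSeq n)) tendsto_id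

namespace RowData

variable {A : Type*} {C l s : ℕ → ℕ} {W : ℕ → Set (Word A)} (D : RowData C l s W)
  (h : IsTwistedSequence C l W) {ρ : ℝ}
  (hsm : ∀ n, IsSmallAngle C l s D.c ρ n (1 / qSeq C l (n + 1)))

include h hsm in
lemma exists_limit (hρ : 0 < ρ) :
    ∃ T ∈ DiffOmega ρ, ∀ x, Tendsto (fun n => (approx C l s D.c n).2 x) atTop (𝓝 (T x)) := by
  refine exists_limit_mem_DiffOmega hρ (approx_mem C l s D.c) (approx_zero _ _ _ _)
    (fun n z hz => ?_) (fun n z hz => ?_)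
  · have := (hsm n).dist_le z hz
    rwa [← angle_succ h.coeff.C_pos h.coeff.l_pos, ← approx_eq] at this
  · have := (hsm n).dist_inv_le z hz
    rwa [← neg_add, ← angle_succ h.coeff.C_pos h.coeff.l_pos, ← approx_inv_eq, ← approx_inv] at this

include h in
-- In the coordinates of `H_n`, the map `T_n` is the rotation by `p_n / q_n`.
lemma cellCode_approx (n : ℕ) (x : Torus) : D.cellCode n ((approx C l s D.c n).2 x) =
    (((D.cellCode n x).1 + pSeq C l n) % qSeq C l n, (D.cellCode n x).2) := by
  have h1 : (D.conj n)⁻¹.2 ((approx C l s D.c n).2 x) = (rot (angle C l n)).2 ((D.conj n)⁻¹.2 x) := by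
    have : (D.conj n)⁻¹ * approx C l s D.c n = rot (angle C l n) * (D.conj n)⁻¹ := by
      rw [approx, conj]; group
    exact congrArg (fun m : MapPair => m.2 x) this
  rw [cellCode, code, h1, rot_snd, angle]
  exact Prod.ext (idx_add (qSeq_pos h.coeff.C_pos h.coeff.l_pos n) _ _) rfl

include h hsm in
-- Smallness of the angles controls all levels `j ≤ n` at stage `n`. By Borel–Cantelli the level-`n`
-- cell of the image under the `m`-th approximation is therefore constant in `m ≥ n`, and it passes
-- to the limit since cells are locally constant at almost every image point.
lemma ae_eventually_cellCode_eq {T : Torus ≃ₜ Torus} (hT : MeasurePreserving T volume volume)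
    (hlim : ∀ x, Tendsto (fun n => (approx C l s D.c n).2 x) atTop (𝓝 (T x))) :
    ∀ᵐ x, ∀ᶠ n in atTop, D.cellCode n (T x) = D.cellCode n ((approx C l s D.c n).2 x) := by
  have hvol : ∀ n, volume {x | ∃ j ≤ n, D.cellCode j ((approx C l s D.c (n + 1)).2 x) ≠
      D.cellCode j ((approx C l s D.c n).2 x)} ≤ ENNReal.ofReal (1 * (1 / 2) ^ n) := fun n => by
    have := (hsm n).volume_le
    rw [← angle_succ h.coeff.C_pos h.coeff.l_pos, ← approx_eq] at this
    rw [one_mul]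
    exact this
  filter_upwards [ae_eventually_notMem_of_le zero_le_one hvol,
    hT.quasiMeasurePreserving.ae (ae_all_iff.2 fun j =>
      ae_eventually_code_eq (conjMap_mem C l s D.c j) (qSeq C l j) (s j))] with x h1 h2
  obtain ⟨N, hN⟩ := eventually_atTop.1 h1
  refine eventually_atTop.2 ⟨N, fun n hn => ?_⟩
  have hconst : ∀ m ≥ n, D.cellCode n ((approx C l s D.c m).2 x) =
      D.cellCode n ((approx C l s D.c n).2 x) := fun m hm => by
    induction m, hm using Nat.le_induction with
    | base => rfl
    | succ m hm ih =>
      rw [← ih]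
      by_contra hne
      exact hN m (by omega) ⟨n, hm, hne⟩
  obtain ⟨m, hm, hm'⟩ := (((hlim x).eventually (h2 n)).and (eventually_ge_atTop n)).exists
  exact hm.symm.trans (hconst m hm')

include h hsm in
theorem ae_isRegular (hdiv : ∀ n, s n ∣ kSeq C l n) (hl : ∀ n, 2 ^ n ≤ l n) {T : Torus ≃ₜ Torus}
    (hT : MeasurePreserving T volume volume)
    (hlim : ∀ x, Tendsto (fun n => (approx C l s D.c n).2 x) atTop (𝓝 (T x))) :
    ∀ᵐ x, D.scheme.IsRegular C l T x := by
  have hs : ∀ n, 0 < s n := fun n =>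
    Nat.pos_of_dvd_of_pos (hdiv n) (kSeq_pos h.coeff.C_pos h.coeff.l_pos n)
  filter_upwards [D.ae_eventually_isGood h hs hl, D.ae_eventually_cellCode_eq h hsm hT hlim] with x h1 h2
  refine ⟨?_, fun M => ?_, ?_⟩
  · filter_upwards [h2] with n hn
    rw [D.cellCode_approx h] at hn
    constructor
    · rw [D.word_eq hs, D.word_eq hs]
      simp only [hn]
    · show jNum C l n (D.cellCode n (T x)).1 = _
      rw [hn]
      exact jNum_add_pSeq h.coeff.C_pos h.coeff.l_pos n _
  · obtain ⟨N, hN⟩ := eventually_atTop.1 (h1.and ((tendsto_qSeq h).eventually_ge_atTop M))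
    refine eventually_atTop.2 ⟨N + 1, fun n hn => ?_⟩
    obtain ⟨m, rfl⟩ := Nat.exists_eq_add_of_le' (show 1 ≤ n by omega)
    obtain ⟨hgood, hM⟩ := hN m (by omega)
    have := (D.nested h hdiv hgood).2.1
    omega
  · filter_upwards [h1] with n hn
    have := D.nested h hdiv hn
    exact ⟨this.1, this.2.2⟩

include h hsm in
-- Equal positions and words mean equal cells at every large level. Through the good rearrangement a
-- common cell of level `n + 2` puts the preimages under `H_{n+1}` in a common strip of width
-- `1/q_{n+1}` and a common fine row, at distance at most `1/q_{n+1}`. `dist_conj_le` turns this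
-- into distance `2^{-n}` of the points.
theorem eq_of_eventually_eq (hdiv : ∀ n, s n ∣ kSeq C l n) {x y : Torus}
    (hx : ∀ᶠ n in atTop, D.IsGood n x) (hy : ∀ᶠ n in atTop, D.IsGood n y)
    (hxy : ∀ᶠ n in atTop, D.scheme.pos n x = D.scheme.pos n y ∧ D.scheme.word n x = D.scheme.word n y) :
    x = y := by
  have hC := h.coeff.C_pos
  have hl := h.coeff.l_pos
  have hs : ∀ n, 0 < s n := fun n => Nat.pos_of_dvd_of_pos (hdiv n) (kSeq_pos hC hl n)
  have hcell : ∀ᶠ n in atTop, D.cellCode n x = D.cellCode n y := by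
    filter_upwards [hxy] with n hn
    refine Prod.ext (jNum_injOn hC hl n (idx_lt (qSeq_pos hC hl n) _) (idx_lt (qSeq_pos hC hl n) _) hn.1) ?_
    have := hn.2
    rw [D.word_eq hs, D.word_eq hs] at this
    exact congrArg Fin.val (D.e_inj n this)
  obtain ⟨N, hN⟩ := eventually_atTop.1 (hcell.and (hx.and hy))
  have hdist : ∀ n ≥ N, dist x y ≤ (1 / 2) ^ n := fun n hn => by
    obtain ⟨-, hgx, hgy⟩ := hN (n + 1) (by omega)
    have hc : D.cellCode (n + 2) x = D.cellCode (n + 2) y := (hN (n + 2) (by omega)).1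
    have hq := qSeq_pos hC hl (n + 1)
    have hk := kSeq_pos hC hl (n + 1)
    have hB : 0 < l (n + 1) * qSeq C l (n + 1) := Nat.mul_pos (hl _) hq
    have hc1 : idx (qSeq C l (n + 2)) ((D.conj (n + 2))⁻¹.2 x).1 =
        idx (qSeq C l (n + 2)) ((D.conj (n + 2))⁻¹.2 y).1 := congrArg Prod.fst hc
    have hc2 : idx (s (n + 2)) ((D.conj (n + 2))⁻¹.2 x).2 =
        idx (s (n + 2)) ((D.conj (n + 2))⁻¹.2 y).2 := congrArg Prod.snd hc
    rw [qSeq_succ] at hc1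
    have hc3 : idx (qSeq C l (n + 1) * kSeq C l (n + 1)) ((D.conj (n + 2))⁻¹.2 x).1 =
        idx (qSeq C l (n + 1) * kSeq C l (n + 1)) ((D.conj (n + 2))⁻¹.2 y).1 := by
      rw [← idx_div hB, hc1, idx_div hB]
    have hc4 : idx (qSeq C l (n + 1)) ((D.conj (n + 2))⁻¹.2 x).1 =
        idx (qSeq C l (n + 1)) ((D.conj (n + 2))⁻¹.2 y).1 := by
      rw [← idx_div hk, hc3, idx_div hk]
    have hi := Nat.mod_lt (idx (qSeq C l (n + 1) * kSeq C l (n + 1)) ((D.conj (n + 2))⁻¹.2 y).1) hk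
    have hz1 : idx (qSeq C l (n + 1)) ((D.conj (n + 1))⁻¹.2 x).1 =
        idx (qSeq C l (n + 1)) ((D.conj (n + 1))⁻¹.2 y).1 := by
      rw [hgx.rearranged.1, hgy.rearranged.1, hc3, hc4]
    have hz2 : idx (kSeq C l (n + 1) * s (n + 2)) ((D.conj (n + 1))⁻¹.2 x).2 =
        idx (kSeq C l (n + 1) * s (n + 2)) ((D.conj (n + 1))⁻¹.2 y).2 := by
      rw [hgx.rearranged.2 (by rw [hc3]; exact hi) (idx_lt (hs _) _),
        hgy.rearranged.2 hi (idx_lt (hs _) _)]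
      simp only [hc3, hc2]
    have hqk : qSeq C l (n + 1) ≤ kSeq C l (n + 1) * s (n + 2) := by
      have h1 := hs (n + 2)
      have h2 := hC (n + 1)
      have h3 := Nat.one_le_two_pow (n := n + 1 + 2)
      calc qSeq C l (n + 1) = 1 * qSeq C l (n + 1) * 1 * 1 := by ring
        _ ≤ 2 ^ (n + 1 + 2) * qSeq C l (n + 1) * C (n + 1) * s (n + 2) := by gcongr <;> omega
    have hq' : (0 : ℝ) < qSeq C l (n + 1) := by exact_mod_cast hq
    have hd : dist ((D.conj (n + 1))⁻¹.2 x) ((D.conj (n + 1))⁻¹.2 y) ≤ 1 / qSeq C l (n + 1) := by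
      rw [Prod.dist_eq]
      refine max_le (dist_le_of_idx_eq hq hz1) ((dist_le_of_idx_eq (Nat.mul_pos hk (hs _)) hz2).trans ?_)
      exact one_div_le_one_div_of_le hq' (by exact_mod_cast hqk)
    have hfin := (hsm n).dist_conj_le _ _ hd
    have he : ∀ w, (conjMap C l s D.c (n + 1)).2 ((D.conj (n + 1))⁻¹.2 w) = w := fun w =>
      (conjMap C l s D.c (n + 1)).2.apply_symm_apply w
    rwa [he, he] at hfin
  refine dist_le_zero.1 (ge_of_tendsto (tendsto_pow_atTop_nhds_zero_of_lt_one
    (r := (1 / 2 : ℝ)) (by norm_num) (by norm_num)) (eventually_atTop.2 ⟨N, hdist⟩))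

include h hsm in
theorem isIsomorphic [Finite A] (hρ : 0 < ρ) (hcard : ∀ n, (W n).ncard = s n)
    (hdiv : ∀ n, s n ∣ kSeq C l n) (hbal : IsBalanced C l W fun n => kSeq C l n / s n)
    (hl10 : ∀ n, 10 ≤ l n) (hl : ∀ n, 2 ^ n ≤ l n) :
    (∃! ν : Measure (symbolicShift W), IsNonatomicErgodic W ν) ∧
      ∀ ν : Measure (symbolicShift W), IsNonatomicErgodic W ν →
        ∃ T ∈ DiffOmega ρ, IsIsomorphic (volume : Measure Torus) T ν (shift W) := by
  have hC := h.coeff.C_pos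
  have hlpos := h.coeff.l_pos
  have hs : ∀ n, 0 < s n := fun n => Nat.pos_of_dvd_of_pos (hdiv n) (kSeq_pos hC hlpos n)
  obtain ⟨T, hT, hlim⟩ := D.exists_limit h hsm hρ
  have hmeas : ∀ n, Measurable (D.cellCode n) := fun n => measurable_code _ _ _
  have hatom : ∀ x : Torus, (volume : Measure Torus) {x} = 0 := fun x => by
    rw [← Set.singleton_prod_singleton (a := x.1) (b := x.2), Measure.volume_eq_prod, Measure.prod_prod]
    simp
  have key := isIsomorphic_of_codingScheme (G := {x | ∀ᶠ n in atTop, D.IsGood n x}) hatom hT.1 h hl10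
    (fun n => Set.finite_of_ncard_pos (by rw [hcard]; exact hs n))
    (fun n => Set.nonempty_of_ncard_ne_zero (by rw [hcard]; exact (hs n).ne')) hbal D.scheme
    (fun n x => by rw [D.word_eq hs]; exact D.e_mem _ _) (fun n x => jNum_lt hC hlpos _ _)
    (fun n => (measurable_of_countable fun p : ℕ × ℕ => jNum C l n p.1).comp (hmeas n))
    (fun n w => hmeas n (MeasurableSet.of_discrete (s := {p : ℕ × ℕ |
      (if hs : p.2 < s n then D.e n ⟨p.2, hs⟩ else []) = w})))
    (D.ae_isRegular h hsm hdiv hl hT.1 hlim) (D.ae_eventually_isGood h hs hl)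
    (fun x hx y hy hxy => D.eq_of_eventually_eq h hsm hdiv hx hy hxy)
  exact ⟨key.1, fun ν hν => ⟨T, hT, key.2 ν hν⟩⟩

end RowData

/-- The number of letters is the number of words of level `0`. -/
lemma ncard_zero_eq {A : Type*} [Finite A] {C l s : ℕ → ℕ} {W : ℕ → Set (Word A)}
    (h : IsTwistedSequence C l W) (hs : s 0 ∣ kSeq C l 0) (hne : (W 1).Nonempty)
    (hbal : IsBalanced C l W fun n => kSeq C l n / s n) : (W 0).ncard = s 0 := by
  classical
  have hk := kSeq_pos h.coeff.C_pos h.coeff.l_pos 0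
  obtain ⟨w', hw'⟩ := hne
  obtain ⟨P, hP, -, hW⟩ := h.succ 0
  obtain ⟨u, hu, hu'⟩ := hW.subset hw'
  obtain ⟨hulen, humem⟩ := hP hu
  have hfin : (W 0).Finite := by rw [h.zero]; exact Set.finite_range _
  have hcount := fun w hw => hbal 0 w' hw' w hw u (hP hu) hu'.symm
  -- The size of `W 0` is not prescribed. It follows by counting the entries of one tuple according
  -- to their value, each letter occurring `k_0 / s_0` times.
  have hsum : kSeq C l 0 = hfin.toFinset.card * (kSeq C l 0 / s 0) := by
    have h1 : (Finset.range (kSeq C l 0)).card =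
        ∑ w ∈ hfin.toFinset, ((Finset.range (kSeq C l 0)).filter fun j => u[j]? = some w).card := by
      rw [← Finset.card_biUnion]
      · congr 1
        ext j
        simp only [Finset.mem_range, Finset.mem_biUnion, Set.Finite.mem_toFinset, Finset.mem_filter]
        constructor
        · intro hj
          have hlt : j < u.length := by rw [hulen]; exact hj
          exact ⟨u[j], humem _ (List.getElem_mem hlt), hj, List.getElem?_eq_getElem hlt⟩
        · rintro ⟨w, -, hj, -⟩; exact hj
      · intro w _ w₂ _ hne
        refine Finset.disjoint_left.2 fun j hj hj' => hne ?_
        rw [Finset.mem_filter] at hj hj'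
        exact Option.some_inj.1 (hj.2.symm.trans hj'.2)
    rw [Finset.card_range] at h1
    conv_lhs => rw [h1]
    rw [Finset.sum_const_nat fun w hw => ?_]
    refine Eq.trans ?_ (hcount w (hfin.mem_toFinset.1 hw))
    rw [← Set.ncard_coe_finset]
    congr 1
    ext j
    simp
  rw [Set.ncard_eq_toFinset_card _ hfin]
  obtain ⟨d, hd⟩ := hs
  have hs0 : 0 < s 0 := Nat.pos_of_ne_zero fun h0 => by rw [h0, zero_mul] at hd; omega
  rw [hd, Nat.mul_div_cancel_left _ hs0] at hsum
  have hd0 : 0 < d := Nat.pos_of_ne_zero fun h0 => by rw [h0, mul_zero] at hd; omega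
  exact (Nat.eq_of_mul_eq_mul_right hd0 hsum).symm

end TwistedSystem

theorem theorem53 (ρ : ℝ) (hρ : 0 < ρ) :
    -- the growth threshold for `l n`, in terms of `k 0, …, k n`, `l 0, …, l (n-1)`, `s 0, …, s (n+1)`
    ∃ L : List ℕ → List ℕ → List ℕ → ℕ,
      ∀ (k l s C : ℕ → ℕ),
        Tendsto k atTop atTop → Tendsto l atTop atTop → Tendsto s atTop atTop →
        (∀ n, L ((List.range (n + 1)).map k) ((List.range n).map l) ((List.range (n + 2)).map s)
          ≤ l n) →
        (∀ n, 0 < C n) → (∀ n, k n = 2 ^ (n + 2) * qSeq C l n * C n) →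
        (∀ n, s n ∣ k n ∧ s n ∣ s (n + 1)) →
      ∀ (A : Type*) [Finite A] [Nonempty A] (W : ℕ → Set (Word A)),
        IsTwistedSequence C l W →
        (∀ n, (W (n + 1)).ncard = s (n + 1)) →
        (∀ n, ∀ w' ∈ W (n + 1), ∀ w ∈ W n, ∀ u ∈ tuples (W n) (k n), w' = twist C l n u →
          {j : ℕ | j < k n ∧ u[j]? = some w}.ncard = k n / s n) →
      (∃! ν : Measure (symbolicShift W), IsNonatomicErgodic W ν) ∧
      ∀ ν : Measure (symbolicShift W), IsNonatomicErgodic W ν →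
        ∃ T ∈ DiffOmega ρ, IsIsomorphic (volume : Measure Torus) T ν (shift W) := by
  refine ⟨growthBound ρ, fun k l s C _ _ _ hL hC hk hdiv A _ _ W h hcard hbal => ?_⟩
  obtain rfl : k = kSeq C l := funext hk
  have hkpos := kSeq_pos hC h.coeff.l_pos
  have hdiv' : ∀ n, s n ∣ kSeq C l n := fun n => (hdiv n).1
  have hs : ∀ n, 0 < s n := fun n => Nat.pos_of_dvd_of_pos (hdiv' n) (hkpos n)
  have hcard' : ∀ n, (W n).ncard = s n := fun n => by
    cases n with
    | zero =>
      exact ncard_zero_eq h (hdiv' 0)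
        (Set.nonempty_of_ncard_ne_zero (by rw [hcard]; exact (hs 1).ne')) hbal
    | succ n => exact hcard n
  obtain ⟨D⟩ := nonempty_rowData h hcard' hs hdiv' hbal
  refine D.isIsomorphic h (fun n => ?_) hρ hcard' hdiv' hbal (fun n => (le_of_growthBound (hL n)).1)
    fun n => (le_of_growthBound (hL n)).2
  have hq := qSeq_pos hC h.coeff.l_pos n
  have hq' : (0 : ℝ) < qSeq C l (n + 1) := by exact_mod_cast qSeq_pos hC h.coeff.l_pos (n + 1)
  -- The additional angle at stage `n` is `β = 1 / q_{n+1}`, and `β l_n ≤ 1` because `l_n` divides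
  -- `q_{n+1}`.
  refine isSmallAngle_of_growthBound (hL n) (fun m _ => ?_) (fun m _ => D.c_lt m) (by positivity) ?_
  · exact Nat.le_mul_of_pos_left _ (Nat.mul_pos (by positivity) (qSeq_pos hC h.coeff.l_pos m))
  · rw [one_div, inv_mul_le_iff₀ hq', mul_one, qSeq_succ]
    have : l n ≤ qSeq C l n * kSeq C l n * (l n * qSeq C l n) := by
      have := hkpos n
      calc l n = 1 * 1 * (l n * 1) := by ring
        _ ≤ _ := by gcongr <;> omega
    exact_mod_cast this
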